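/- Let $X$ be an infinite, totally disconnected, compact metrizable space, $T$ a homeomorphism of $X$, $\mu$ an ergodic $T$-invariant Borel probability measure on $X$ that is full (i.e. $\mu(U)>0$ for every nonempty open $U$), and $K$ a field. Let $C_K(X)$ be the algebra of locally constant functions $X\to K$ and $\mathcal A=C_K(X)\rtimes_T\mathbb Z$ the algebraic crossed product, i.e. the algebra of finite sums $\sum_i f_it^i$ ($f_i\in C_K(X)$) with $tf=(f\circ T^{-1})t$. Let $y\in X$, let $E_1\supseteq E_2\supseteq\cdots$ be clopen sets with $\bigcap_nE_n=\{y\}$, and let $\mathcal P_n$ be finite partitions of $X\setminus E_n$ into nonempty clopen sets such that $\mathcal P_{n+1}\cup\{E_{n+1}\}$ refines $\mathcal P_n\cup\{E_n\}$ for all $n$ and $\bigcup_n(\mathcal P_n\cup\{E_n\})$ generates the topology of $X$. Let $\mathcal A_n\subseteq\mathcal A$ be the unital subalgebra generated by the elements $\chi_Zt$ and $t^{-1}\chi_Z$ ($Z\in\mathcal P_n$), and $\mathcal A_\infty=\bigcup_n\mathcal A_n$. Let $\mathbb V_n$ be the set of all nonempty sets $$W=E_n\cap T^{-1}(Z_1)\cap\cdots\cap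 T^{-k+1}(Z_{k-1})\cap T^{-k}(E_n),\qquad k\ge1,\ Z_1,\dots,Z_{k-1}\in\mathcal P_n,$$ write $|W|=k$, and put $h_W=\sum_{l=0}^{|W|-1}\chi_{T^l(W)}$ and $e_{ij}(W)=(\chi_{X\setminus E_n}t)^i\chi_W(t^{-1}\chi_{X\setminus E_n})^j$ for $0\le i,j<|W|$. Let $\mathfrak R_n=\prod_{W\in\mathbb V_n}M_{|W|}(K)$ and let $\pi_n:\mathcal A_n\to\mathfrak R_n$, $\pi_n(a)=(h_Wa)_W$, where $h_W\mathcal A_n$ is identified with $M_{|W|}(K)$ through the matrix units $e_{ij}(W)$. Let $j_n:\mathfrak R_n\to\mathfrak R_{n+1}$ be the block diagonal embedding whose $W'$-component ($W'\in\mathbb V_{n+1}$) has one diagonal block $a_W$, starting in row and column $j'$ (rows and columns being numbered from $0$), for each pair $(W,j')$ with $W\in\mathbb V_n$, $0\le j'\le|W'|-1$ and $W'\subseteq T^{-j'}(W)$. Let $\mathfrak R_\infty=\varinjlim(\mathfrak R_n,j_n)$, and let $\mathrm{rk}_{\mathfrak R_\infty}$ be the function on $\mathfrak R_\infty$ induced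 by the functions $\mathrm{rk}_{\mathfrak R_n}(x)=\sum_{W\in\mathbb V_n}|W|\,\mu(W)\cdot\frac{\mathrm{Rk}(x_W)}{|W|}$, where $\mathrm{Rk}$ is the usual rank of matrices. Let $\mathfrak R_{\mathrm{rk}}$ be the completion of $\mathfrak R_\infty$ in the metric $\mathrm{rk}_{\mathfrak R_\infty}(x-y)$, and $\mathrm{rk}_{\mathfrak R_{\mathrm{rk}}}$ the continuous extension of $\mathrm{rk}_{\mathfrak R_\infty}$ to it. Then $\mathfrak R_\infty$ is a von Neumann regular ring, $\mathrm{rk}_{\mathfrak R_\infty}$ is a rank function on it, and $\mathrm{rk}_{\mathfrak R_{\mathrm{rk}}}$ extends to a Sylvester matrix rank function on $\mathfrak R_{\mathrm{rk}}$. There is an injective $K$-algebra homomorphism $\Phi:\mathcal A\to\mathfrak R_{\mathrm{rk}}$ which on each $\mathcal A_n$ is the composition of $\pi_n$ with the canonical map $\mathfrak R_n\to\mathfrak R_\infty\to\mathfrak R_{\mathrm{rk}}$, such that $\mathrm{rk}_{\mathcal A}(M)=\mathrm{rk}_{\mathfrak R_{\mathrm{rk}}}(\Phi(M))$ ($M$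 a matrix over $\mathcal A$) is a faithful Sylvester matrix rank function on $\mathcal A$ and its restriction $\mathrm{rk}_{\mathcal A_\infty}$ is a faithful Sylvester matrix rank function on $\mathcal A_\infty$. Moreover $\mathfrak R_{\mathrm{rk}}$, with the map $\Phi$ (respectively $\Phi|_{\mathcal A_\infty}$), is the completion of $\mathcal A$ (respectively $\mathcal A_\infty$) in the metric given by $\mathrm{rk}_{\mathcal A}$ (respectively $\mathrm{rk}_{\mathcal A_\infty}$). -/

import Mathlib

open TopologicalSpace MeasureTheory

namespace RankCrossed

section Dynamics

variable {X : Type*} [TopologicalSpace X]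

/-- The translate `T ^ n (U)` of a clopen set `U`, for `n : ℤ`. -/
def translate (T : X ≃ₜ X) (n : ℤ) (U : Clopens X) : Clopens X :=
  ⟨(T ^ n) '' (U : Set X), (T ^ n).isClosed_image.2 U.isClosed, (T ^ n).isOpen_image.2 U.isOpen⟩

theorem zpow_add_apply (T : X ≃ₜ X) (m n : ℤ) (x : X) :
    (T ^ (m + n)) x = (T ^ m) ((T ^ n) x) := by
  rw [zpow_add]; rfl

theorem zpow_neg_apply (T : X ≃ₜ X) (n : ℤ) (x : X) : (T ^ (-n)) ((T ^ n) x) = x := by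
  rw [← zpow_add_apply, neg_add_cancel]; rfl

theorem zpow_apply_neg (T : X ≃ₜ X) (n : ℤ) (x : X) : (T ^ n) ((T ^ (-n)) x) = x := by
  rw [← zpow_add_apply, add_neg_cancel]; rfl

theorem mem_translate (T : X ≃ₜ X) (n : ℤ) (U : Clopens X) (x : X) :
    x ∈ translate T n U ↔ (T ^ (-n)) x ∈ U := by
  constructor
  · rintro ⟨z, hz, rfl⟩
    rw [zpow_neg_apply]; exact hz
  · intro h
    exact ⟨_, h, zpow_apply_neg T n x⟩

theorem mem_translate_neg (T : X ≃ₜ X) (n : ℤ) (U : Clopens X) (x : X) :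
    x ∈ translate T (-n) U ↔ (T ^ n) x ∈ U := by
  rw [mem_translate, neg_neg]

/-- The cells of a partition `P` of `X \ E` together with `E` itself: the partition `P ∪ {E}`. -/
def cells {E : Clopens X} (P : Finpartition Eᶜ) : Set (Clopens X) :=
  insert E (P.parts : Set (Clopens X))

/-- For a word `Z₁, …, Z_{k-1}` of elements of `P`, the set
`E ∩ T⁻¹(Z₁) ∩ ⋯ ∩ T^{-k+1}(Z_{k-1}) ∩ T^{-k}(E)`. -/
def returnSet (T : X ≃ₜ X) {E : Clopens X} {P : Finpartition Eᶜ}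
    (w : List {Z // Z ∈ P.parts}) : Clopens X :=
  E ⊓ (Finset.univ.inf fun i : Fin w.length => translate T (-((i : ℤ) + 1)) (w.get i).1) ⊓
    translate T (-((w.length : ℤ) + 1)) E

/-- The nonempty sets `W = E ∩ T⁻¹(Z₁) ∩ ⋯ ∩ T^{-k+1}(Z_{k-1}) ∩ T^{-k}(E)` with `k ≥ 1` and
`Z₁, …, Z_{k-1} ∈ P`, recorded by their words `Z₁, …, Z_{k-1}`. (Different words have disjoint
sets, see `Tower.eq_of_mem`, so this is the same as recording the sets.) -/
@[ext] structure Tower (T : X ≃ₜ X) {E : Clopens X} (P : Finpartition Eᶜ) where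
  /-- the word `Z₁, …, Z_{k-1}` -/
  word : List {Z // Z ∈ P.parts}
  nonempty : (returnSet T word : Set X).Nonempty

namespace Tower

variable {T : X ≃ₜ X} {E : Clopens X} {P : Finpartition Eᶜ}

/-- The set `W` itself, the base of the tower. -/
def base (W : Tower T P) : Clopens X := returnSet T W.word

/-- The length `|W| = k` of `W`. -/
def len (W : Tower T P) : ℕ := W.word.length + 1

theorem len_pos (W : Tower T P) : 0 < W.len := Nat.succ_pos _

theorem mem_inf {ι : Type*} (s : Finset ι) (f : ι → Clopens X) (x : X) :
    x ∈ s.inf f ↔ ∀ i ∈ s, x ∈ f i := by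
  classical
  induction s using Finset.induction_on with
  | empty => simp only [Finset.inf_empty, Finset.notMem_empty, false_imp_iff, implies_true, iff_true]
             exact Set.mem_univ x
  | insert a s _ ih =>
    rw [Finset.inf_insert, Finset.forall_mem_insert, ← ih]; exact Iff.rfl

theorem mem_base (W : Tower T P) (x : X) :
    x ∈ W.base ↔ x ∈ E ∧
      (∀ i (h : i < W.word.length), (T ^ ((i : ℤ) + 1)) x ∈ (W.word[i]).1) ∧
      (T ^ (W.len : ℤ)) x ∈ E := by
  have h1 : x ∈ W.base ↔ (x ∈ E ∧ x ∈ (Finset.univ.inf fun i : Fin W.word.length =>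
      translate T (-((i : ℤ) + 1)) (W.word.get i).1)) ∧
      x ∈ translate T (-((W.word.length : ℤ) + 1)) E := Iff.rfl
  rw [h1, mem_inf, mem_translate_neg, and_assoc]
  simp only [mem_translate_neg, Finset.mem_univ, true_imp_iff, Fin.forall_iff, len]
  push_cast
  exact Iff.rfl

theorem mem_parts_notMem {Z : Clopens X} (hZ : Z ∈ P.parts) {x : X} (hx : x ∈ Z) : x ∉ E := by
  have : Z ≤ Eᶜ := P.le hZ
  exact this hx

theorem cell_unique {Z Z' : Clopens X} (hZ : Z ∈ cells P) (hZ' : Z' ∈ cells P) {x : X}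
    (hx : x ∈ Z) (hx' : x ∈ Z') : Z = Z' := by
  rcases hZ with rfl | hZ <;> rcases hZ' with rfl | hZ'
  · rfl
  · exact absurd hx (mem_parts_notMem hZ' hx')
  · exact absurd hx' (mem_parts_notMem hZ hx)
  · by_contra hne
    have := Clopens.coe_disjoint.2 (P.disjoint hZ hZ' hne)
    exact Set.disjoint_left.1 this hx hx'

theorem exists_part {x : X} (hx : x ∉ E) : ∃ Z ∈ P.parts, x ∈ Z := by
  have h : x ∈ ((P.parts.sup id : Clopens X) : Set X) := by rw [P.sup_parts]; exact hx
  rw [Clopens.coe_finset_sup] at h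
  simpa using h

/-- The points of `W` first return to `E` at time `|W|`. -/
theorem notMem_of_lt (W : Tower T P) {x : X} (hx : x ∈ W.base) {i : ℕ} (h0 : 0 < i)
    (hi : i < W.len) : (T ^ (i : ℤ)) x ∉ E := by
  obtain ⟨j, rfl⟩ : ∃ j, i = j + 1 := ⟨i - 1, by omega⟩
  have hj : j < W.word.length := by simpa [len] using hi
  have := ((W.mem_base x).1 hx).2.1 j hj
  push_cast
  exact mem_parts_notMem (W.word[j]).2 this

theorem mem_E (W : Tower T P) {x : X} (hx : x ∈ W.base) : x ∈ E := ((W.mem_base x).1 hx).1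

theorem mem_E_len (W : Tower T P) {x : X} (hx : x ∈ W.base) : (T ^ (W.len : ℤ)) x ∈ E :=
  ((W.mem_base x).1 hx).2.2

theorem len_le (W : Tower T P) {x : X} (hx : x ∈ W.base) {i : ℕ} (h0 : 0 < i)
    (hi : (T ^ (i : ℤ)) x ∈ E) : W.len ≤ i := by
  by_contra h
  exact W.notMem_of_lt hx h0 (not_le.1 h) hi

theorem eq_of_mem {W W' : Tower T P} {x : X} (hx : x ∈ W.base) (hx' : x ∈ W'.base) :
    W = W' := by
  have hl : W.len = W'.len := le_antisymm (W.len_le hx W'.len_pos (W'.mem_E_len hx'))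
    (W'.len_le hx' W.len_pos (W.mem_E_len hx))
  have hl' : W.word.length = W'.word.length := by simpa [len] using hl
  refine Tower.ext (List.ext_getElem hl' fun i h1 h2 => Subtype.ext ?_)
  exact cell_unique (Or.inr (W.word[i]).2) (Or.inr (W'.word[i]).2)
    (((W.mem_base x).1 hx).2.1 i h1) (((W'.mem_base x).1 hx').2.1 i h2)

/-- The levels `T ^ l (W)`, `0 ≤ l < |W|`, of all towers are pairwise disjoint. -/
theorem level_unique {W W' : Tower T P} {x x' : X} (hx : x ∈ W.base) (hx' : x' ∈ W'.base)
    {l l' : ℕ} (hl : l < W.len) (hl' : l' < W'.len)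
    (h : (T ^ (l : ℤ)) x = (T ^ (l' : ℤ)) x') : l = l' ∧ x = x' ∧ W = W' := by
  have key : ∀ {W W' : Tower T P} {x x' : X} (_ : x ∈ W.base) (_ : x' ∈ W'.base)
      {l l' : ℕ} (_ : l < W.len) (_ : l' < W'.len)
      (_ : (T ^ (l : ℤ)) x = (T ^ (l' : ℤ)) x'), l' ≤ l := by
    intro W W' x x' hx hx' l l' hl hl' h
    by_contra hlt
    push Not at hlt
    have h2 : x = (T ^ ((l' - l : ℕ) : ℤ)) x' := by
      rw [← zpow_neg_apply T l x, h, ← zpow_add_apply]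
      congr 2; omega
    exact W'.notMem_of_lt hx' (i := l' - l) (by omega) (by omega) (h2 ▸ W.mem_E hx)
  have hll : l = l' := le_antisymm (key hx' hx hl' hl h.symm) (key hx hx' hl hl' h)
  subst hll
  have hxx : x = x' := (T ^ (l : ℤ)).injective h
  subst hxx
  exact ⟨rfl, rfl, eq_of_mem hx hx'⟩

/-- A point of `E` which returns to `E` lies in the base of a tower. -/
theorem exists_of_return {x : X} (hx : x ∈ E) {k : ℕ} (h0 : 0 < k)
    (hk : (T ^ (k : ℤ)) x ∈ E) : ∃ W : Tower T P, x ∈ W.base := by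
  classical
  have hex : ∃ k : ℕ, 0 < k ∧ (T ^ (k : ℤ)) x ∈ E := ⟨k, h0, hk⟩
  obtain ⟨hm0, hm⟩ := Nat.find_spec hex
  set m := Nat.find hex with hmdef
  have hlt : ∀ i : Fin (m - 1), ∃ Z ∈ P.parts, (T ^ ((i : ℤ) + 1)) x ∈ Z := by
    intro i
    apply exists_part
    have := Nat.find_min hex (m := i + 1) (by omega)
    push_cast at this
    intro h
    exact this ⟨Nat.succ_pos _, h⟩
  choose Z hZ hxZ using hlt
  let w : List {Z // Z ∈ P.parts} := List.ofFn fun i => ⟨Z i, hZ i⟩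
  have hwl : w.length = m - 1 := by simp [w]
  have hxw : x ∈ returnSet T w := by
    refine ⟨⟨hx, ?_⟩, ?_⟩
    · change x ∈ Finset.univ.inf fun i : Fin w.length =>
        translate T (-((i : ℤ) + 1)) (w.get i).1
      rw [mem_inf]
      rintro i -
      rw [mem_translate_neg]
      have := hxZ ⟨i, by omega⟩
      simpa [w] using this
    · change x ∈ translate T _ E
      rw [mem_translate_neg, hwl]
      have : ((m - 1 : ℕ) : ℤ) + 1 = m := by omega
      rw [this]; exact hm
  exact ⟨⟨w, x, hxw⟩, hxw⟩

instance : Countable (Tower T P) :=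
  Function.Injective.countable (f := Tower.word) fun _ _ h => Tower.ext h

end Tower

/-- The arrows ending at the tower `W'` of the finer level: pairs `(W, j)` of a tower `W` of the
coarser level and `0 ≤ j < |W'|` with `W' ⊆ T⁻ʲ(W)`. -/
def Arrow {T : X ≃ₜ X} {E E' : Clopens X} (P : Finpartition Eᶜ) {P' : Finpartition E'ᶜ}
    (W' : Tower T P') : Type _ :=
  {a : Tower T P × ℕ // a.2 < W'.len ∧ W'.base ≤ translate T (-(a.2 : ℤ)) a.1.base}

namespace Arrow

variable {T : X ≃ₜ X} {E E' : Clopens X} {P : Finpartition Eᶜ} {P' : Finpartition E'ᶜ}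
  {W' : Tower T P'}

/-- The source `W` of an arrow `(W, j)`. -/
def source (a : Arrow P W') : Tower T P := a.1.1

/-- The position `j` of an arrow `(W, j)`. -/
def pos (a : Arrow P W') : ℕ := a.1.2

theorem pos_lt (a : Arrow P W') : a.pos < W'.len := a.2.1

theorem mem_source (a : Arrow P W') {x : X} (hx : x ∈ W'.base) :
    (T ^ (a.pos : ℤ)) x ∈ a.source.base := by
  have := a.2.2 hx
  exact (mem_translate_neg T _ _ _).1 this

theorem ext {a b : Arrow P W'} (h1 : a.source = b.source) (h2 : a.pos = b.pos) : a = b :=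
  Subtype.ext (Prod.ext h1 h2)

theorem pos_add_len_le (hE : E' ≤ E) (a : Arrow P W') : a.pos + a.source.len ≤ W'.len := by
  obtain ⟨x, hx⟩ := W'.nonempty
  have hx : x ∈ W'.base := hx
  have h1 := a.mem_source hx
  have h2 : (T ^ ((W'.len - a.pos : ℕ) : ℤ)) ((T ^ (a.pos : ℤ)) x) ∈ E := by
    rw [← zpow_add_apply]
    have : ((W'.len - a.pos : ℕ) : ℤ) + (a.pos : ℤ) = W'.len := by have := a.pos_lt; omega
    rw [this]
    exact hE (W'.mem_E_len hx)
  have := a.source.len_le h1 (by have := a.pos_lt; omega) h2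
  have := a.pos_lt
  omega

/-- All points of `W'` follow the same itinerary with respect to the coarser partition, up to
time `|W'|`. -/
theorem same_itinerary (href : ∀ Z' ∈ cells P', ∃ Z ∈ cells P, Z' ≤ Z) {x x' : X}
    (hx : x ∈ W'.base) (hx' : x' ∈ W'.base) {i : ℕ} (hi : i ≤ W'.len) {Z : Clopens X}
    (hZ : Z ∈ cells P) (h : (T ^ (i : ℤ)) x ∈ Z) : (T ^ (i : ℤ)) x' ∈ Z := by
  have : ∃ Z' ∈ cells P', (T ^ (i : ℤ)) x ∈ Z' ∧ (T ^ (i : ℤ)) x' ∈ Z' := by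
    rcases Nat.eq_zero_or_pos i with rfl | h0
    · exact ⟨E', Or.inl rfl, W'.mem_E hx, W'.mem_E hx'⟩
    · rcases hi.eq_or_lt with rfl | hlt
      · exact ⟨E', Or.inl rfl, W'.mem_E_len hx, W'.mem_E_len hx'⟩
      · obtain ⟨j, rfl⟩ : ∃ j, i = j + 1 := ⟨i - 1, by omega⟩
        have hj : j < W'.word.length := by simpa [Tower.len] using hlt
        push_cast
        exact ⟨_, Or.inr (W'.word[j]).2, ((W'.mem_base x).1 hx).2.1 j hj,
          ((W'.mem_base x').1 hx').2.1 j hj⟩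
  obtain ⟨Z', hZ', h1, h2⟩ := this
  obtain ⟨Z₀, hZ₀, hle⟩ := href Z' hZ'
  obtain rfl := Tower.cell_unique hZ hZ₀ h (hle h1)
  exact hle h2

/-- The position in `W'` of level `l` of the block `a`. -/
def toFin (hE : E' ≤ E) (p : Σ a : Arrow P W', Fin a.source.len) : Fin W'.len :=
  ⟨p.1.pos + p.2, by have := p.1.pos_add_len_le hE; have := p.2.2; omega⟩

theorem toFin_injective (hE : E' ≤ E) :
    Function.Injective (toFin hE : (Σ a : Arrow P W', Fin a.source.len) → Fin W'.len) := by
  rintro ⟨a, l⟩ ⟨b, l'⟩ h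
  obtain ⟨x, hx⟩ := W'.nonempty
  have hx : x ∈ W'.base := hx
  have h' : a.pos + l = b.pos + l' := congrArg Fin.val h
  have h2 : (T ^ ((l : ℕ) : ℤ)) ((T ^ (a.pos : ℤ)) x) =
      (T ^ ((l' : ℕ) : ℤ)) ((T ^ (b.pos : ℤ)) x) := by
    rw [← zpow_add_apply, ← zpow_add_apply]; congr 2; omega
  obtain ⟨h3, -, h4⟩ := Tower.level_unique (a.mem_source hx) (b.mem_source hx) l.2 l'.2 h2
  have hab : a = b := ext h4 (by omega)
  subst hab
  exact congrArg _ (Fin.ext h3)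

theorem toFin_surjective (hE : E' ≤ E) (href : ∀ Z' ∈ cells P', ∃ Z ∈ cells P, Z' ≤ Z) :
    Function.Surjective (toFin hE : (Σ a : Arrow P W', Fin a.source.len) → Fin W'.len) := by
  classical
  intro p
  obtain ⟨x, hx⟩ := W'.nonempty
  have hx : x ∈ W'.base := hx
  let Q : ℕ → Prop := fun i => (T ^ (i : ℤ)) x ∈ E
  have hQ0 : Q 0 := hE (W'.mem_E hx)
  set j := Nat.findGreatest Q p with hj
  have hQj : Q j := Nat.findGreatest_spec (Nat.zero_le _) hQ0
  have hjp : j ≤ p := Nat.findGreatest_le _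
  have hp := p.2
  have hret : (T ^ ((W'.len - j : ℕ) : ℤ)) ((T ^ (j : ℤ)) x) ∈ E := by
    rw [← zpow_add_apply]
    have : ((W'.len - j : ℕ) : ℤ) + (j : ℤ) = W'.len := by omega
    rw [this]; exact hE (W'.mem_E_len hx)
  obtain ⟨W, hW⟩ := Tower.exists_of_return (P := P) hQj (by omega) hret
  have hWlen : W.len ≤ W'.len - j := W.len_le hW (by omega) hret
  have hpl : (p : ℕ) < j + W.len := by
    by_contra hcon
    push Not at hcon
    have h1 : Q (j + W.len) := by
      have := W.mem_E_len hW
      rw [← zpow_add_apply] at this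
      simp only [Q]; push_cast; rwa [add_comm]
    have := Nat.le_findGreatest hcon h1
    have := W.len_pos
    omega
  have hle : W'.base ≤ translate T (-(j : ℤ)) W.base := by
    intro x' hx'
    have hx' : x' ∈ W'.base := hx'
    change x' ∈ translate T _ _
    rw [mem_translate_neg, W.mem_base]
    have hW' := (W.mem_base _).1 hW
    have tr : ∀ (i : ℕ) (_ : i ≤ W.len) {Z : Clopens X} (_ : Z ∈ cells P),
        (T ^ (i : ℤ)) ((T ^ (j : ℤ)) x) ∈ Z → (T ^ (i : ℤ)) ((T ^ (j : ℤ)) x') ∈ Z := by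
      intro i hi Z hZ h
      rw [← zpow_add_apply] at h ⊢
      rw [← Nat.cast_add] at h ⊢
      exact same_itinerary href hx hx' (by omega) hZ h
    refine ⟨?_, fun i hi => ?_, tr _ le_rfl (Or.inl rfl) hW'.2.2⟩
    · exact tr 0 (Nat.zero_le _) (Or.inl rfl) hW'.1
    · have := tr (i + 1) (by simp only [Tower.len]; omega) (Or.inr (W.word[i]).2)
        (by push_cast; exact hW'.2.1 i hi)
      push_cast at this
      exact this
  exact ⟨⟨⟨(W, j), by omega, hle⟩, ⟨p - j, by change _ < W.len; omega⟩⟩,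
    Fin.ext (show j + (p - j) = (p : ℕ) by omega)⟩

instance : Finite (Arrow P W') :=
  Finite.of_injective (fun a : Arrow P W' => (⟨a.pos, a.pos_lt⟩ : Fin W'.len)) (by
    intro a b h
    obtain ⟨x, hx⟩ := W'.nonempty
    have h2 : a.pos = b.pos := congrArg Fin.val h
    have h3 := a.mem_source hx
    rw [h2] at h3
    exact ext (Tower.eq_of_mem h3 (b.mem_source hx)) h2)

noncomputable instance : Fintype (Arrow P W') := Fintype.ofFinite _

noncomputable instance : DecidableEq (Arrow P W') := Classical.decEq _

/-- The positions `0, …, |W'| - 1` are partitioned into consecutive blocks of lengths `|W|`, one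
for each arrow `W → W'`. -/
noncomputable def blocks (hE : E' ≤ E) (href : ∀ Z' ∈ cells P', ∃ Z ∈ cells P, Z' ≤ Z)
    (W' : Tower T P') : (Σ a : Arrow P W', Fin a.source.len) ≃ Fin W'.len :=
  Equiv.ofBijective (toFin hE) ⟨toFin_injective hE, toFin_surjective hE href⟩

end Arrow

end Dynamics

section LevelRings

open Matrix

variable {X : Type*} [TopologicalSpace X]

/-- The ring `∏_W M_{|W|}(K)`, the product over all towers. -/
abbrev LevelRing (T : X ≃ₜ X) {E : Clopens X} (P : Finpartition Eᶜ) (K : Type*) : Type _ :=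
  ∀ W : Tower T P, Matrix (Fin W.len) (Fin W.len) K

/-- The block diagonal embedding `∏_W M_{|W|}(K) → ∏_{W'} M_{|W'|}(K)`: the `W'`-component of the
image of `(a_W)` is block diagonal, with one block `a_W`, in rows and columns
`j, …, j + |W| - 1`, for every arrow `(W, j)` ending at `W'`. -/
noncomputable def connect (T : X ≃ₜ X) (K : Type*) [Field K] {E E' : Clopens X}
    (P : Finpartition Eᶜ) (P' : Finpartition E'ᶜ) (hE : E' ≤ E)
    (href : ∀ Z' ∈ cells P', ∃ Z ∈ cells P, Z' ≤ Z) :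
    LevelRing T P K →ₐ[K] LevelRing T P' K :=
  AlgHom.mk' (RingHom.pi fun W' : Tower T P' =>
      ((reindexRingEquiv K (Arrow.blocks hE href W') :
        Matrix (Σ a : Arrow P W', Fin a.source.len) (Σ a : Arrow P W', Fin a.source.len) K →+*
          Matrix (Fin W'.len) (Fin W'.len) K)).comp
      ((blockDiagonal'RingHom (fun a : Arrow P W' => Fin a.source.len) K).comp
        (RingHom.pi fun a : Arrow P W' =>
          Pi.evalRingHom (fun W : Tower T P => Matrix (Fin W.len) (Fin W.len) K) a.source)))
    (by
      intro c x
      funext W'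
      change reindex _ _ (blockDiagonal' fun a : Arrow P W' => c • x a.source) =
        c • reindex _ _ (blockDiagonal' fun a : Arrow P W' => x a.source)
      have : (fun a : Arrow P W' => c • x a.source) = c • fun a : Arrow P W' => x a.source := rfl
      rw [this, blockDiagonal'_smul]
      rfl)

theorem connect_apply (T : X ≃ₜ X) {K : Type*} [Field K] {E E' : Clopens X}
    {P : Finpartition Eᶜ} {P' : Finpartition E'ᶜ} (hE : E' ≤ E)
    (href : ∀ Z' ∈ cells P', ∃ Z ∈ cells P, Z' ≤ Z) (x : LevelRing T P K)
    (W' : Tower T P') : connect T K P P' hE href x W' =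
      reindex (Arrow.blocks hE href W') (Arrow.blocks hE href W')
        (blockDiagonal' fun a : Arrow P W' => x a.source) := rfl

theorem rank_diagonal_eq_sum {K ι : Type*} [Field K] [Fintype ι] [DecidableEq ι]
    [DecidableEq K] (d : ι → K) : (diagonal d).rank = ∑ i, if d i = 0 then 0 else 1 := by
  rw [rank_diagonal, Fintype.card_subtype, Finset.card_filter]
  exact Finset.sum_congr rfl fun i _ => by split_ifs <;> simp_all

theorem rank_blockDiagonal' {K o : Type*} [Field K] [Fintype o] [DecidableEq o] {m : o → Type*}
    [∀ i, Fintype (m i)] [∀ i, DecidableEq (m i)] (M : ∀ i, Matrix (m i) (m i) K) :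
    (blockDiagonal' M).rank = ∑ i, (M i).rank := by
  classical
  have h : ∀ i, ∃ (V U : Matrix (m i) (m i) K) (d : m i → K),
      IsUnit V ∧ IsUnit U ∧ V * M i * U = diagonal d := by
    intro i
    obtain ⟨V, U, e, hV, hU, h⟩ := exists_rank_normal_form (M i)
    refine ⟨V, U, Sum.elim 1 0 ∘ e, hV, hU, h.trans ?_⟩
    rw [← diagonal_one, ← diagonal_zero, fromBlocks_diagonal, submatrix_diagonal_equiv]
    rfl
  choose V U d hV hU h using h
  have unit : ∀ A : ∀ i, Matrix (m i) (m i) K, (∀ i, IsUnit (A i)) →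
      IsUnit (blockDiagonal' A).det := by
    intro A hA
    rw [← isUnit_iff_isUnit_det]
    exact (Pi.isUnit_iff.2 hA).map (blockDiagonal'RingHom m K)
  have e1 : blockDiagonal' V * blockDiagonal' M * blockDiagonal' U =
      diagonal fun ik : Σ i, m i => d ik.1 ik.2 := by
    rw [← blockDiagonal'_mul, ← blockDiagonal'_mul, ← blockDiagonal'_diagonal]
    exact congrArg _ (funext h)
  have e2 : ∀ i, (M i).rank = (diagonal (d i)).rank := by
    intro i
    rw [← h i, rank_mul_eq_left_of_isUnit_det _ _ ((isUnit_iff_isUnit_det _).1 (hU i)),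
      rank_mul_eq_right_of_isUnit_det _ _ ((isUnit_iff_isUnit_det _).1 (hV i))]
  have e3 : (blockDiagonal' M).rank = (diagonal fun ik : Σ i, m i => d ik.1 ik.2).rank := by
    rw [← e1, rank_mul_eq_left_of_isUnit_det _ _ (unit U hU),
      rank_mul_eq_right_of_isUnit_det _ _ (unit V hV)]
  rw [e3, rank_diagonal_eq_sum, Fintype.sum_sigma]
  exact Finset.sum_congr rfl fun i _ => by rw [e2, rank_diagonal_eq_sum]

theorem rank_add_le' {K m n : Type*} [Field K] [Fintype m] [Fintype n] (A B : Matrix m n K) :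
    (A + B).rank ≤ A.rank + B.rank := by
  rw [Matrix.rank, Matrix.rank, Matrix.rank]
  refine le_trans (Submodule.finrank_mono (t := A.mulVecLin.range ⊔ B.mulVecLin.range) ?_)
    (Submodule.finrank_add_le_finrank_add_finrank _ _)
  rintro _ ⟨v, rfl⟩
  rw [mulVecLin_add, LinearMap.add_apply]
  exact Submodule.add_mem_sup (LinearMap.mem_range_self _ v) (LinearMap.mem_range_self _ v)

theorem rank_neg' {K m n : Type*} [Field K] [Fintype m] [Fintype n] (A : Matrix m n K) :
    (-A).rank = A.rank := by
  have : (-A).mulVecLin = -A.mulVecLin := LinearMap.ext fun v => neg_mulVec v A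
  rw [Matrix.rank, Matrix.rank, this, LinearMap.range_neg]

theorem rank_connect (T : X ≃ₜ X) {K : Type*} [Field K] {E E' : Clopens X}
    {P : Finpartition Eᶜ} {P' : Finpartition E'ᶜ} (hE : E' ≤ E)
    (href : ∀ Z' ∈ cells P', ∃ Z ∈ cells P, Z' ≤ Z) (x : LevelRing T P K)
    (W' : Tower T P') : (connect T K P P' hE href x W').rank =
      ∑ a : Arrow P W', (x a.source).rank := by
  classical
  rw [connect_apply, rank_reindex, rank_blockDiagonal']

end LevelRings

section Measure

set_option linter.unusedSectionVars false

open Filter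
open scoped ENNReal

variable {X : Type*} [TopologicalSpace X] [MeasurableSpace X] [BorelSpace X]

theorem zpow_natCast_apply (T : X ≃ₜ X) (n : ℕ) (x : X) : (T ^ (n : ℤ)) x = T^[n] x := by
  rw [zpow_natCast]
  induction n generalizing x with
  | zero => rfl
  | succ n ih => rw [pow_succ, Function.iterate_succ_apply, ← ih]; rfl

theorem measurableSet_clopen (U : Clopens X) : MeasurableSet (U : Set X) := U.isOpen.measurableSet

theorem measure_translate {T : X ≃ₜ X} {μ : Measure X} (hT : Ergodic T μ) (n : ℕ)
    (U : Clopens X) : μ (translate T n U : Set X) = μ (U : Set X) := by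
  have h := (hT.toMeasurePreserving.iterate n).measure_preimage
    (measurableSet_clopen (translate T n U)).nullMeasurableSet
  rw [← h]
  congr 1
  ext x
  rw [Set.mem_preimage, ← zpow_natCast_apply]
  change _ ∈ translate T n U ↔ _
  rw [mem_translate, zpow_neg_apply]
  rfl

/-- Almost every point lies in some level of some tower. -/
theorem ae_mem_level {T : X ≃ₜ X} {μ : Measure X} [IsProbabilityMeasure μ] (hT : Ergodic T μ)
    {E : Clopens X} (P : Finpartition Eᶜ) (hE : μ (E : Set X) ≠ 0) :
    ∀ᵐ x ∂μ, ∃ (W : Tower T P) (z : X) (l : ℕ), z ∈ W.base ∧ l < W.len ∧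
      (T ^ (l : ℤ)) z = x := by
  classical
  have hmeas : ∀ n : ℤ, MeasurableSet ((T ^ n) ⁻¹' (E : Set X)) := fun n =>
    (T ^ n).continuous.measurable (measurableSet_clopen E)
  have fut : ∀ᵐ x ∂μ, ∃ m : ℕ, 0 < m ∧ (T ^ (m : ℤ)) x ∈ E := by
    let A : Set X := ⋃ m : ℕ, (T ^ ((m : ℤ) + 1)) ⁻¹' (E : Set X)
    have hA : MeasurableSet A := MeasurableSet.iUnion fun m => hmeas _
    have hsub : T ⁻¹' A ⊆ A := by
      intro x hx
      obtain ⟨m, hm⟩ := Set.mem_iUnion.1 hx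
      refine Set.mem_iUnion.2 ⟨m + 1, ?_⟩
      have : (T ^ ((m : ℤ) + 1)) ((T ^ (1 : ℤ)) x) ∈ (E : Set X) := by
        rw [zpow_one]; exact hm
      rw [← zpow_add_apply] at this
      simpa using this
    rcases hT.ae_empty_or_univ_of_preimage_ae_le hA.nullMeasurableSet
      (Eventually.of_forall hsub) with h | h
    · exfalso
      apply hE
      rw [← hT.toMeasurePreserving.measure_preimage (measurableSet_clopen E).nullMeasurableSet]
      refine measure_mono_null ?_ (ae_eq_empty.1 h)
      intro x hx
      refine Set.mem_iUnion.2 ⟨0, ?_⟩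
      simpa using hx
    · filter_upwards [eventuallyEq_univ.1 h] with x hx
      obtain ⟨m, hm⟩ := Set.mem_iUnion.1 hx
      exact ⟨m + 1, Nat.succ_pos _, by simpa using hm⟩
  have past : ∀ᵐ x ∂μ, ∃ m : ℕ, (T ^ (-(m : ℤ))) x ∈ E := by
    let A : Set X := ⋃ m : ℕ, (T ^ (-(m : ℤ))) ⁻¹' (E : Set X)
    have hA : MeasurableSet A := MeasurableSet.iUnion fun m => hmeas _
    have hsub : A ⊆ T ⁻¹' A := by
      intro x hx
      obtain ⟨m, hm⟩ := Set.mem_iUnion.1 hx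
      refine Set.mem_iUnion.2 ⟨m + 1, ?_⟩
      have h1 : (T ^ (-(m : ℤ) - 1)) ((T ^ (1 : ℤ)) x) ∈ (E : Set X) := by
        rw [← zpow_add_apply]; simpa using hm
      rw [zpow_one] at h1
      have h2 : -((m + 1 : ℕ) : ℤ) = -(m : ℤ) - 1 := by push_cast; ring
      rw [Set.mem_preimage, h2]; exact h1
    rcases hT.ae_empty_or_univ_of_ae_le_preimage hA.nullMeasurableSet
      (Eventually.of_forall hsub) with h | h
    · exfalso
      apply hE
      refine measure_mono_null ?_ (ae_eq_empty.1 h)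
      intro x hx
      refine Set.mem_iUnion.2 ⟨0, ?_⟩
      simpa using hx
    · filter_upwards [eventuallyEq_univ.1 h] with x hx
      simpa [A] using hx
  filter_upwards [fut, past] with x ⟨m, hm0, hm⟩ hp
  have hn := Nat.find_spec hp
  set n := Nat.find hp with hndef
  have hret : (T ^ ((n + m : ℕ) : ℤ)) ((T ^ (-(n : ℤ))) x) ∈ E := by
    rw [← zpow_add_apply]
    have : ((n + m : ℕ) : ℤ) + -(n : ℤ) = m := by push_cast; ring
    rwa [this]
  obtain ⟨W, hW⟩ := Tower.exists_of_return (P := P) hn (by omega) hret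
  refine ⟨W, _, n, hW, ?_, zpow_apply_neg T n x⟩
  by_contra hlt
  push Not at hlt
  have h1 := W.mem_E_len hW
  rw [← zpow_add_apply] at h1
  have h2 : (W.len : ℤ) + -(n : ℤ) = -((n - W.len : ℕ) : ℤ) := by omega
  rw [h2] at h1
  exact Nat.find_min hp (m := n - W.len) (by have := W.len_pos; omega) h1

/-- The function `rk(x) = ∑_W α_W · rk_{|W|}(x_W)` on `∏_W M_{|W|}(K)`, where
`α_W = |W| μ(W)` and `rk_{|W|} = Rk / |W|` is the normalized rank on `M_{|W|}(K)`. -/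
noncomputable def levelRank {T : X ≃ₜ X} (μ : Measure X) {E : Clopens X} {P : Finpartition Eᶜ}
    {K : Type*} [Field K] (x : LevelRing T P K) : ℝ :=
  ∑' W : Tower T P, (W.len * μ.real (W.base : Set X)) * ((x W).rank / W.len)

variable {T : X ≃ₜ X} {μ : Measure X} [IsProbabilityMeasure μ] {E : Clopens X}
  {P : Finpartition Eᶜ} {K : Type*} [Field K]

theorem tsum_len_mul_le (hT : Ergodic T μ) (P : Finpartition Eᶜ) :
    ∑' W : Tower T P, (W.len : ℝ≥0∞) * μ (W.base : Set X) ≤ 1 := by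
  have h1 : ∀ W : Tower T P, (W.len : ℝ≥0∞) * μ (W.base : Set X) =
      ∑' l : Fin W.len, μ (translate T ((l : ℕ) : ℤ) W.base : Set X) := by
    intro W
    simp [measure_translate hT, tsum_fintype]
  simp_rw [h1]
  rw [← ENNReal.tsum_sigma (fun (W : Tower T P) (l : Fin W.len) =>
    μ (translate T ((l : ℕ) : ℤ) W.base : Set X)), ← measure_iUnion]
  · exact prob_le_one
  · rintro ⟨W, l⟩ ⟨W', l'⟩ hne
    refine Set.disjoint_left.2 ?_
    rintro _ ⟨z, hz, rfl⟩ ⟨z', hz', h⟩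
    obtain ⟨h1, -, h2⟩ := Tower.level_unique hz hz' l.2 l'.2 h.symm
    subst h2
    exact hne (congrArg _ (Fin.ext h1))
  · exact fun _ => measurableSet_clopen _

theorem summable_len_mul (hT : Ergodic T μ) (P : Finpartition Eᶜ) :
    Summable fun W : Tower T P => (W.len : ℝ) * μ.real (W.base : Set X) := by
  have := ENNReal.summable_toReal
    (ne_top_of_le_ne_top ENNReal.one_ne_top (tsum_len_mul_le hT P))
  simpa [ENNReal.toReal_mul, Measure.real] using this

theorem levelRank_term (x : LevelRing T P K) (W : Tower T P) :
    (W.len * μ.real (W.base : Set X)) * ((x W).rank / W.len) =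
      μ.real (W.base : Set X) * (x W).rank := by
  have : (W.len : ℝ) ≠ 0 := by exact_mod_cast W.len_pos.ne'
  field_simp

theorem summable_levelRank (hT : Ergodic T μ) (x : LevelRing T P K) :
    Summable fun W : Tower T P =>
      (W.len * μ.real (W.base : Set X)) * ((x W).rank / W.len) := by
  refine Summable.of_nonneg_of_le (fun W => by positivity) (fun W => ?_) (summable_len_mul hT P)
  rw [levelRank_term, mul_comm]
  gcongr
  exact_mod_cast (Matrix.rank_le_width (x W))

theorem levelRank_eq_toReal (x : LevelRing T P K) :
    levelRank μ x = (∑' W : Tower T P, μ (W.base : Set X) * ((x W).rank : ℝ≥0∞)).toReal := by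
  rw [ENNReal.tsum_toReal_eq fun W => ENNReal.mul_ne_top (measure_ne_top _ _) (by simp)]
  refine tsum_congr fun W => ?_
  rw [levelRank_term, ENNReal.toReal_mul]
  simp [Measure.real]

theorem levelRank_nonneg (x : LevelRing T P K) : 0 ≤ levelRank μ x :=
  tsum_nonneg fun W => by positivity

theorem levelRank_mono (hT : Ergodic T μ) {x z : LevelRing T P K}
    (h : ∀ W, (x W).rank ≤ (z W).rank) : levelRank μ x ≤ levelRank μ z :=
  (summable_levelRank hT x).tsum_le_tsum (fun W => by have := h W; gcongr)
    (summable_levelRank hT z)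

theorem levelRank_zero : levelRank μ (0 : LevelRing T P K) = 0 := by
  simp [levelRank]

theorem levelRank_neg (x : LevelRing T P K) : levelRank μ (-x) = levelRank μ x :=
  tsum_congr fun W => by rw [Pi.neg_apply, rank_neg']

theorem levelRank_add_le (hT : Ergodic T μ) (x z : LevelRing T P K) :
    levelRank μ (x + z) ≤ levelRank μ x + levelRank μ z := by
  unfold levelRank
  rw [← (summable_levelRank hT x).tsum_add (summable_levelRank hT z)]
  refine (summable_levelRank hT _).tsum_le_tsum (fun W => ?_)
    ((summable_levelRank hT x).add (summable_levelRank hT z))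
  rw [← mul_add, ← add_div]
  have := rank_add_le' (x W) (z W)
  gcongr
  exact_mod_cast this

theorem levelRank_mul_le_left (hT : Ergodic T μ) (x z : LevelRing T P K) :
    levelRank μ (x * z) ≤ levelRank μ x :=
  levelRank_mono hT fun W => Matrix.rank_mul_le_left (x W) (z W)

theorem levelRank_mul_le_right (hT : Ergodic T μ) (x z : LevelRing T P K) :
    levelRank μ (x * z) ≤ levelRank μ z :=
  levelRank_mono hT fun W => Matrix.rank_mul_le_right (x W) (z W)

/-- `μ(W) = ∑_{W'} |J(W, W')| μ(W')`. -/
theorem tsum_arrows (hT : Ergodic T μ) {E' : Clopens X} {P' : Finpartition E'ᶜ} (hE : E' ≤ E)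
    (href : ∀ Z' ∈ cells P', ∃ Z ∈ cells P, Z' ≤ Z) (hE' : μ (E' : Set X) ≠ 0) (W : Tower T P) :
    ∑' q : {q : Σ W' : Tower T P', Arrow P W' // q.2.source = W}, μ (q.1.1.base : Set X) =
      μ (W.base : Set X) := by
  let S : {q : Σ W' : Tower T P', Arrow P W' // q.2.source = W} → Set X :=
    fun q => translate T (q.1.2.pos : ℤ) q.1.1.base
  have hcount : Countable {q : Σ W' : Tower T P', Arrow P W' // q.2.source = W} := inferInstance
  have h1 : ∀ q, μ (q.1.1.base : Set X) = μ (S q) := fun q => (measure_translate hT _ _).symm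
  rw [tsum_congr h1, ← measure_iUnion]
  · refine measure_congr (ae_eq_set.2 ⟨?_, ?_⟩)
    · rw [Set.sdiff_eq_empty.2, measure_empty]
      refine Set.iUnion_subset ?_
      rintro ⟨⟨W', a⟩, rfl⟩ _ ⟨z, hz, rfl⟩
      exact a.mem_source hz
    · refine measure_mono_null ?_ (ae_iff.1 (ae_mem_level hT P' hE'))
      rintro _ ⟨hxW, hx⟩ ⟨W', z, j, hz, hj, rfl⟩
      apply hx
      obtain ⟨⟨a, l⟩, hal⟩ := Arrow.toFin_surjective (W' := W') hE href ⟨j, hj⟩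
      have hal' : a.pos + (l : ℕ) = j := congrArg Fin.val hal
      have h3 : (T ^ ((l : ℕ) : ℤ)) ((T ^ (a.pos : ℤ)) z) =
          (T ^ ((0 : ℕ) : ℤ)) ((T ^ (j : ℤ)) z) := by
        rw [← zpow_add_apply, ← zpow_add_apply]; congr 2; omega
      obtain ⟨h4, -, h5⟩ := Tower.level_unique (a.mem_source hz) hxW l.2 W.len_pos h3
      refine Set.mem_iUnion.2 ⟨⟨⟨W', a⟩, h5⟩, z, hz, ?_⟩
      have : j = a.pos := by omega
      rw [this]
  · rintro ⟨⟨W₁, a⟩, ha⟩ ⟨⟨W₂, b⟩, hb⟩ hne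
    refine Set.disjoint_left.2 ?_
    rintro _ ⟨z, hz, rfl⟩ ⟨z', hz', h⟩
    obtain ⟨h1, -, h2⟩ := Tower.level_unique hz hz' a.pos_lt b.pos_lt h.symm
    subst h2
    have : a = b := Arrow.ext (ha.trans hb.symm) h1
    subst this
    exact hne rfl
  · exact fun _ => measurableSet_clopen _

/-- The block diagonal embeddings preserve the rank functions. -/
theorem levelRank_connect (hT : Ergodic T μ) {E' : Clopens X} {P' : Finpartition E'ᶜ}
    (hE : E' ≤ E) (href : ∀ Z' ∈ cells P', ∃ Z ∈ cells P, Z' ≤ Z) (hE' : μ (E' : Set X) ≠ 0)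
    (x : LevelRing T P K) : levelRank μ (connect T K P P' hE href x) = levelRank μ x := by
  rw [levelRank_eq_toReal, levelRank_eq_toReal]
  congr 1
  have h1 : ∀ W' : Tower T P', μ (W'.base : Set X) *
      ((connect T K P P' hE href x W').rank : ℝ≥0∞) =
      ∑' a : Arrow P W', μ (W'.base : Set X) * ((x a.source).rank : ℝ≥0∞) := by
    intro W'
    rw [rank_connect, tsum_fintype, ← Finset.mul_sum]
    push_cast
    rfl
  rw [tsum_congr h1, ← ENNReal.tsum_sigma (fun (W' : Tower T P') (a : Arrow P W') =>
    μ (W'.base : Set X) * ((x a.source).rank : ℝ≥0∞)),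
    ← (Equiv.sigmaFiberEquiv fun q : Σ W' : Tower T P', Arrow P W' => q.2.source).tsum_eq,
    ENNReal.tsum_sigma']
  refine tsum_congr fun W => ?_
  rw [← tsum_arrows hT hE href hE' W, ← ENNReal.tsum_mul_right]
  refine tsum_congr fun q => ?_
  obtain ⟨q, rfl⟩ := q
  rfl

end Measure

/-- A system `(y, (E_n), (P_n))` on `X`: a point `y`, a decreasing sequence of clopen sets `E_n`
with intersection `{y}`, and partitions `P_n` of `X \ E_n` into finitely many nonempty clopen sets
such that `P_{n+1} ∪ {E_{n+1}}` refines `P_n ∪ {E_n}` and `⋃ₙ (P_n ∪ {E_n})` generates the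
topology of `X`. -/
structure ApproxSystem (X : Type*) [TopologicalSpace X] where
  /-- the point `y` -/
  y : X
  /-- the sets `E_n` -/
  E : ℕ → Clopens X
  /-- the partitions `P_n` -/
  P : ∀ n, Finpartition (E n)ᶜ
  antitone : Antitone E
  iInter_eq : ⋂ n, (E n : Set X) = {y}
  refines : ∀ n, ∀ Z' ∈ cells (P (n + 1)), ∃ Z ∈ cells (P n), Z' ≤ Z
  generates : ‹TopologicalSpace X› =
    TopologicalSpace.generateFrom (⋃ n, (fun Z : Clopens X => (Z : Set X)) '' cells (P n))

section Limit

variable {X : Type*} [TopologicalSpace X] (S : ApproxSystem X) (T : X ≃ₜ X)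
  (K : Type*) [Field K]

/-- The ring `R_n = ∏_W M_{|W|}(K)`, with `W` running over the towers of `(E_n, P_n)`. -/
abbrev ApproxSystem.Level (n : ℕ) : Type _ := LevelRing T (S.P n) K

/-- The connecting embedding `R_n → R_{n+1}`. -/
noncomputable def ApproxSystem.step (n : ℕ) : S.Level T K n →ₐ[K] S.Level T K (n + 1) :=
  connect T K (S.P n) (S.P (n + 1)) (S.antitone n.le_succ) (S.refines n)

/-- The composite embeddings `R_m → R_n` for `m ≤ n`. -/
noncomputable def ApproxSystem.trans (m n : ℕ) (h : m ≤ n) :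
    S.Level T K m →ₐ[K] S.Level T K n :=
  Nat.leRec (motive := fun n _ => S.Level T K m →ₐ[K] S.Level T K n) (AlgHom.id K _)
    (fun n _ f => (S.step T K n).comp f) h

theorem ApproxSystem.trans_self (m : ℕ) : S.trans T K m m le_rfl = AlgHom.id K _ :=
  Nat.leRec_self _ _

theorem ApproxSystem.trans_succ (m n : ℕ) (h : m ≤ n) :
    S.trans T K m (n + 1) (h.trans n.le_succ) = (S.step T K n).comp (S.trans T K m n h) :=
  Nat.leRec_succ _ _ h

instance ApproxSystem.directedSystem :
    DirectedSystem (S.Level T K) (fun m n h => (S.trans T K m n h : S.Level T K m → _)) where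
  map_self m x := by rw [S.trans_self]; rfl
  map_map k j i hij hjk x := by
    induction k, hjk using Nat.le_induction with
    | base => rw [S.trans_self]; rfl
    | succ n hn ih =>
      rw [S.trans_succ T K j n hn, S.trans_succ T K i n (hij.trans hn)]
      exact congrArg (S.step T K n) ih

/-- The direct limit `R_∞ = lim R_n`. -/
def ApproxSystem.Limit : Type _ := DirectLimit (S.Level T K) (S.trans T K)

noncomputable instance : Ring (S.Limit T K) :=
  inferInstanceAs (Ring (DirectLimit (S.Level T K) (S.trans T K)))

noncomputable instance : Module K (S.Limit T K) :=
  inferInstanceAs (Module K (DirectLimit (S.Level T K) (S.trans T K)))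

noncomputable instance : Algebra K (S.Limit T K) :=
  Algebra.ofModule
    (fun c (x z : DirectLimit (S.Level T K) (S.trans T K)) => smul_mul_assoc c x z)
    (fun c (x z : DirectLimit (S.Level T K) (S.trans T K)) => mul_smul_comm c x z)

variable {K} in
/-- The canonical map `R_n → R_∞`. -/
noncomputable def ApproxSystem.toLimit (n : ℕ) : S.Level T K n →ₐ[K] S.Limit T K :=
  AlgHom.mk'
    { toFun := fun x => (⟦⟨n, x⟩⟧ : DirectLimit (S.Level T K) (S.trans T K))
      map_one' := (DirectLimit.one_def n).symm
      map_mul' := fun x z => (DirectLimit.mul_def n x z).symm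
      map_zero' := (DirectLimit.zero_def n).symm
      map_add' := fun x z => (DirectLimit.add_def n x z).symm }
    (fun c x => (DirectLimit.smul_def (f := S.trans T K) n x c).symm)

variable {S T K}

theorem ApproxSystem.exists_rep₂ (x z : S.Limit T K) :
    ∃ n a b, x = S.toLimit T n a ∧ z = S.toLimit T n b :=
  DirectLimit.exists_eq_mk₂ (S.trans T K) x z

theorem ApproxSystem.exists_rep (x : S.Limit T K) : ∃ n a, x = S.toLimit T n a :=
  DirectLimit.exists_eq_mk (S.trans T K) x

end Limit

section RankedLimit

set_option linter.unusedSectionVars false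

variable {X : Type*} [TopologicalSpace X] [MeasurableSpace X] [BorelSpace X]
  (S : ApproxSystem X) {T : X ≃ₜ X} {μ : Measure X} [IsProbabilityMeasure μ]
  [μ.IsOpenPosMeasure] (hT : Ergodic T μ) (K : Type*) [Field K]

theorem ApproxSystem.mem_E (n : ℕ) : S.y ∈ S.E n := by
  have : S.y ∈ ⋂ n, (S.E n : Set X) := by rw [S.iInter_eq]; rfl
  exact Set.mem_iInter.1 this n

theorem ApproxSystem.measure_E_ne_zero (μ : Measure X) [μ.IsOpenPosMeasure] (n : ℕ) :
    μ (S.E n : Set X) ≠ 0 :=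
  (S.E n).isOpen.measure_ne_zero μ ⟨S.y, S.mem_E n⟩

theorem ApproxSystem.levelRank_trans (hT : Ergodic T μ) (m n : ℕ) (h : m ≤ n)
    (x : S.Level T K m) : levelRank μ (S.trans T K m n h x) = levelRank μ x := by
  induction n, h using Nat.le_induction with
  | base => rw [S.trans_self]; rfl
  | succ n hn ih =>
    rw [S.trans_succ T K m n hn, ← ih]
    exact levelRank_connect hT _ _ (S.measure_E_ne_zero μ _) _

/-- The rank function on `R_∞` induced by the rank functions on the rings `R_n`. -/
noncomputable def ApproxSystem.limitRank (x : S.Limit T K) : ℝ :=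
  DirectLimit.lift (S.trans T K) (fun n (a : S.Level T K n) => levelRank μ a)
    (fun m n h a => (S.levelRank_trans K hT m n h a).symm) x

theorem ApproxSystem.limitRank_toLimit (n : ℕ) (a : S.Level T K n) :
    S.limitRank hT K (S.toLimit T n a) = levelRank μ a := rfl

theorem ApproxSystem.limitRank_mul_le_left (x z : S.Limit T K) :
    S.limitRank hT K (x * z) ≤ S.limitRank hT K x := by
  obtain ⟨n, a, b, rfl, rfl⟩ := ApproxSystem.exists_rep₂ x z
  rw [← map_mul]
  simp only [limitRank_toLimit]
  exact levelRank_mul_le_left hT a b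

theorem ApproxSystem.limitRank_mul_le_right (x z : S.Limit T K) :
    S.limitRank hT K (x * z) ≤ S.limitRank hT K z := by
  obtain ⟨n, a, b, rfl, rfl⟩ := ApproxSystem.exists_rep₂ x z
  rw [← map_mul]
  simp only [limitRank_toLimit]
  exact levelRank_mul_le_right hT a b

/-- The rank function of `R_∞`, as a seminorm on the additive group. -/
noncomputable def ApproxSystem.limitSeminorm : AddGroupSeminorm (S.Limit T K) where
  toFun := S.limitRank hT K
  map_zero' := by
    rw [← map_zero (S.toLimit (K := K) T 0), limitRank_toLimit]
    exact levelRank_zero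
  add_le' x z := by
    obtain ⟨n, a, b, rfl, rfl⟩ := ApproxSystem.exists_rep₂ x z
    rw [← map_add]
    simp only [limitRank_toLimit]
    exact levelRank_add_le hT a b
  neg' x := by
    obtain ⟨n, a, rfl⟩ := ApproxSystem.exists_rep x
    rw [← map_neg]
    simp only [limitRank_toLimit]
    exact levelRank_neg a

/-- The ring `R_∞`, regarded as a (pseudo)metric space for the distance `rk(x - y)`. -/
def ApproxSystem.RankedLimit {X : Type*} [TopologicalSpace X] [MeasurableSpace X]
    (S : ApproxSystem X) {T : X ≃ₜ X} {μ : Measure X} (_ : Ergodic T μ)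
    (K : Type*) [Field K] : Type _ := S.Limit T K

noncomputable instance : Ring (S.RankedLimit hT K) := inferInstanceAs (Ring (S.Limit T K))

noncomputable instance : Algebra K (S.RankedLimit hT K) :=
  inferInstanceAs (Algebra K (S.Limit T K))

noncomputable instance : SeminormedAddCommGroup (S.RankedLimit hT K) :=
  AddGroupSeminorm.toSeminormedAddCommGroup
    (E := S.RankedLimit hT K) (S.limitSeminorm hT K)

theorem ApproxSystem.norm_eq (x : S.RankedLimit hT K) : ‖x‖ = S.limitRank hT K x := rfl

instance : IsTopologicalRing (S.RankedLimit hT K) where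
  continuous_mul := by
    rw [continuous_iff_continuousAt]
    rintro ⟨x₀, z₀⟩
    rw [ContinuousAt, tendsto_iff_norm_sub_tendsto_zero]
    have h : Filter.Tendsto (fun p : S.RankedLimit hT K × S.RankedLimit hT K =>
        ‖p.1 - x₀‖ + ‖p.2 - z₀‖) (nhds (x₀, z₀)) (nhds 0) := by
      have : Continuous fun p : S.RankedLimit hT K × S.RankedLimit hT K =>
        ‖p.1 - x₀‖ + ‖p.2 - z₀‖ := by fun_prop
      simpa using this.tendsto (x₀, z₀)
    refine squeeze_zero (fun _ => norm_nonneg _) (fun p => ?_) h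
    have : p.1 * p.2 - x₀ * z₀ = (p.1 - x₀) * p.2 + x₀ * (p.2 - z₀) := by noncomm_ring
    rw [this]
    exact (norm_add_le _ _).trans (add_le_add (S.limitRank_mul_le_left hT K _ _)
      (S.limitRank_mul_le_right hT K _ _))
  continuous_neg := continuous_neg

instance : UniformContinuousConstSMul K (S.RankedLimit hT K) where
  uniformContinuous_const_smul c := by
    refine LipschitzWith.uniformContinuous (K := 1) (LipschitzWith.of_dist_le_mul fun x z => ?_)
    rw [dist_eq_norm, dist_eq_norm, ← smul_sub, Algebra.smul_def, NNReal.coe_one, one_mul]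
    exact S.limitRank_mul_le_right hT K _ _

/-- The rank completion `R_rk` of `R_∞`: the completion of `R_∞` for the metric `rk(x - y)`. It
is a `K`-algebra, and its norm `‖·‖` is the continuous extension of the rank function of `R_∞`. -/
abbrev ApproxSystem.RankCompletion : Type _ :=
  UniformSpace.Completion (S.RankedLimit hT K)

/-- The canonical map `R_∞ → R_rk` into the completion. -/
noncomputable def ApproxSystem.toCompletion : S.Limit T K →+* S.RankCompletion hT K :=
  (UniformSpace.Completion.coeRingHom :
    S.RankedLimit hT K →+* UniformSpace.Completion (S.RankedLimit hT K))

theorem ApproxSystem.norm_toCompletion (x : S.Limit T K) :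
    ‖S.toCompletion hT K x‖ = S.limitRank hT K x :=
  UniformSpace.Completion.norm_coe (E := S.RankedLimit hT K) x

end RankedLimit

section CrossedProduct

variable {X : Type*} [TopologicalSpace X]

/-- The algebra `C_K(X)` of locally constant functions `X → K`, with the action of `ℤ` induced
by the homeomorphism `T`. -/
def FunctionAlgebra (_ : X ≃ₜ X) (K : Type*) : Type _ := LocallyConstant X K

variable (T : X ≃ₜ X) (K : Type*) [Field K]

noncomputable instance : CommRing (FunctionAlgebra T K) :=
  inferInstanceAs (CommRing (LocallyConstant X K))

noncomputable instance : Algebra K (FunctionAlgebra T K) :=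
  inferInstanceAs (Algebra K (LocallyConstant X K))

instance : CoeFun (FunctionAlgebra T K) fun _ => X → K := ⟨fun f => LocallyConstant.toFun f⟩

/-- The action of `ℤ` on `C_K(X)`: `(n • f)(x) = f(T⁻ⁿ x)`. -/
noncomputable instance : MulSemiringAction (Multiplicative ℤ) (FunctionAlgebra T K) where
  smul n f := LocallyConstant.comap
    ⟨(T ^ (-n.toAdd) : X ≃ₜ X), (T ^ (-n.toAdd) : X ≃ₜ X).continuous⟩ f
  one_smul f := LocallyConstant.ext fun x => rfl
  mul_smul m n f := LocallyConstant.ext fun x => by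
    change f ((T ^ (-(m * n).toAdd)) x) = f ((T ^ (-n.toAdd)) ((T ^ (-m.toAdd)) x))
    rw [← zpow_add_apply, toAdd_mul, neg_add_rev]
  smul_zero _ := LocallyConstant.ext fun _ => rfl
  smul_add _ _ _ := LocallyConstant.ext fun _ => rfl
  smul_one _ := LocallyConstant.ext fun _ => rfl
  smul_mul _ _ _ := LocallyConstant.ext fun _ => rfl

theorem FunctionAlgebra.smul_apply (n : Multiplicative ℤ) (f : FunctionAlgebra T K) (x : X) :
    (n • f) x = f ((T ^ (-n.toAdd)) x) := rfl

instance : SMulCommClass (Multiplicative ℤ) K (FunctionAlgebra T K) where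
  smul_comm _ _ _ := LocallyConstant.ext fun _ => rfl

/-- The characteristic function `χ_U` of a clopen set. -/
noncomputable def FunctionAlgebra.char (U : Clopens X) : FunctionAlgebra T K :=
  LocallyConstant.charFn K U.isClopen

theorem FunctionAlgebra.smul_char (i : ℤ) (U : Clopens X) :
    Multiplicative.ofAdd i • FunctionAlgebra.char T K U =
      FunctionAlgebra.char T K (translate T i U) := by
  classical
  refine LocallyConstant.ext fun x => ?_
  change LocallyConstant.charFn K U.isClopen ((T ^ (-i)) x) =
    LocallyConstant.charFn K (translate T i U).isClopen x
  rw [LocallyConstant.coe_charFn, LocallyConstant.coe_charFn, Set.indicator_apply,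
    Set.indicator_apply]
  exact if_congr (mem_translate T i U x).symm rfl rfl

/-- The algebraic crossed product `A = C_K(X) ⋊_T ℤ`: finite sums `∑ f_i t^i` with the product
determined by `t f = (f ∘ T⁻¹) t`. -/
abbrev CrossedProduct : Type _ := SkewMonoidAlgebra (FunctionAlgebra T K) (Multiplicative ℤ)

/-- The element `f t^i` of the crossed product. -/
noncomputable def monomial (f : FunctionAlgebra T K) (i : ℤ) : CrossedProduct T K :=
  SkewMonoidAlgebra.single (Multiplicative.ofAdd i) f

/-- The characteristic function `χ_U`, as an element of the crossed product. -/
noncomputable def chi (U : Clopens X) : CrossedProduct T K :=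
  monomial T K (FunctionAlgebra.char T K U) 0

/-- The canonical unit `t` of the crossed product (`i = 1`) and its powers `t^i`. -/
noncomputable def tpow (i : ℤ) : CrossedProduct T K := monomial T K 1 i

theorem tpow_mul_tpow (i j : ℤ) : tpow T K i * tpow T K j = tpow T K (i + j) := by
  simp [tpow, monomial, SkewMonoidAlgebra.single_mul_single]

theorem tpow_zero : tpow T K 0 = 1 := rfl

/-- The covariance relation `t^i χ_U = χ_{T^i(U)} t^i`. -/
theorem tpow_mul_chi (i : ℤ) (U : Clopens X) :
    tpow T K i * chi T K U = chi T K (translate T i U) * tpow T K i := by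
  unfold tpow chi monomial
  rw [SkewMonoidAlgebra.single_mul_single, SkewMonoidAlgebra.single_mul_single,
    FunctionAlgebra.smul_char, ofAdd_zero, mul_one, one_mul, one_mul, one_smul, mul_one]

/-- The algebra `A(E, P)`: the unital subalgebra of the crossed product generated by the elements
`χ_Z t` and `(χ_Z t)* = t⁻¹ χ_Z` for `Z ∈ P`. -/
noncomputable def approxAlgebra {E : Clopens X} (P : Finpartition Eᶜ) :
    Subalgebra K (CrossedProduct T K) :=
  Algebra.adjoin K
    ((fun Z => chi T K Z * tpow T K 1) '' P.parts ∪ (fun Z => tpow T K (-1) * chi T K Z) '' P.parts)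

variable {T}

/-- The central projection `h_W = ∑_{0 ≤ l < |W|} χ_{T^l(W)}`. -/
noncomputable def Tower.h {E : Clopens X} {P : Finpartition Eᶜ} (W : Tower T P) :
    CrossedProduct T K :=
  ∑ l : Fin W.len, chi T K (translate T (l : ℕ) W.base)

/-- The matrix units `e_{ij}(W) = (χ_{X \ E} t)^i χ_W (t⁻¹ χ_{X \ E})^j`, `0 ≤ i, j < |W|`. -/
noncomputable def Tower.e {E : Clopens X} {P : Finpartition Eᶜ} (W : Tower T P)
    (i j : Fin W.len) : CrossedProduct T K :=
  (chi T K Eᶜ * tpow T K 1) ^ (i : ℕ) * chi T K W.base * (tpow T K (-1) * chi T K Eᶜ) ^ (j : ℕ)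

variable {K}

/-- `x = π(a)`, where `π : A(E, P) → ∏_W M_{|W|}(K)` is the map `a ↦ (h_W a)_W` and `h_W A(E, P)`
is identified with `M_{|W|}(K)` through the matrix units `e_{ij}(W)`. -/
def IsImage {E : Clopens X} {P : Finpartition Eᶜ} (a : CrossedProduct T K)
    (x : LevelRing T P K) : Prop :=
  ∀ W : Tower T P, W.h K * a = ∑ i, ∑ j, x W i j • W.e K i j

variable (T K)

/-- The union `A_∞` of the algebras `A_n = A(E_n, P_n)`. -/
noncomputable def ApproxSystem.algebra (S : ApproxSystem X) : Subalgebra K (CrossedProduct T K) :=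
  ⨆ n, approxAlgebra T K (S.P n)

end CrossedProduct

section Sylvester

/-- A rank function on a ring `R`. -/
structure IsRankFunction {R : Type*} [Ring R] (rk : R → ℝ) : Prop where
  nonneg : ∀ x, 0 ≤ rk x
  le_one : ∀ x, rk x ≤ 1
  map_zero : rk 0 = 0
  map_one : rk 1 = 1
  mul_le_left : ∀ x y, rk (x * y) ≤ rk x
  mul_le_right : ∀ x y, rk (x * y) ≤ rk y
  add_of_orthogonal : ∀ e f, e * e = e → f * f = f → e * f = 0 → f * e = 0 →
    rk (e + f) = rk e + rk f
  eq_zero : ∀ x, rk x = 0 → x = 0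

/-- A Sylvester matrix rank function on a ring `R`. -/
structure SylvesterRank (R : Type*) [Ring R] where
  /-- the rank of a matrix -/
  rk : ∀ {m n : ℕ}, Matrix (Fin m) (Fin n) R → ℝ
  nonneg : ∀ {m n : ℕ} (M : Matrix (Fin m) (Fin n) R), 0 ≤ rk M
  zero : ∀ m n : ℕ, rk (0 : Matrix (Fin m) (Fin n) R) = 0
  one : rk (1 : Matrix (Fin 1) (Fin 1) R) = 1
  mul_le_left : ∀ {l m n : ℕ} (M : Matrix (Fin l) (Fin m) R) (N : Matrix (Fin m) (Fin n) R),
    rk (M * N) ≤ rk M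
  mul_le_right : ∀ {l m n : ℕ} (M : Matrix (Fin l) (Fin m) R) (N : Matrix (Fin m) (Fin n) R),
    rk (M * N) ≤ rk N
  diag : ∀ {m n m' n' : ℕ} (M : Matrix (Fin m) (Fin n) R) (N : Matrix (Fin m') (Fin n') R),
    rk (Matrix.reindex finSumFinEquiv finSumFinEquiv (Matrix.fromBlocks M 0 0 N)) = rk M + rk N
  triangular : ∀ {m n m' n' : ℕ} (M : Matrix (Fin m) (Fin n) R) (N : Matrix (Fin m') (Fin n') R)
    (L : Matrix (Fin m) (Fin n') R),
    rk M + rk N ≤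
      rk (Matrix.reindex finSumFinEquiv finSumFinEquiv (Matrix.fromBlocks M L 0 N))

namespace SylvesterRank

variable {R S : Type*} [Ring R] [Ring S]

/-- The rank of an element of the ring, as a `1 × 1` matrix. -/
def elt (N : SylvesterRank R) (x : R) : ℝ := N.rk !![x]

/-- The rank function is faithful: its kernel is zero. -/
def Faithful (N : SylvesterRank R) : Prop := ∀ x : R, N.elt x = 0 → x = 0

/-- The rank function induced on `R` by a ring homomorphism `f : R → S` and a rank function
on `S`: the rank of a matrix `M` over `R` is the rank of `f(M)`. -/
def comap (f : R →+* S) (N : SylvesterRank S) : SylvesterRank R where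
  rk M := N.rk (M.map f)
  nonneg M := N.nonneg _
  zero m n := by rw [Matrix.map_zero _ (map_zero f)]; exact N.zero m n
  one := by rw [Matrix.map_one _ (map_zero f) (map_one f)]; exact N.one
  mul_le_left M L := by rw [Matrix.map_mul]; exact N.mul_le_left _ _
  mul_le_right M L := by rw [Matrix.map_mul]; exact N.mul_le_right _ _
  diag M L := by
    rw [← N.diag, Matrix.reindex_apply, Matrix.reindex_apply, ← Matrix.submatrix_map,
      Matrix.fromBlocks_map, Matrix.map_zero _ (map_zero f), Matrix.map_zero _ (map_zero f)]
  triangular M L B := by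
    refine (N.triangular (M.map f) (L.map f) (B.map f)).trans_eq ?_
    rw [Matrix.reindex_apply, Matrix.reindex_apply, ← Matrix.submatrix_map,
      Matrix.fromBlocks_map, Matrix.map_zero _ (map_zero f)]

end SylvesterRank

/-- `f : R → S` exhibits the ring `S`, with the rank function `rkS`, as the completion of the
ring `R` for the metric `rkR(x - y)`: `rkS(x - y)` is a complete metric on `S`, and `f` is isometric
with dense image. -/
structure IsRankCompletion {R S : Type*} [Ring R] [Ring S] (rkR : R → ℝ) (rkS : S → ℝ)
    (f : R →+* S) : Prop where
  isometric : ∀ x, rkS (f x) = rkR x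
  dense : ∀ s : S, ∀ ε > 0, ∃ x : R, rkS (s - f x) < ε
  separated : ∀ s : S, rkS s = 0 → s = 0
  complete : ∀ u : ℕ → S, (∀ ε > 0, ∃ n₀, ∀ m ≥ n₀, ∀ n ≥ n₀, rkS (u m - u n) < ε) →
    ∃ s : S, ∀ ε > 0, ∃ n₀, ∀ n ≥ n₀, rkS (u n - s) < ε

end Sylvester

end RankCrossed

/-! Write R_n for the level rings, R_∞ for their limit, R_rk for the completion and A_n for the
approximating algebras.

The homomorphism Φ is built on the whole crossed product at once, as a limit of compressions. An
element a acts on the functions on an orbit. For every tower W a point x of its base is chosen, and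
`compress` cuts this operator down to the orbit segment x, Tx, …, T^{|W|-1}x. Thus f t^i becomes a
|W| × |W| matrix supported on the diagonal p - q = i, with entry f(T^p x) in row p. Compression is
linear and unital, but errors arise where the shift by i leaves the segment. All such errors are
boundary effects, and they are small for the rank:

The compression of a product with left factor f t^i differs from the product of the compressions in
at most |i| rows of each tower (`rank_compress_mul_sub_le`). The total weight of these rows is at
most |i| μ(E_n). This tends to 0, because μ({y}) = 0: an atom would have a finite orbit carrying a
full measure, which is impossible on an infinite space.

Once f is constant on the cells, the images in R_{n+1} of the compressions at levels n and n+1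
differ only in rows near the interior boundaries of the blocks (`rank_connect_compress_sub_le`). The
weighted number of these boundaries is the decrease of the total measure of the bases from one level
to the next (`hasSum_card_arrow_sub_one`). These decreases telescope, so the compressions form a
Cauchy sequence in R_rk.

The limit Φ is therefore defined and multiplicative. For the generators χ_Z t and t⁻¹ χ_Z of A_n the
coefficient vanishes exactly where the shift crosses a boundary, so all errors are zero and Φ is π_n
on A_n. Finite combinations of the matrix units e_ij(W) belong to A_n and are dense in R_n for the
rank, so already the image of A_∞ is dense in R_rk. For injectivity, ergodicity and fullness give
topological freeness. A nonzero a can then be cut down to χ_V a b = c χ_V with V nonempty clopen and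
c ≠ 0, and Φ(χ_V) ≠ 0 because elements of degree 0 have no boundary errors and every tower has
positive weight.

The Sylvester rank function is obtained on R_n by flattening a matrix over R_n to a matrix over K
for each tower and summing the ranks with weights μ(W). The block diagonal embeddings preserve it,
so it passes to R_∞. Subadditivity makes it Lipschitz in the entries, so it extends to R_rk, where
the axioms are closed conditions holding on a dense set. Faithfulness on the crossed product and on
A_∞ is then the injectivity of Φ. -/

namespace RankCrossed

/-! ### Ranks of matrices over a field -/

section MatrixRank

set_option linter.unusedSectionVars false

variable {K m n m' n' : Type*} [Field K] [Fintype m] [Fintype n] [Fintype m'] [Fintype n']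

/-- The product of two submodules, as a module, is the product of the modules. -/
def prodEquivProd {V V' : Type*} [AddCommGroup V] [Module K V] [AddCommGroup V'] [Module K V']
    (p : Submodule K V) (q : Submodule K V') : p.prod q ≃ₗ[K] p × q where
  toFun x := (⟨x.1.1, x.2.1⟩, ⟨x.1.2, x.2.2⟩)
  invFun x := ⟨(x.1.1, x.2.1), x.1.2, x.2.2⟩
  map_add' _ _ := rfl
  map_smul' _ _ := rfl

theorem rank_fromBlocks_diagonal (M : Matrix m n K) (N : Matrix m' n' K) :
    (Matrix.fromBlocks M 0 0 N).rank = M.rank + N.rank := by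
  classical
  have h : (Matrix.fromBlocks M 0 0 N).mulVecLin =
      (LinearEquiv.sumArrowLequivProdArrow m m' K K).symm.toLinearMap ∘ₗ
        (M.mulVecLin.prodMap N.mulVecLin) ∘ₗ
        (LinearEquiv.sumArrowLequivProdArrow n n' K K).toLinearMap := by
    refine LinearMap.ext fun v => funext fun i => ?_
    cases i <;>
      simp [Matrix.fromBlocks_mulVec, LinearEquiv.sumArrowLequivProdArrow,
        Equiv.sumArrowEquivProdArrow]
  rw [Matrix.rank, h, LinearMap.range_comp, LinearEquiv.finrank_map_eq, LinearMap.range_comp,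
    LinearEquiv.range, Submodule.map_top, LinearMap.range_prodMap,
    (prodEquivProd _ _).finrank_eq, Module.finrank_prod]
  rfl

/-- Every matrix over a field has a generalized inverse. -/
theorem exists_mul_mul_eq_self (M : Matrix m n K) : ∃ N : Matrix n m K, M * N * M = M := by
  classical
  let f := Matrix.toLin' M
  -- A linear section `s` of `f` over its range, extended arbitrarily to `g` on the whole codomain:
  -- then `g (f v)` is a preimage of `f v`.
  obtain ⟨s, hs⟩ := f.rangeRestrict.exists_rightInverse_of_surjective f.range_rangeRestrict
  obtain ⟨g, hg⟩ := LinearMap.exists_extend s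
  refine ⟨LinearMap.toMatrix' g, ?_⟩
  apply Matrix.toLin'.injective
  rw [Matrix.toLin'_mul, Matrix.toLin'_mul, Matrix.toLin'_toMatrix']
  refine LinearMap.ext fun v => ?_
  have h1 : g (f v) = s (f.rangeRestrict v) := LinearMap.congr_fun hg (f.rangeRestrict v)
  have h2 := congrArg Subtype.val (LinearMap.congr_fun hs (f.rangeRestrict v))
  change f (g (f v)) = f v
  rw [h1]
  exact h2

/-- With G a generalized inverse of M, multiplication by diag(MG, 1) on the left turns L into MGL,
and a column operation with -GL on the right then clears this block. What remains is diag(M, N), and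
multiplication cannot raise the rank. -/
theorem rank_add_rank_le_rank_fromBlocks (M : Matrix m n K) (N : Matrix m' n' K)
    (L : Matrix m n' K) : M.rank + N.rank ≤ (Matrix.fromBlocks M L 0 N).rank := by
  classical
  obtain ⟨G, hG⟩ := exists_mul_mul_eq_self M
  have h : (Matrix.fromBlocks (M * G) 0 0 1 : Matrix (m ⊕ m') (m ⊕ m') K) *
      Matrix.fromBlocks M L 0 N *
      (Matrix.fromBlocks 1 (-(G * L)) 0 1 : Matrix (n ⊕ n') (n ⊕ n') K) = Matrix.fromBlocks M 0 0 N := by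
    simp only [Matrix.fromBlocks_multiply, Matrix.mul_one, Matrix.mul_zero, Matrix.zero_mul,
      Matrix.one_mul, add_zero, zero_add, Matrix.mul_neg, ← Matrix.mul_assoc, hG]
    simp
  rw [← rank_fromBlocks_diagonal, ← h]
  exact (Matrix.rank_mul_le_left _ _).trans (Matrix.rank_mul_le_right _ _)

theorem rank_eq_zero_iff (M : Matrix m n K) : M.rank = 0 ↔ M = 0 := by
  classical
  rw [Matrix.rank, Submodule.finrank_eq_zero, LinearMap.range_eq_bot]
  exact ⟨fun h => Matrix.toLin'.injective (by rw [map_zero]; exact h), fun h => by simp [h]⟩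

/-- Orthogonality gives e(e + f)e = e, f(e + f)f = f and vanishing mixed terms, so diag(e, f) is a
product with e + f as a factor. -/
theorem rank_add_of_orthogonal {e f : Matrix m m K} (he : e * e = e) (hf : f * f = f)
    (hef : e * f = 0) (hfe : f * e = 0) : (e + f).rank = e.rank + f.rank := by
  classical
  refine le_antisymm (rank_add_le' _ _) ?_
  rw [← rank_fromBlocks_diagonal]
  have h : Matrix.fromBlocks e 0 0 f = Matrix.fromRows e f * (e + f) * Matrix.fromCols e f := by
    rw [Matrix.fromRows_mul, Matrix.fromRows_mul_fromCols]
    simp [mul_add, he, hf, hef, hfe]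
  rw [h]
  exact (Matrix.rank_mul_le_left _ _).trans (Matrix.rank_mul_le_right _ _)

/-- Replacing M i by the square matrix M i * G i, with G i a generalized inverse, changes neither
the ranks of the blocks nor that of the whole, because each of the two is a left factor of the
other. This reduces rectangular blocks to square ones. -/
theorem rank_blockDiagonal'_rect {o : Type*} [Fintype o] [DecidableEq o] {m n : o → Type*}
    [∀ i, Fintype (m i)] [∀ i, Fintype (n i)] [∀ i, DecidableEq (m i)]
    (M : ∀ i, Matrix (m i) (n i) K) :
    (Matrix.blockDiagonal' M).rank = ∑ i, (M i).rank := by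
  choose G hG using fun i => exists_mul_mul_eq_self (M i)
  have h : ∀ i, (M i * G i).rank = (M i).rank := fun i =>
    le_antisymm (Matrix.rank_mul_le_left _ _) (by
      conv_lhs => rw [← hG i]
      exact Matrix.rank_mul_le_left _ _)
  simp_rw [← h]
  rw [← rank_blockDiagonal' fun i => M i * G i]
  apply le_antisymm
  · have : Matrix.blockDiagonal' M =
        Matrix.blockDiagonal' (fun i => M i * G i) * Matrix.blockDiagonal' M := by
      rw [← Matrix.blockDiagonal'_mul]; simp_rw [hG]
    conv_lhs => rw [this]
    exact Matrix.rank_mul_le_left _ _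
  · rw [Matrix.blockDiagonal'_mul]
    exact Matrix.rank_mul_le_left _ _

end MatrixRank

/-! ### Subadditivity of Sylvester rank functions -/

namespace SylvesterRank

variable {R : Type*} [Ring R] (N : SylvesterRank R)

/-- A + B is the product of the row (1 1), the matrix diag(A, B) and the column (1 1). -/
theorem add_le {m n : ℕ} (A B : Matrix (Fin m) (Fin n) R) : N.rk (A + B) ≤ N.rk A + N.rk B := by
  rw [← N.diag]
  have h : A + B = (Matrix.fromCols (1 : Matrix (Fin m) (Fin m) R)
        (1 : Matrix (Fin m) (Fin m) R)).submatrix id finSumFinEquiv.symm *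
      Matrix.reindex finSumFinEquiv finSumFinEquiv (Matrix.fromBlocks A 0 0 B) *
      (Matrix.fromRows (1 : Matrix (Fin n) (Fin n) R)
        (1 : Matrix (Fin n) (Fin n) R)).submatrix finSumFinEquiv.symm id := by
    rw [Matrix.reindex_apply, Matrix.submatrix_mul_equiv, Matrix.submatrix_mul_equiv,
      Matrix.fromCols_mul_fromBlocks, Matrix.fromCols_mul_fromRows]
    simp
  rw [h]
  exact (N.mul_le_left _ _).trans (N.mul_le_right _ _)

theorem sum_le {ι : Type*} (s : Finset ι) {m n : ℕ} (A : ι → Matrix (Fin m) (Fin n) R) :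
    N.rk (∑ i ∈ s, A i) ≤ ∑ i ∈ s, N.rk (A i) := by
  classical
  induction s using Finset.induction_on with
  | empty => simp [N.zero]
  | insert a s ha ih =>
    rw [Finset.sum_insert ha, Finset.sum_insert ha]
    exact (N.add_le _ _).trans (by gcongr)

/-- A matrix with one entry x factors through the 1 × 1 matrix x. -/
theorem single_le {m n : ℕ} (i : Fin m) (j : Fin n) (x : R) :
    N.rk (Matrix.single i j x) ≤ N.elt x := by
  have h : Matrix.single i j x = Matrix.single i (0 : Fin 1) (1 : R) * !![x] *
      Matrix.single (0 : Fin 1) j (1 : R) := by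
    have : (!![x] : Matrix (Fin 1) (Fin 1) R) = Matrix.single 0 0 x := by
      ext a b; simp [Subsingleton.elim a 0, Subsingleton.elim b 0]
    rw [this]; simp
  rw [h]
  exact (N.mul_le_left _ _).trans (N.mul_le_right _ _)

theorem le_sum_elt {m n : ℕ} (A : Matrix (Fin m) (Fin n) R) :
    N.rk A ≤ ∑ i, ∑ j, N.elt (A i j) := by
  conv_lhs => rw [Matrix.matrix_eq_sum_single A]
  refine (N.sum_le _ _).trans (Finset.sum_le_sum fun i _ => (N.sum_le _ _).trans
    (Finset.sum_le_sum fun j _ => N.single_le i j _))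

/-- The rank of a matrix is thus Lipschitz in its entries, for the metric given by the rank of
elements. This is what allows its extension to the completion. -/
theorem sub_le {m n : ℕ} (A B : Matrix (Fin m) (Fin n) R) :
    N.rk A - N.rk B ≤ ∑ i, ∑ j, N.elt (A i j - B i j) := by
  have h := N.add_le (A - B) B
  rw [sub_add_cancel] at h
  linarith [N.le_sum_elt (A - B), show ∑ i, ∑ j, N.elt ((A - B) i j) =
    ∑ i, ∑ j, N.elt (A i j - B i j) from rfl]

end SylvesterRank

/-! ### The matrix rank of a level ring -/

section LevelSylvester

set_option linter.unusedSectionVars false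

variable {X : Type*} [TopologicalSpace X] [MeasurableSpace X] [BorelSpace X]
  {T : X ≃ₜ X} {μ : Measure X} [IsProbabilityMeasure μ] {E : Clopens X}
  {P : Finpartition Eᶜ} {K : Type*} [Field K]

/-- The `W`-component of a matrix over `∏_W M_{|W|}(K)`, flattened to a matrix over `K`. -/
def flatten {m n : ℕ} (M : Matrix (Fin m) (Fin n) (LevelRing T P K)) (W : Tower T P) :
    Matrix (Fin m × Fin W.len) (Fin n × Fin W.len) K :=
  .of fun i j => M i.1 j.1 W i.2 j.2

theorem flatten_mul {l m n : ℕ} (M : Matrix (Fin l) (Fin m) (LevelRing T P K))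
    (N : Matrix (Fin m) (Fin n) (LevelRing T P K)) (W : Tower T P) :
    flatten (M * N) W = flatten M W * flatten N W := by
  ext i j
  simp only [flatten, Matrix.of_apply, Matrix.mul_apply, Finset.sum_apply, Matrix.sum_apply,
    Pi.mul_apply, Fintype.sum_prod_type]

theorem flatten_fromBlocks {m n m' n' : ℕ} (M : Matrix (Fin m) (Fin n) (LevelRing T P K))
    (N : Matrix (Fin m') (Fin n') (LevelRing T P K))
    (L : Matrix (Fin m) (Fin n') (LevelRing T P K)) (W : Tower T P) :
    (flatten (Matrix.reindex finSumFinEquiv finSumFinEquiv (Matrix.fromBlocks M L 0 N)) W).rank =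
      (Matrix.fromBlocks (flatten M W) (flatten L W) 0 (flatten N W)).rank := by
  rw [← Matrix.rank_submatrix _
      ((Equiv.sumProdDistrib _ _ _).symm.trans (finSumFinEquiv.prodCongr (Equiv.refl _)))
      ((Equiv.sumProdDistrib _ _ _).symm.trans (finSumFinEquiv.prodCongr (Equiv.refl _)))]
  congr 1
  ext (i | i) (j | j) <;> simp [flatten]

theorem summable_flatten (hT : Ergodic T μ) {m n : ℕ}
    (M : Matrix (Fin m) (Fin n) (LevelRing T P K)) :
    Summable fun W : Tower T P => μ.real (W.base : Set X) * (flatten M W).rank := by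
  refine Summable.of_nonneg_of_le (fun W => by positivity) (fun W => ?_)
    ((summable_len_mul hT P).mul_left (n : ℝ))
  have h := Matrix.rank_le_card_width (flatten M W)
  rw [Fintype.card_prod, Fintype.card_fin, Fintype.card_fin] at h
  have h' : ((flatten M W).rank : ℝ) ≤ n * W.len := by exact_mod_cast h
  calc _ ≤ μ.real (W.base : Set X) * (n * W.len) := by gcongr
    _ = _ := by ring

/-- The levels of the towers fill up the whole space. -/
theorem tsum_len_mul (hT : Ergodic T μ) (P : Finpartition Eᶜ) (hE : μ (E : Set X) ≠ 0) :
    ∑' W : Tower T P, (W.len : ℝ) * μ.real (W.base : Set X) = 1 := by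
  have h0 : ∑' W : Tower T P, (W.len : ENNReal) * μ (W.base : Set X) = 1 := by
    refine le_antisymm (tsum_len_mul_le hT P) ?_
    have h1 : ∀ W : Tower T P, (W.len : ENNReal) * μ (W.base : Set X) =
        ∑' l : Fin W.len, μ (translate T ((l : ℕ) : ℤ) W.base : Set X) := by
      intro W
      simp [measure_translate hT, tsum_fintype]
    simp_rw [h1]
    rw [← ENNReal.tsum_sigma (fun (W : Tower T P) (l : Fin W.len) =>
      μ (translate T ((l : ℕ) : ℤ) W.base : Set X))]
    -- For this inequality countable subadditivity is enough: the union of all levels has measure 1,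
    -- since almost every point lies in one of them.
    refine le_trans (le_of_eq ?_) (measure_iUnion_le _)
    symm
    rw [← prob_compl_eq_zero_iff (MeasurableSet.iUnion fun _ => measurableSet_clopen _)]
    refine measure_mono_null ?_ (ae_iff.1 (ae_mem_level hT P hE))
    rintro x hx ⟨W, z, l, hz, hl, rfl⟩
    exact hx (Set.mem_iUnion.2 ⟨⟨W, ⟨l, hl⟩⟩, z, hz, rfl⟩)
  have h2 := congrArg ENNReal.toReal h0
  rw [ENNReal.tsum_toReal_eq fun W => ENNReal.mul_ne_top (by simp) (measure_ne_top _ _)] at h2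
  simpa [Measure.real] using h2

theorem levelRank_eq (x : LevelRing T P K) :
    levelRank μ x = ∑' W : Tower T P, μ.real (W.base : Set X) * (x W).rank :=
  tsum_congr fun W => levelRank_term x W

theorem levelRank_one (hT : Ergodic T μ) (hE : μ (E : Set X) ≠ 0) :
    levelRank μ (1 : LevelRing T P K) = 1 := by
  rw [levelRank_eq, ← tsum_len_mul hT P hE]
  refine tsum_congr fun W => ?_
  rw [Pi.one_apply, Matrix.rank_one, Fintype.card_fin, mul_comm]

theorem rank_flatten_singleton (x : LevelRing T P K) (W : Tower T P) :
    (flatten !![x] W).rank = (x W).rank := by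
  rw [← Matrix.rank_submatrix _ (Equiv.uniqueProd (Fin W.len) (Fin 1)).symm
    (Equiv.uniqueProd (Fin W.len) (Fin 1)).symm]
  congr 1

/-- The weighted sum of the ranks of the components of a matrix over `∏_W M_{|W|}(K)`. -/
noncomputable def levelMatrixRank (μ : Measure X) {m n : ℕ}
    (M : Matrix (Fin m) (Fin n) (LevelRing T P K)) : ℝ :=
  ∑' W : Tower T P, μ.real (W.base : Set X) * (flatten M W).rank

theorem levelMatrixRank_diag (hT : Ergodic T μ) {m n m' n' : ℕ}
    (M : Matrix (Fin m) (Fin n) (LevelRing T P K))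
    (N : Matrix (Fin m') (Fin n') (LevelRing T P K)) :
    levelMatrixRank μ (Matrix.reindex finSumFinEquiv finSumFinEquiv
      (Matrix.fromBlocks M 0 0 N)) = levelMatrixRank μ M + levelMatrixRank μ N := by
  unfold levelMatrixRank
  rw [← (summable_flatten hT M).tsum_add (summable_flatten hT N)]
  refine tsum_congr fun W => ?_
  rw [flatten_fromBlocks, ← mul_add, show flatten (0 : Matrix _ _ (LevelRing T P K)) W = 0
    from rfl, rank_fromBlocks_diagonal]
  push_cast; rfl

theorem levelMatrixRank_triangular (hT : Ergodic T μ) {m n m' n' : ℕ}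
    (M : Matrix (Fin m) (Fin n) (LevelRing T P K))
    (N : Matrix (Fin m') (Fin n') (LevelRing T P K))
    (L : Matrix (Fin m) (Fin n') (LevelRing T P K)) :
    levelMatrixRank μ M + levelMatrixRank μ N ≤
      levelMatrixRank μ (Matrix.reindex finSumFinEquiv finSumFinEquiv
        (Matrix.fromBlocks M L 0 N)) := by
  have h : ∀ W : Tower T P, μ.real (W.base : Set X) * (flatten M W).rank +
      μ.real (W.base : Set X) * (flatten N W).rank ≤ μ.real (W.base : Set X) *
        (flatten (Matrix.reindex finSumFinEquiv finSumFinEquiv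
          (Matrix.fromBlocks M L 0 N)) W).rank := by
    intro W
    have h := rank_add_rank_le_rank_fromBlocks (flatten M W) (flatten N W) (flatten L W)
    rw [flatten_fromBlocks, ← mul_add]
    exact mul_le_mul_of_nonneg_left (by exact_mod_cast h) measureReal_nonneg
  unfold levelMatrixRank
  rw [← (summable_flatten hT M).tsum_add (summable_flatten hT N)]
  exact ((summable_flatten hT M).add (summable_flatten hT N)).tsum_le_tsum h
    (summable_flatten hT _)

/-- The Sylvester matrix rank function of `∏_W M_{|W|}(K)`. -/
noncomputable def levelSylvester (hT : Ergodic T μ) (P : Finpartition Eᶜ) (K : Type*) [Field K]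
    (hE : μ (E : Set X) ≠ 0) : SylvesterRank (LevelRing T P K) where
  rk M := levelMatrixRank μ M
  nonneg M := tsum_nonneg fun W => by positivity
  zero m n := by
    have : ∀ W : Tower T P, flatten (0 : Matrix (Fin m) (Fin n) (LevelRing T P K)) W = 0 :=
      fun W => rfl
    simp [levelMatrixRank, this]
  one := by
    rw [← levelRank_one (K := K) (P := P) hT hE, levelRank_eq]
    refine tsum_congr fun W => ?_
    rw [← rank_flatten_singleton]
    congr 3
    have h : (1 : Matrix (Fin 1) (Fin 1) (LevelRing T P K)) = !![1] :=
      Matrix.ext fun i j => by rw [Subsingleton.elim i 0, Subsingleton.elim j 0]; rfl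
    rw [h]
  mul_le_left M N := by
    refine (summable_flatten hT _).tsum_le_tsum (fun W => ?_) (summable_flatten hT _)
    rw [flatten_mul]
    gcongr
    exact Matrix.rank_mul_le_left _ _
  mul_le_right M N := by
    refine (summable_flatten hT _).tsum_le_tsum (fun W => ?_) (summable_flatten hT _)
    rw [flatten_mul]
    gcongr
    exact Matrix.rank_mul_le_right _ _
  diag M N := levelMatrixRank_diag hT M N
  triangular M N L := levelMatrixRank_triangular hT M N L

theorem levelSylvester_elt (hT : Ergodic T μ) (hE : μ (E : Set X) ≠ 0) (x : LevelRing T P K) :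
    (levelSylvester hT P K hE).elt x = levelRank μ x := by
  rw [levelRank_eq]
  exact tsum_congr fun W => by rw [rank_flatten_singleton]

/-- When rows and columns are indexed by (arrow, matrix index, position in the block), the flattened
image becomes block diagonal with one block per arrow, namely the flattened matrix at the source.
The blocks need not be square. -/
theorem rank_flatten_connect {E' : Clopens X} {P' : Finpartition E'ᶜ} (hE : E' ≤ E)
    (href : ∀ Z' ∈ cells P', ∃ Z ∈ cells P, Z' ≤ Z) {m n : ℕ}
    (M : Matrix (Fin m) (Fin n) (LevelRing T P K)) (W' : Tower T P') :
    (flatten (M.map (connect T K P P' hE href)) W').rank =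
      ∑ a : Arrow P W', (flatten M a.source).rank := by
  classical
  let e : ∀ k : ℕ, (Σ a : Arrow P W', Fin k × Fin a.source.len) ≃ Fin k × Fin W'.len := fun k =>
    (Equiv.sigmaCongrRight fun a => Equiv.prodComm _ _).trans
      ((Equiv.sigmaProdDistrib _ _).symm.trans
        (((Arrow.blocks hE href W').prodCongr (Equiv.refl _)).trans (Equiv.prodComm _ _)))
  rw [← Matrix.rank_submatrix _ (e m) (e n), ← rank_blockDiagonal'_rect]
  congr 1
  ext ⟨a, i, k⟩ ⟨b, j, l⟩
  have h : flatten (M.map (connect T K P P' hE href)) W' (e m ⟨a, i, k⟩) (e n ⟨b, j, l⟩) =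
      Matrix.blockDiagonal' (fun a : Arrow P W' => M i j a.source) ⟨a, k⟩ ⟨b, l⟩ := by
    change connect T K P P' hE href (M i j) W' (Arrow.blocks hE href W' ⟨a, k⟩)
      (Arrow.blocks hE href W' ⟨b, l⟩) = _
    rw [connect_apply, Matrix.reindex_apply, Matrix.submatrix_apply, Equiv.symm_apply_apply,
      Equiv.symm_apply_apply]
  rw [Matrix.submatrix_apply, h, Matrix.blockDiagonal'_apply, Matrix.blockDiagonal'_apply]
  by_cases hab : a = b
  · subst hab; simp [flatten]
  · simp [hab]

end LevelSylvester

end RankCrossed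

namespace RankCrossed

/-! ### Regularity, faithfulness and compatibility of the level ranks -/

section LevelRegular

set_option linter.unusedSectionVars false

variable {X : Type*} [TopologicalSpace X] [MeasurableSpace X] [BorelSpace X]
  {T : X ≃ₜ X} {μ : Measure X} [IsProbabilityMeasure μ] {E : Clopens X}
  {P : Finpartition Eᶜ} {K : Type*} [Field K]

theorem exists_levelRing_inverse (x : LevelRing T P K) : ∃ z, x * z * x = x := by
  choose z hz using fun W => exists_mul_mul_eq_self (x W)
  exact ⟨z, funext hz⟩

/-- Here fullness of the measure enters: all weights are positive, so no component of a level ring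
is invisible to the rank. -/
theorem Tower.measure_base_pos [μ.IsOpenPosMeasure] (W : Tower T P) :
    0 < μ.real (W.base : Set X) :=
  ENNReal.toReal_pos (W.base.isOpen.measure_ne_zero μ W.nonempty) (measure_ne_top _ _)

theorem eq_zero_of_levelRank_eq_zero [μ.IsOpenPosMeasure] (hT : Ergodic T μ)
    {x : LevelRing T P K} (h : levelRank μ x = 0) : x = 0 := by
  have hs := summable_levelRank hT x
  have h1 := (hs.hasSum_iff.2 h)
  rw [hasSum_zero_iff_of_nonneg fun W => by positivity] at h1
  funext W
  have h2 := congrFun h1 W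
  rw [levelRank_term] at h2
  have h3 : ((x W).rank : ℝ) = 0 := (mul_eq_zero.1 h2).resolve_left W.measure_base_pos.ne'
  exact (rank_eq_zero_iff _).1 (by exact_mod_cast h3)

theorem levelRank_add_of_orthogonal (hT : Ergodic T μ) {e f : LevelRing T P K}
    (he : e * e = e) (hf : f * f = f) (hef : e * f = 0) (hfe : f * e = 0) :
    levelRank μ (e + f) = levelRank μ e + levelRank μ f := by
  unfold levelRank
  rw [← (summable_levelRank hT e).tsum_add (summable_levelRank hT f)]
  refine tsum_congr fun W => ?_
  rw [Pi.add_apply, rank_add_of_orthogonal (congrFun he W) (congrFun hf W) (congrFun hef W)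
    (congrFun hfe W)]
  push_cast
  ring

/-- The block diagonal embeddings preserve the ranks of matrices. -/
theorem levelMatrixRank_connect (hT : Ergodic T μ) {E' : Clopens X} {P' : Finpartition E'ᶜ}
    (hE : E' ≤ E) (href : ∀ Z' ∈ cells P', ∃ Z ∈ cells P, Z' ≤ Z) (hE' : μ (E' : Set X) ≠ 0)
    {m n : ℕ} (M : Matrix (Fin m) (Fin n) (LevelRing T P K)) :
    levelMatrixRank μ (M.map (connect T K P P' hE href)) = levelMatrixRank μ M := by
  -- In extended nonnegative reals the double sum over towers and arrows can be rearranged without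
  -- summability conditions.
  have conv : ∀ {F : Clopens X} {Q : Finpartition Fᶜ}
      (L : Matrix (Fin m) (Fin n) (LevelRing T Q K)), levelMatrixRank μ L =
      (∑' W : Tower T Q, μ (W.base : Set X) * ((flatten L W).rank : ENNReal)).toReal := by
    intro F Q L
    rw [ENNReal.tsum_toReal_eq fun W => ENNReal.mul_ne_top (measure_ne_top _ _) (by simp)]
    refine tsum_congr fun W => ?_
    rw [ENNReal.toReal_mul]
    simp [Measure.real]
  rw [conv, conv]
  congr 1
  have h1 : ∀ W' : Tower T P', μ (W'.base : Set X) *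
      ((flatten (M.map (connect T K P P' hE href)) W').rank : ENNReal) =
      ∑' a : Arrow P W', μ (W'.base : Set X) * ((flatten M a.source).rank : ENNReal) := by
    intro W'
    rw [rank_flatten_connect, tsum_fintype, ← Finset.mul_sum]
    push_cast
    rfl
  -- Pairs of a fine tower and an arrow ending at it are regrouped by the source W of the arrow. By
  -- `tsum_arrows` the measures of the fine towers in the fibre over W add up to μ(W).
  rw [tsum_congr h1, ← ENNReal.tsum_sigma (fun (W' : Tower T P') (a : Arrow P W') =>
    μ (W'.base : Set X) * ((flatten M a.source).rank : ENNReal)),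
    ← (Equiv.sigmaFiberEquiv fun q : Σ W' : Tower T P', Arrow P W' => q.2.source).tsum_eq,
    ENNReal.tsum_sigma']
  refine tsum_congr fun W => ?_
  rw [← tsum_arrows hT hE href hE' W, ← ENNReal.tsum_mul_right]
  refine tsum_congr fun q => ?_
  obtain ⟨q, rfl⟩ := q
  rfl

end LevelRegular

/-! ### The direct limit and the extension of its matrix rank to the completion -/

namespace ApproxSystem

set_option linter.unusedSectionVars false

variable {X : Type*} [TopologicalSpace X] [MeasurableSpace X] [BorelSpace X]
  (S : ApproxSystem X) {T : X ≃ₜ X} {μ : Measure X} [IsProbabilityMeasure μ]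
  [μ.IsOpenPosMeasure] (hT : Ergodic T μ) (K : Type*) [Field K]

theorem exists_limit_inverse (x : S.Limit T K) : ∃ z, x * z * x = x := by
  obtain ⟨n, a, rfl⟩ := exists_rep x
  obtain ⟨b, hb⟩ := exists_levelRing_inverse a
  exact ⟨S.toLimit T n b, by rw [← map_mul, ← map_mul, hb]⟩

variable {K} in
theorem toLimit_trans (m n : ℕ) (h : m ≤ n) (a : S.Level T K m) :
    S.toLimit T n (S.trans T K m n h a) = S.toLimit T m a :=
  Quotient.sound ⟨n, le_rfl, h, by
    change S.trans T K n n le_rfl (S.trans T K m n h a) = S.trans T K m n h a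
    rw [S.trans_self]; rfl⟩

variable {K} in
-- The rank of an element of a level ring can be read off in the limit, and it is faithful at each
-- level; an element killed in the limit has rank zero.
theorem toLimit_injective (hT : Ergodic T μ) (n : ℕ) : Function.Injective (S.toLimit (K := K) T n) := by
  rw [injective_iff_map_eq_zero]
  intro a ha
  refine eq_zero_of_levelRank_eq_zero hT (x := a) ?_
  rw [← limitRank_toLimit S hT K n a, ha]
  exact (S.limitSeminorm hT K).map_zero'

theorem limitRank_isRankFunction : IsRankFunction (S.limitRank hT K) where
  nonneg x := by
    obtain ⟨n, a, rfl⟩ := exists_rep x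
    exact levelRank_nonneg a
  le_one x := by
    obtain ⟨n, a, rfl⟩ := exists_rep x
    rw [limitRank_toLimit, ← levelRank_one (K := K) (P := S.P n) hT (S.measure_E_ne_zero μ n)]
    conv_lhs => rw [← one_mul a]
    exact levelRank_mul_le_left hT _ _
  map_zero := (S.limitSeminorm hT K).map_zero'
  map_one := by
    rw [← map_one (S.toLimit (K := K) T 0), limitRank_toLimit,
      levelRank_one hT (S.measure_E_ne_zero μ 0)]
  mul_le_left := S.limitRank_mul_le_left hT K
  mul_le_right := S.limitRank_mul_le_right hT K
  add_of_orthogonal e f he hf hef hfe := by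
    obtain ⟨n, a, b, rfl, rfl⟩ := exists_rep₂ e f
    have inj := S.toLimit_injective (K := K) hT n
    rw [← map_add]
    simp only [limitRank_toLimit]
    -- The idempotent and orthogonality relations hold in the limit and are pulled back along the
    -- injective map from the level.
    refine levelRank_add_of_orthogonal hT (inj ?_) (inj ?_) (inj ?_) (inj ?_) <;>
      simpa only [map_mul, map_zero]
  eq_zero x hx := by
    obtain ⟨n, a, rfl⟩ := exists_rep x
    rw [limitRank_toLimit] at hx
    have := eq_zero_of_levelRank_eq_zero hT hx
    exact this ▸ map_zero (S.toLimit T n)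

theorem exists_rep_family {ι : Type*} [Finite ι] (f : ι → S.Limit T K) :
    ∃ (n : ℕ) (g : ι → S.Level T K n), ∀ i, f i = S.toLimit T n (g i) := by
  cases nonempty_fintype ι
  choose k a ha using fun i => exists_rep (f i)
  refine ⟨Finset.univ.sup k, fun i => S.trans T K (k i) _ (Finset.le_sup (Finset.mem_univ i))
    (a i), fun i => ?_⟩
  rw [toLimit_trans, ha]

/-- A lift is provided at every level from some point on, so that several matrices can be lifted to
one common level. -/
theorem exists_rep_matrix {m n : ℕ} (M : Matrix (Fin m) (Fin n) (S.Limit T K)) :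
    ∃ k, ∀ l ≥ k, ∃ A : Matrix (Fin m) (Fin n) (S.Level T K l), M = A.map (S.toLimit T l) := by
  obtain ⟨k, g, hg⟩ := S.exists_rep_family K fun p : Fin m × Fin n => M p.1 p.2
  refine ⟨k, fun l hl => ⟨.of fun i j => S.trans T K k l hl (g (i, j)), ?_⟩⟩
  ext i j
  rw [Matrix.map_apply, Matrix.of_apply, toLimit_trans, ← hg (i, j)]

theorem levelMatrixRank_trans (hT : Ergodic T μ) (k l : ℕ) (h : k ≤ l) {m n : ℕ}
    (A : Matrix (Fin m) (Fin n) (S.Level T K k)) :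
    levelMatrixRank μ (A.map (S.trans T K k l h)) = levelMatrixRank μ A := by
  induction l, h using Nat.le_induction with
  | base => rw [S.trans_self]; congr 1
  | succ n hn ih =>
    rw [← ih, ← levelMatrixRank_connect hT (S.antitone n.le_succ) (S.refines n)
      (S.measure_E_ne_zero μ _), S.trans_succ T K k n hn, Matrix.map_map]
    rfl

theorem exists_rep_matrix₂ {m n m' n' : ℕ} (M : Matrix (Fin m) (Fin n) (S.Limit T K))
    (N : Matrix (Fin m') (Fin n') (S.Limit T K)) :
    ∃ (k : ℕ) (A : Matrix (Fin m) (Fin n) (S.Level T K k))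
      (B : Matrix (Fin m') (Fin n') (S.Level T K k)),
      M = A.map (S.toLimit T k) ∧ N = B.map (S.toLimit T k) := by
  obtain ⟨k, hk⟩ := S.exists_rep_matrix K M
  obtain ⟨l, hl⟩ := S.exists_rep_matrix K N
  obtain ⟨A, hA⟩ := hk (max k l) (le_max_left _ _)
  obtain ⟨B, hB⟩ := hl (max k l) (le_max_right _ _)
  exact ⟨_, A, B, hA, hB⟩

/-- The matrix rank of `R_∞` induced by the matrix ranks of the rings `R_n`. -/
noncomputable def limitMatrixRank (μ : Measure X) {m n : ℕ}
    (M : Matrix (Fin m) (Fin n) (S.Limit T K)) : ℝ :=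
  levelMatrixRank μ ((S.exists_rep_matrix K M).choose_spec _ le_rfl).choose

variable {K} in
-- Independence of the chosen lift: two lifts of one matrix agree at a common later level, by
-- injectivity of the map to the limit, and the transition maps preserve the rank.
theorem limitMatrixRank_map (hT : Ergodic T μ) {k m n : ℕ}
    (A : Matrix (Fin m) (Fin n) (S.Level T K k)) :
    S.limitMatrixRank K μ (A.map (S.toLimit T k)) = levelMatrixRank μ A := by
  have key : ∀ (l : ℕ) (B : Matrix (Fin m) (Fin n) (S.Level T K l)),
      A.map (S.toLimit T k) = B.map (S.toLimit T l) →
        levelMatrixRank μ B = levelMatrixRank μ A := by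
    intro l B h
    rw [← S.levelMatrixRank_trans K hT k _ (le_max_left k l) A,
      ← S.levelMatrixRank_trans K hT l _ (le_max_right k l) B]
    congr 1
    refine Matrix.ext fun i j => S.toLimit_injective hT _ ?_
    rw [Matrix.map_apply, Matrix.map_apply, toLimit_trans, toLimit_trans]
    exact (congrFun (congrFun h i) j).symm
  exact key _ _ ((S.exists_rep_matrix K (A.map (S.toLimit T k))).choose_spec _ le_rfl).choose_spec

/-- The Sylvester matrix rank function of `R_∞`. -/
noncomputable def limitSylvester : SylvesterRank (S.Limit T K) where
  rk M := S.limitMatrixRank K μ M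
  nonneg M := tsum_nonneg fun W => by positivity
  zero m n := by
    rw [← Matrix.map_zero (S.toLimit (K := K) T 0) (map_zero _), S.limitMatrixRank_map hT]
    exact (levelSylvester hT (S.P 0) K (S.measure_E_ne_zero μ 0)).zero m n
  one := by
    rw [← Matrix.map_one (S.toLimit (K := K) T 0) (map_zero _) (map_one _),
      S.limitMatrixRank_map hT]
    exact (levelSylvester hT (S.P 0) K (S.measure_E_ne_zero μ 0)).one
  mul_le_left M N := by
    obtain ⟨k, A, B, rfl, rfl⟩ := S.exists_rep_matrix₂ K M N
    rw [← Matrix.map_mul, S.limitMatrixRank_map hT, S.limitMatrixRank_map hT]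
    exact (levelSylvester hT (S.P k) K (S.measure_E_ne_zero μ k)).mul_le_left A B
  mul_le_right M N := by
    obtain ⟨k, A, B, rfl, rfl⟩ := S.exists_rep_matrix₂ K M N
    rw [← Matrix.map_mul, S.limitMatrixRank_map hT, S.limitMatrixRank_map hT]
    exact (levelSylvester hT (S.P k) K (S.measure_E_ne_zero μ k)).mul_le_right A B
  diag M N := by
    obtain ⟨k, A, B, rfl, rfl⟩ := S.exists_rep_matrix₂ K M N
    rw [S.limitMatrixRank_map hT, S.limitMatrixRank_map hT, ← levelMatrixRank_diag hT,
      ← S.limitMatrixRank_map hT, Matrix.reindex_apply, Matrix.reindex_apply,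
      ← Matrix.submatrix_map, Matrix.fromBlocks_map, Matrix.map_zero _ (map_zero _),
      Matrix.map_zero _ (map_zero _)]
  triangular {m n m' n'} M N L := by
    obtain ⟨k, hk⟩ := S.exists_rep_matrix K M
    obtain ⟨l, hl⟩ := S.exists_rep_matrix K N
    obtain ⟨o, ho⟩ := S.exists_rep_matrix K L
    obtain ⟨A, rfl⟩ := hk (max k (max l o)) (le_max_left _ _)
    obtain ⟨B, rfl⟩ := hl (max k (max l o)) ((le_max_left _ _).trans (le_max_right _ _))
    obtain ⟨C, rfl⟩ := ho (max k (max l o)) ((le_max_right _ _).trans (le_max_right _ _))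
    rw [S.limitMatrixRank_map hT, S.limitMatrixRank_map hT]
    refine (levelMatrixRank_triangular hT A B C).trans_eq ?_
    rw [← S.limitMatrixRank_map hT, Matrix.reindex_apply, Matrix.reindex_apply,
      ← Matrix.submatrix_map, Matrix.fromBlocks_map, Matrix.map_zero _ (map_zero _)]

theorem limitSylvester_elt (x : S.Limit T K) :
    (S.limitSylvester hT K).elt x = S.limitRank hT K x := by
  obtain ⟨n, a, rfl⟩ := exists_rep x
  have h : (!![S.toLimit T n a] : Matrix (Fin 1) (Fin 1) (S.Limit T K)) =
      (!![a] : Matrix (Fin 1) (Fin 1) (S.Level T K n)).map (S.toLimit T n) := by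
    ext i j
    rw [Subsingleton.elim i 0, Subsingleton.elim j 0]; rfl
  rw [limitRank_toLimit, ← levelSylvester_elt hT (S.measure_E_ne_zero μ n)]
  change S.limitMatrixRank K μ _ = levelMatrixRank μ _
  rw [h, S.limitMatrixRank_map hT]

/-- The matrix rank of `R_∞` extends continuously to matrices over the completion. -/
theorem exists_continuous_extension (m n : ℕ) :
    ∃ g : Matrix (Fin m) (Fin n) (S.RankCompletion hT K) → ℝ, Continuous g ∧
      ∀ A : Matrix (Fin m) (Fin n) (S.Limit T K),
        g (A.map (S.toCompletion hT K)) = (S.limitSylvester hT K).rk A := by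
  classical
  let N := S.limitSylvester hT K
  let c : (Fin m → Fin n → S.Limit T K) → (Fin m → Fin n → S.RankCompletion hT K) :=
    fun A i j => S.toCompletion hT K (A i j)
  -- Each of the m n terms of the entrywise estimate is at most the sup distance of the two
  -- matrices.
  have lip : ∀ A B : Fin m → Fin n → S.Limit T K,
      N.rk (.of A) - N.rk (.of B) ≤ (m * n : ℕ) * dist (c A) (c B) := by
    intro A B
    refine (N.sub_le _ _).trans ?_
    have h : ∀ i j, N.elt (A i j - B i j) ≤ dist (c A) (c B) := by
      intro i j
      rw [limitSylvester_elt, ← norm_toCompletion, map_sub, ← dist_eq_norm]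
      exact (dist_le_pi_dist (c A i) (c B i) j).trans (dist_le_pi_dist (c A) (c B) i)
    calc ∑ i, ∑ j, N.elt (A i j - B i j) ≤ ∑ _i : Fin m, ∑ _j : Fin n, dist (c A) (c B) :=
          Finset.sum_le_sum fun i _ => Finset.sum_le_sum fun j _ => h i j
      _ = (m * n : ℕ) * dist (c A) (c B) := by simp [mul_assoc]
  -- The rank of some preimage in R_∞; off the image of `c` the value 0 is arbitrary.
  let f : (Fin m → Fin n → S.RankCompletion hT K) → ℝ := fun B =>
    if h : ∃ A, c A = B then N.rk (.of h.choose) else 0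
  -- Two preimages of one matrix are at distance 0, so the Lipschitz bound in both directions shows
  -- that they have the same rank.
  have hf : ∀ A, f (c A) = N.rk (.of A) := by
    intro A
    have h : ∃ A', c A' = c A := ⟨A, rfl⟩
    have hc := h.choose_spec
    have h1 := lip h.choose A
    have h2 := lip A h.choose
    rw [hc, dist_self, mul_zero] at h1 h2
    simp only [f, dif_pos h]
    linarith
  have hl : LipschitzOnWith (m * n : ℕ) f (Set.range c) := by
    refine LipschitzOnWith.of_dist_le_mul ?_
    rintro _ ⟨A, rfl⟩ _ ⟨B, rfl⟩
    rw [hf, hf, Real.dist_eq, abs_le]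
    have h1 := lip A B
    have h2 := lip B A
    rw [dist_comm] at h2
    constructor
    · push_cast at *; linarith
    · push_cast at *; linarith
  -- A real Lipschitz function extends from any subset. Density of the image is needed only later,
  -- for the axioms.
  obtain ⟨g, hg, hgf⟩ := hl.extend_real
  exact ⟨g, hg.continuous, fun A => (hgf ⟨A, rfl⟩).symm.trans (hf A)⟩

theorem denseRange_map (m n : ℕ) : DenseRange
    fun A : Matrix (Fin m) (Fin n) (S.Limit T K) => A.map (S.toCompletion hT K) :=
  DenseRange.piMap fun _ => DenseRange.piMap fun _ => UniformSpace.Completion.denseRange_coe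
    (α := S.RankedLimit hT K)

/-- The rank function of the completion extends to a Sylvester matrix rank function. -/
theorem exists_completionSylvester :
    ∃ N : SylvesterRank (S.RankCompletion hT K), ∀ s, N.elt s = ‖s‖ := by
  choose g hg hgA using S.exists_continuous_extension hT K
  let N := S.limitSylvester hT K
  -- A closed condition on a pair of matrices over the completion needs to be checked only for
  -- matrices coming from R_∞.
  have dense₂ : ∀ {m n m' n' : ℕ} (p : Matrix (Fin m) (Fin n) (S.RankCompletion hT K) ×
      Matrix (Fin m') (Fin n') (S.RankCompletion hT K) → Prop) (_ : IsClosed {x | p x})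
      (_ : ∀ (A : Matrix (Fin m) (Fin n) (S.Limit T K))
        (B : Matrix (Fin m') (Fin n') (S.Limit T K)), p (A.map (S.toCompletion hT K), B.map (S.toCompletion hT K))) (x), p x :=
    fun p hp h x => ((S.denseRange_map hT K _ _).prodMap (S.denseRange_map hT K _ _)).induction_on
      x hp fun a => h a.1 a.2
  refine ⟨{
    rk := fun {m n} M => g m n M
    nonneg := fun {m n} M => (S.denseRange_map hT K m n).induction_on M
      (isClosed_le continuous_const (hg m n)) fun A => by rw [hgA]; exact N.nonneg A
    zero := fun m n => by
      rw [← Matrix.map_zero (S.toCompletion hT K) (map_zero _), hgA, N.zero]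
    one := by
      rw [← Matrix.map_one (S.toCompletion hT K) (map_zero _) (map_one _), hgA, N.one]
    mul_le_left := fun {l m n} M L => dense₂
      (fun x => g l n (x.1 * x.2) ≤ g l m x.1)
      (isClosed_le ((hg l n).comp (continuous_fst.matrix_mul continuous_snd))
        ((hg l m).comp continuous_fst))
      (fun A B => by
        dsimp only
        rw [← Matrix.map_mul, hgA, hgA]; exact N.mul_le_left A B) (M, L)
    mul_le_right := fun {l m n} M L => dense₂
      (fun x => g l n (x.1 * x.2) ≤ g m n x.2)
      (isClosed_le ((hg l n).comp (continuous_fst.matrix_mul continuous_snd))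
        ((hg m n).comp continuous_snd))
      (fun A B => by
        dsimp only
        rw [← Matrix.map_mul, hgA, hgA]; exact N.mul_le_right A B) (M, L)
    diag := fun {m n m' n'} M L => dense₂
      (fun x => g _ _ (Matrix.reindex finSumFinEquiv finSumFinEquiv
        (Matrix.fromBlocks x.1 0 0 x.2)) = g m n x.1 + g m' n' x.2)
      (isClosed_eq ((hg _ _).comp ((continuous_fst.matrix_fromBlocks continuous_const
        continuous_const continuous_snd).matrix_reindex _ _))
        (((hg _ _).comp continuous_fst).add ((hg _ _).comp continuous_snd)))
      (fun A B => by
        dsimp only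
        rw [hgA, hgA, ← N.diag, ← hgA, Matrix.reindex_apply, Matrix.reindex_apply,
          ← Matrix.submatrix_map, Matrix.fromBlocks_map, Matrix.map_zero _ (map_zero _),
          Matrix.map_zero _ (map_zero _)]) (M, L)
    triangular := fun {m n m' n'} M L B => by
      -- The same density argument for three matrices, as the off-diagonal block varies too.
      have key := ((S.denseRange_map hT K m n).prodMap ((S.denseRange_map hT K m' n').prodMap
        (S.denseRange_map hT K m n'))).induction_on
        (p := fun x => g m n x.1 + g m' n' x.2.1 ≤
          g _ _ (Matrix.reindex finSumFinEquiv finSumFinEquiv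
            (Matrix.fromBlocks x.1 x.2.2 0 x.2.1))) (M, L, B) ?_ ?_
      · exact key
      · exact isClosed_le (((hg _ _).comp continuous_fst).add
            ((hg _ _).comp (continuous_fst.comp continuous_snd)))
          ((hg _ _).comp ((continuous_fst.matrix_fromBlocks (continuous_snd.comp continuous_snd)
            continuous_const (continuous_fst.comp continuous_snd)).matrix_reindex _ _))
      · rintro ⟨A, C, D⟩
        dsimp only [Prod.map]
        rw [hgA, hgA]
        refine (N.triangular A C D).trans_eq ?_
        rw [← hgA, Matrix.reindex_apply, Matrix.reindex_apply,
          ← Matrix.submatrix_map, Matrix.fromBlocks_map, Matrix.map_zero _ (map_zero _)] }, ?_⟩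
  intro s
  refine (UniformSpace.Completion.denseRange_coe (α := S.RankedLimit hT K)).induction_on
    (p := fun s => g 1 1 !![s] = ‖s‖) s (isClosed_eq ((hg 1 1).comp ?_) continuous_norm) fun x => ?_
  · exact continuous_matrix fun i j => by
      rw [Subsingleton.elim i 0, Subsingleton.elim j 0]; exact continuous_id
  · have h : (!![(x : S.RankCompletion hT K)] : Matrix (Fin 1) (Fin 1) (S.RankCompletion hT K)) =
        (!![x] : Matrix (Fin 1) (Fin 1) (S.Limit T K)).map (S.toCompletion hT K) := by
      ext i j
      rw [Subsingleton.elim i 0, Subsingleton.elim j 0]; rfl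
    have h2 : ‖(x : S.RankCompletion hT K)‖ = S.limitRank hT K x := S.norm_toCompletion hT K x
    rw [h, hgA, h2]
    exact S.limitSylvester_elt hT K x

end ApproxSystem
end RankCrossed

namespace RankCrossed

/-! ### Consequences of ergodicity and fullness: no atoms, topological freeness -/

section Aperiodic

set_option linter.unusedSectionVars false

open Filter
open scoped Topology

theorem zpow_apply_of_fixed {X : Type*} [TopologicalSpace X] (T : X ≃ₜ X) {n : ℤ} {x : X}
    (h : (T ^ n) x = x) (q : ℤ) : (T ^ (n * q)) x = x := by
  induction q using Int.induction_on with
  | zero => simp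
  | succ i ih => rw [mul_add, mul_one, zpow_add_apply, h, ih]
  | pred i ih =>
    have h' : (T ^ (-n)) x = x := by conv_lhs => rw [← h, zpow_neg_apply]
    rw [mul_sub, mul_one, sub_eq_add_neg, zpow_add_apply, h', ih]

variable {X : Type*} [TopologicalSpace X] [CompactSpace X] [T2Space X]
  [TotallyDisconnectedSpace X] [Infinite X] [MeasurableSpace X] [BorelSpace X] {T : X ≃ₜ X}
  {μ : Measure X} [IsProbabilityMeasure μ] [μ.IsOpenPosMeasure]

/-- By ergodicity the complement is a null set. It is open, so by fullness it is empty. -/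
theorem eq_univ_of_isClosed_of_invariant (hT : Ergodic T μ) {F : Set X} (hF : IsClosed F)
    (hinv : T ⁻¹' F = F) (h0 : μ F ≠ 0) : F = Set.univ := by
  rcases hT.measure_self_or_compl_eq_zero hF.measurableSet hinv with h | h
  · exact absurd h h0
  · rw [← Set.compl_empty_iff]
    exact (hF.isOpen_compl.measure_eq_zero_iff μ).1 h

theorem finite_orbit {n : ℕ} (hn : 0 < n) {x : X} (h : (T ^ (n : ℤ)) x = x) :
    (Set.range fun k : ℤ => (T ^ k) x).Finite := by
  refine ((Finset.range n).finite_toSet.image fun k : ℕ => (T ^ (k : ℤ)) x).subset ?_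
  rintro _ ⟨k, rfl⟩
  have hn' : (n : ℤ) ≠ 0 := by exact_mod_cast hn.ne'
  refine ⟨(k % n).toNat, ?_, ?_⟩
  · have := Int.emod_lt_of_pos k (by exact_mod_cast hn : (0 : ℤ) < n)
    have := Int.emod_nonneg k hn'
    simp only [Finset.coe_range, Set.mem_Iio]
    omega
  · dsimp only
    rw [Int.toNat_of_nonneg (Int.emod_nonneg k hn')]
    conv_rhs => rw [← Int.emod_add_mul_ediv k n, zpow_add_apply, zpow_apply_of_fixed T h]

theorem preimage_orbit (x : X) :
    T ⁻¹' (Set.range fun k : ℤ => (T ^ k) x) = Set.range fun k : ℤ => (T ^ k) x := by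
  ext z
  constructor
  · rintro ⟨k, hk⟩
    refine ⟨-1 + k, ?_⟩
    change (T ^ (-1 + k)) x = z
    have hk : (T ^ k) x = (T ^ (1 : ℤ)) z := by rw [zpow_one]; exact hk
    rw [zpow_add_apply, hk, zpow_neg_apply]
  · rintro ⟨k, rfl⟩
    refine ⟨1 + k, ?_⟩
    change (T ^ (1 + k)) x = T ((T ^ k) x)
    rw [zpow_add_apply, zpow_one]

/-- By Poincaré recurrence an atom returns to itself, so its orbit is finite. This orbit is a closed
invariant set of positive measure, hence all of the infinite space X, a contradiction. -/
theorem measure_singleton_eq_zero (hT : Ergodic T μ) (x : X) : μ {x} = 0 := by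
  by_contra h0
  obtain ⟨z, hz, m, hm, hzm⟩ := hT.toMeasurePreserving.conservative.exists_mem_iterate_mem
    (measurableSet_singleton x).nullMeasurableSet h0
  obtain rfl : z = x := hz
  have hfix : (T ^ (m : ℤ)) z = z := by rw [zpow_natCast_apply]; exact hzm
  have hfin := finite_orbit (Nat.pos_of_ne_zero hm) hfix
  have huniv := eq_univ_of_isClosed_of_invariant hT hfin.isClosed (preimage_orbit z) (fun h =>
    h0 (measure_mono_null (Set.singleton_subset_iff.2
      (⟨0, rfl⟩ : z ∈ Set.range fun k : ℤ => (T ^ k) z)) h))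
  rw [huniv] at hfin
  exact Set.infinite_univ hfin

/-- If T^n were the identity, every orbit would be finite. A clopen set U around a point outside the
orbit of x, chosen disjoint from that orbit, would have a closed saturation of positive measure,
hence equal to X, and the orbit of x would meet U after all. -/
theorem exists_zpow_apply_ne (hT : Ergodic T μ) {n : ℕ} (hn : 0 < n) :
    ∃ x, (T ^ (n : ℤ)) x ≠ x := by
  by_contra! hfix
  obtain ⟨x⟩ : Nonempty X := inferInstance
  have hfin := finite_orbit hn (hfix x)
  obtain ⟨z, hz⟩ := hfin.infinite_compl.nonempty
  obtain ⟨U, hU, hzU, hUx⟩ := compact_exists_isClopen_in_isOpen hfin.isClosed.isOpen_compl hz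
  -- As T^n is supposed to be the identity, n translates already give the invariant saturation of U.
  -- Being a finite union, it is closed.
  let G : Set X := ⋃ k ∈ Finset.range n, (T ^ (k : ℤ)) ⁻¹' U
  have hG : ∀ w, w ∈ G ↔ ∃ k : ℤ, (T ^ k) w ∈ U := by
    intro w
    constructor
    · intro hw
      obtain ⟨k, -, hk⟩ := Set.mem_iUnion₂.1 hw
      exact ⟨k, hk⟩
    · rintro ⟨k, hk⟩
      have hn' : (n : ℤ) ≠ 0 := by exact_mod_cast hn.ne'
      have h1 := Int.emod_lt_of_pos k (by exact_mod_cast hn : (0 : ℤ) < n)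
      have h2 := Int.emod_nonneg k hn'
      refine Set.mem_iUnion₂.2 ⟨(k % n).toNat, Finset.mem_range.2 (by omega), ?_⟩
      rw [Set.mem_preimage, Int.toNat_of_nonneg h2]
      rwa [← Int.emod_add_mul_ediv k n, zpow_add_apply, zpow_apply_of_fixed T (hfix w)] at hk
  have hGc : IsClosed G := isClosed_biUnion_finset fun k _ => hU.1.preimage (T ^ (k : ℤ)).continuous
  have hGinv : T ⁻¹' G = G := by
    ext w
    rw [Set.mem_preimage, hG, hG]
    constructor
    · rintro ⟨k, hk⟩
      refine ⟨k + 1, ?_⟩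
      rwa [zpow_add_apply, zpow_one]
    · rintro ⟨k, hk⟩
      refine ⟨k - 1, ?_⟩
      have : T w = (T ^ (1 : ℤ)) w := by rw [zpow_one]
      rwa [this, ← zpow_add_apply, sub_add_cancel]
  have hsub : U ⊆ G := fun w hw => (hG w).2 ⟨0, hw⟩
  have huniv := eq_univ_of_isClosed_of_invariant hT hGc hGinv fun h =>
    hU.2.measure_ne_zero μ ⟨z, hzU⟩ (measure_mono_null hsub h)
  obtain ⟨k, hk⟩ := (hG x).1 (huniv ▸ Set.mem_univ x)
  exact hUx hk ⟨k, rfl⟩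

/-- Every nonempty open set contains a nonempty clopen set which is disjoint from its first
translates. -/
theorem exists_clopen_disjoint_translates (hT : Ergodic T μ) {U : Set X} (hU : IsOpen U)
    (hne : U.Nonempty) (d : ℕ) :
    ∃ V : Clopens X, (V : Set X).Nonempty ∧ (V : Set X) ⊆ U ∧
      ∀ k : ℤ, k ≠ 0 → k.natAbs ≤ d → ∀ x ∈ V, (T ^ k) x ∉ V := by
  -- Every nonzero k with |k| ≤ d divides d!, so `F` contains all points fixed by such a T^k. It is
  -- closed and invariant; if it contained U it would be X, which makes T^{d!} the identity.
  let F : Set X := {x | (T ^ ((d.factorial : ℕ) : ℤ)) x = x}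
  have hFc : IsClosed F := isClosed_eq (T ^ _).continuous continuous_id
  have hFinv : T ⁻¹' F = F := by
    ext w
    change (T ^ ((d.factorial : ℕ) : ℤ)) (T w) = T w ↔ (T ^ ((d.factorial : ℕ) : ℤ)) w = w
    have h1 : ∀ w, T w = (T ^ (1 : ℤ)) w := fun w => by rw [zpow_one]
    rw [h1, ← zpow_add_apply, add_comm, zpow_add_apply]
    exact (T ^ (1 : ℤ)).injective.eq_iff
  obtain ⟨x, hxU, hxF⟩ : ∃ x ∈ U, x ∉ F := by
    by_contra! hUF
    have huniv := eq_univ_of_isClosed_of_invariant hT hFc hFinv fun h =>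
      hU.measure_ne_zero μ hne (measure_mono_null hUF h)
    obtain ⟨x, hx⟩ := exists_zpow_apply_ne hT (Nat.factorial_pos d)
    exact hx (huniv ▸ Set.mem_univ x : x ∈ F)
  have hmove : ∀ k : ℤ, k ≠ 0 → k.natAbs ≤ d → (T ^ k) x ≠ x := by
    intro k hk hkd hfix
    apply hxF
    have hdvd : k ∣ (d.factorial : ℤ) := by
      rw [← Int.natAbs_dvd]
      exact_mod_cast Nat.dvd_factorial (Int.natAbs_pos.2 hk) hkd
    obtain ⟨q, hq⟩ := hdvd
    change (T ^ ((d.factorial : ℕ) : ℤ)) x = x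
    rw [hq]
    exact zpow_apply_of_fixed T hfix q
  have hsep : ∀ k : ℤ, ∃ V : Set X, IsOpen V ∧ x ∈ V ∧
      (k ≠ 0 → k.natAbs ≤ d → ∀ z ∈ V, (T ^ k) z ∉ V) := by
    intro k
    by_cases hk : k ≠ 0 ∧ k.natAbs ≤ d
    · obtain ⟨A, B, hA, hB, hxA, hxB, hAB⟩ := t2_separation (hmove k hk.1 hk.2).symm
      exact ⟨A ∩ (T ^ k) ⁻¹' B, hA.inter (hB.preimage (T ^ k).continuous), ⟨hxA, hxB⟩,
        fun _ _ z hz hz' => Set.disjoint_left.1 hAB hz'.1 hz.2⟩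
    -- For the remaining k nothing is required; the whole space serves as a default.
    · exact ⟨Set.univ, isOpen_univ, Set.mem_univ x, fun h1 h2 => absurd ⟨h1, h2⟩ hk⟩
  choose V hVo hxV hV using hsep
  obtain ⟨V', hV', hxV', hsub⟩ := compact_exists_isClopen_in_isOpen
    (hU.inter (isOpen_biInter_finset (s := Finset.Icc (-d : ℤ) d) fun k _ => hVo k))
    ⟨hxU, Set.mem_iInter₂.2 fun k _ => hxV k⟩
  refine ⟨⟨V', hV'⟩, ⟨x, hxV'⟩, fun z hz => (hsub hz).1, fun k hk hkd z hz hz' => ?_⟩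
  have hmem : k ∈ Finset.Icc (-d : ℤ) d := Finset.mem_Icc.2 (by omega)
  exact hV k hk hkd z (Set.mem_iInter₂.1 (hsub hz).2 k hmem) (Set.mem_iInter₂.1 (hsub hz').2 k hmem)

end Aperiodic

/-! ### Refining partitions and the shrinking sets E_n -/

namespace ApproxSystem

set_option linter.unusedSectionVars false

open Filter
open scoped Topology

variable {X : Type*} [TopologicalSpace X] (S : ApproxSystem X)

/-- Continuity from above: the intersection is the single point y, which is a null set. This is why
the boundary errors of compressions vanish in the limit. -/
theorem tendsto_measure_E [CompactSpace X] [T2Space X] [Infinite X] [MeasurableSpace X]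
    [BorelSpace X] [TotallyDisconnectedSpace X] {T : X ≃ₜ X} {μ : Measure X}
    [IsProbabilityMeasure μ] [μ.IsOpenPosMeasure] (hT : Ergodic T μ) :
    Tendsto (fun n => μ.real (S.E n : Set X)) atTop (𝓝 0) := by
  have h := tendsto_measure_iInter_atTop (μ := μ) (s := fun n => (S.E n : Set X))
    (fun n => (measurableSet_clopen (S.E n)).nullMeasurableSet)
    (fun m n h => S.antitone h) ⟨0, measure_ne_top _ _⟩
  rw [S.iInter_eq, measure_singleton_eq_zero hT] at h
  exact (ENNReal.tendsto_toReal ENNReal.zero_ne_top).comp h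

theorem exists_cell (n : ℕ) (x : X) : ∃ Z ∈ cells (S.P n), x ∈ Z := by
  by_cases hx : x ∈ S.E n
  · exact ⟨_, Or.inl rfl, hx⟩
  · obtain ⟨Z, hZ, hxZ⟩ := Tower.exists_part (P := S.P n) hx
    exact ⟨Z, Or.inr hZ, hxZ⟩

theorem exists_coarser_cell {m n : ℕ} (h : m ≤ n) {Z' : Clopens X} (hZ' : Z' ∈ cells (S.P n)) :
    ∃ Z ∈ cells (S.P m), Z' ≤ Z := by
  induction n, h using Nat.le_induction generalizing Z' with
  | base => exact ⟨Z', hZ', le_rfl⟩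
  | succ n _ ih =>
    obtain ⟨Z₁, h1, h2⟩ := S.refines n Z' hZ'
    obtain ⟨Z, h3, h4⟩ := ih h1
    exact ⟨Z, h3, h2.trans h4⟩

/-- The cells are given only as a subbasis. Because the partitions refine each other, the
intersection of two cells at x contains the cell at x of the finer level, so they form a basis. -/
theorem exists_cell_subset {U : Set X} (hU : IsOpen U) {x : X} (hx : x ∈ U) :
    ∃ n, ∃ Z ∈ cells (S.P n), x ∈ Z ∧ (Z : Set X) ⊆ U := by
  rw [S.generates] at hU
  induction hU with
  | basic s hs =>
    obtain ⟨n, Z, hZ, rfl⟩ := Set.mem_iUnion.1 hs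
    exact ⟨n, Z, hZ, hx, le_rfl⟩
  | univ =>
    obtain ⟨Z, hZ, hxZ⟩ := S.exists_cell 0 x
    exact ⟨0, Z, hZ, hxZ, Set.subset_univ _⟩
  | inter s t _ _ ihs iht =>
    obtain ⟨m, A, hA, hxA, hAs⟩ := ihs hx.1
    obtain ⟨n, B, hB, hxB, hBt⟩ := iht hx.2
    obtain ⟨Z, hZ, hxZ⟩ := S.exists_cell (max m n) x
    obtain ⟨A', hA', hZA⟩ := S.exists_coarser_cell (le_max_left m n) hZ
    obtain ⟨B', hB', hZB⟩ := S.exists_coarser_cell (le_max_right m n) hZ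
    obtain rfl := Tower.cell_unique hA hA' hxA (hZA hxZ)
    obtain rfl := Tower.cell_unique hB hB' hxB (hZB hxZ)
    exact ⟨_, Z, hZ, hxZ, fun z hz => ⟨hAs (hZA hz), hBt (hZB hz)⟩⟩
  | sUnion s _ ih =>
    obtain ⟨t, ht, hxt⟩ := hx
    obtain ⟨n, Z, hZ, hxZ, hZt⟩ := ih t ht hxt
    exact ⟨n, Z, hZ, hxZ, hZt.trans (Set.subset_sUnion_of_mem ht)⟩

/-- A locally constant function is constant on the cells of all sufficiently fine partitions. -/
theorem exists_const_on_cells [CompactSpace X] {Y : Type*} {f : X → Y}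
    (hf : IsLocallyConstant f) :
    ∃ n₀, ∀ n ≥ n₀, ∀ Z ∈ cells (S.P n), ∀ x ∈ Z, ∀ z ∈ Z, f x = f z := by
  choose k C hC hxC hCf using fun x =>
    S.exists_cell_subset (hf.isOpen_fiber (f x)) (x := x) rfl
  -- By compactness finitely many cells on which f is constant cover X; the largest of their levels
  -- will do.
  obtain ⟨t, ht⟩ := isCompact_univ.elim_finite_subcover (fun x => (C x : Set X))
    (fun x => (C x).isOpen) fun x _ => Set.mem_iUnion.2 ⟨x, hxC x⟩
  refine ⟨t.sup k, fun n hn Z hZ x hx z hz => ?_⟩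
  obtain ⟨w, hw, hxw⟩ := Set.mem_iUnion₂.1 (ht (Set.mem_univ x))
  obtain ⟨C', hC', hZC⟩ := S.exists_coarser_cell ((Finset.le_sup hw).trans hn) hZ
  obtain rfl := Tower.cell_unique (hC w) hC' hxw (hZC hx)
  exact (hCf w (hZC hx)).trans (hCf w (hZC hz)).symm

end ApproxSystem
end RankCrossed

namespace RankCrossed

/-! ### Compression of the crossed product to the towers -/

section Compress

set_option linter.unusedSectionVars false

variable {X : Type*} [TopologicalSpace X] {T : X ≃ₜ X} {E : Clopens X} {P : Finpartition Eᶜ}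
  {K : Type*} [Field K]

/-- A point of the base of a tower. -/
noncomputable def Tower.point (W : Tower T P) : X := W.nonempty.some

theorem Tower.point_mem (W : Tower T P) : W.point ∈ W.base := W.nonempty.some_mem

theorem monomial_mul (f g : FunctionAlgebra T K) (i j : ℤ) :
    monomial T K f i * monomial T K g j =
      monomial T K (f * Multiplicative.ofAdd i • g) (i + j) := by
  unfold monomial
  rw [SkewMonoidAlgebra.single_mul_single]
  rfl

theorem FunctionAlgebra.ext {f g : FunctionAlgebra T K} (h : ∀ x, f x = g x) : f = g :=
  LocallyConstant.ext h

theorem FunctionAlgebra.mul_apply (f g : FunctionAlgebra T K) (x : X) :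
    (f * g) x = f x * g x := rfl

theorem FunctionAlgebra.add_apply (f g : FunctionAlgebra T K) (x : X) :
    (f + g) x = f x + g x := rfl

open Classical in
theorem FunctionAlgebra.char_apply (U : Clopens X) (x : X) :
    FunctionAlgebra.char T K U x = if x ∈ U then 1 else 0 := by
  change LocallyConstant.charFn K U.isClopen x = _
  rw [LocallyConstant.coe_charFn, Set.indicator_apply]
  exact if_congr Iff.rfl rfl rfl

theorem coeff_monomial (f : FunctionAlgebra T K) (i k : ℤ) :
    (monomial T K f i).coeff (Multiplicative.ofAdd k) = if k = i then f else 0 := by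
  classical
  unfold monomial
  rw [SkewMonoidAlgebra.coeff_single_apply]
  exact if_congr (eq_comm.trans Multiplicative.ofAdd.injective.eq_iff) rfl rfl

variable (P) in
/-- The compression of an element of the crossed product, regarded as an operator on the functions
on an orbit, to the towers. -/
noncomputable def compress : CrossedProduct T K →ₗ[K] LevelRing T P K where
  toFun a W := .of fun p q =>
    a.coeff (Multiplicative.ofAdd ((p : ℤ) - (q : ℤ))) ((T ^ ((p : ℕ) : ℤ)) W.point)
  map_add' a b := by
    simp only [SkewMonoidAlgebra.coeff_add]
    rfl
  map_smul' c a := by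
    simp only [SkewMonoidAlgebra.coeff_smul]
    rfl

theorem compress_monomial (f : FunctionAlgebra T K) (i : ℤ) (W : Tower T P) (p q : Fin W.len) :
    compress P (monomial T K f i) W p q =
      if (p : ℤ) - (q : ℤ) = i then f ((T ^ ((p : ℕ) : ℤ)) W.point) else 0 := by
  change ((monomial T K f i).coeff (Multiplicative.ofAdd ((p : ℤ) - (q : ℤ)))) _ = _
  rw [coeff_monomial]
  split_ifs <;> rfl

theorem compress_one : compress P (1 : CrossedProduct T K) = 1 := by
  have h : (1 : CrossedProduct T K) = monomial T K 1 0 := rfl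
  funext W
  ext p q
  rw [h, compress_monomial, Pi.one_apply, Matrix.one_apply]
  refine if_congr ?_ rfl rfl
  rw [sub_eq_zero, Fin.ext_iff]
  exact_mod_cast Iff.rfl

/-- In row p only the intermediate index p - i contributes to the product of the compressions. If it
lies in the tower, this row is the same as for the compressed product; it fails to lie there for at
most |i| rows, at one end of the tower. -/
theorem rank_compress_mul_sub_le (f g : FunctionAlgebra T K) (i j : ℤ) (W : Tower T P) :
    ((compress P (monomial T K f i * monomial T K g j) -
      compress P (monomial T K f i) * compress P (monomial T K g j)) W).rank ≤ i.natAbs := by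
  classical
  -- The exceptional rows are among the first i rows if i ≥ 0 and among the last |i| rows if i ≤ 0.
  let s : Finset (Fin W.len) :=
    Finset.univ.filter fun p => ¬ (0 ≤ (p : ℤ) - i ∧ (p : ℤ) - i < W.len)
  have hs : s.card ≤ i.natAbs := by
    rw [← Finset.card_range i.natAbs]
    rcases le_total 0 i with hi | hi
    · refine Finset.card_le_card_of_injOn (fun p => (p : ℕ)) (fun p hp => ?_)
        (fun p _ q _ h => Fin.ext h)
      have hp := (Finset.mem_filter.1 hp).2
      have := p.2
      simp only [Finset.coe_range, Set.mem_Iio]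
      omega
    · refine Finset.card_le_card_of_injOn (fun p => W.len - 1 - (p : ℕ)) (fun p hp => ?_)
        (fun p _ q _ h => Fin.ext ?_)
      · have hp := (Finset.mem_filter.1 hp).2
        have := p.2
        simp only [Finset.coe_range, Set.mem_Iio]
        omega
      · have := p.2
        have := q.2
        dsimp only at h
        omega
  refine (Matrix.rank_le_card_of_support_subset _ s fun p hp => ?_).trans hs
  by_contra hps
  apply hp
  have hp' : 0 ≤ (p : ℤ) - i ∧ (p : ℤ) - i < W.len := by
    by_contra h
    exact hps (Finset.mem_coe.2 (Finset.mem_filter.2 ⟨Finset.mem_univ _, h⟩))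
  obtain ⟨r, hr⟩ : ∃ r : Fin W.len, (r : ℤ) = p - i :=
    ⟨⟨((p : ℤ) - i).toNat, by omega⟩, by simp only; omega⟩
  funext q
  change compress P (monomial T K f i * monomial T K g j) W p q -
    (compress P (monomial T K f i) W * compress P (monomial T K g j) W) p q = 0
  rw [sub_eq_zero, monomial_mul, compress_monomial, Matrix.mul_apply,
    Finset.sum_eq_single r]
  · rw [compress_monomial, compress_monomial, if_pos (show (p : ℤ) - (r : ℤ) = i by omega)]
    by_cases h : (p : ℤ) - (q : ℤ) = i + j
    · rw [if_pos h, if_pos (by omega), FunctionAlgebra.mul_apply, FunctionAlgebra.smul_apply,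
        toAdd_ofAdd, ← zpow_add_apply, show -i + (p : ℤ) = r by omega]
    · rw [if_neg h, if_neg (by omega), mul_zero]
  · intro r' _ hr'
    rw [compress_monomial, if_neg, zero_mul]
    intro h
    exact hr' (Fin.ext (by omega))
  · exact fun h => absurd (Finset.mem_univ r) h

end Compress

/-! ### Comparing the compressions at consecutive levels -/

section Step

set_option linter.unusedSectionVars false

variable {X : Type*} [TopologicalSpace X] {T : X ≃ₜ X} {E E' : Clopens X} {P : Finpartition Eᶜ}
  {P' : Finpartition E'ᶜ} {K : Type*} [Field K]

theorem Arrow.toFin_val (hE : E' ≤ E) {W' : Tower T P'}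
    (p : Σ a : Arrow P W', Fin a.source.len) : (Arrow.toFin hE p : ℕ) = p.1.pos + p.2 := rfl

/-- Positions in different blocks are separated by the beginning of a block. -/
theorem Arrow.exists_pos_between (hE : E' ≤ E) {W' : Tower T P'}
    {p q : Σ a : Arrow P W', Fin a.source.len} (hne : p.1 ≠ q.1)
    (h : Arrow.toFin hE p < Arrow.toFin hE q) :
    (Arrow.toFin hE p : ℕ) < q.1.pos ∧ q.1.pos ≤ (Arrow.toFin hE q : ℕ) := by
  refine ⟨?_, by rw [Arrow.toFin_val]; omega⟩
  by_contra! hcon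
  have hlt : (Arrow.toFin hE p : ℕ) < Arrow.toFin hE q := h
  rw [Arrow.toFin_val hE q] at hlt
  have hq := q.2.2
  have : p = ⟨q.1, ⟨Arrow.toFin hE p - q.1.pos, by omega⟩⟩ := by
    apply Arrow.toFin_injective hE
    apply Fin.ext
    rw [Arrow.toFin_val hE ⟨q.1, _⟩]
    dsimp only
    omega
  exact hne (congrArg (fun r => r.1) this)

/-- The function `f` has constant values on the relevant levels of the towers. -/
def IsAdapted (P : Finpartition Eᶜ) (f : FunctionAlgebra T K) (i : ℤ) : Prop :=
  ∀ (W : Tower T P) (p q : ℕ), p < W.len → q < W.len → (p : ℤ) - q = i →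
    ∀ x ∈ W.base, ∀ z ∈ W.base, f ((T ^ (p : ℤ)) x) = f ((T ^ (p : ℤ)) z)

theorem connect_toFin (hE : E' ≤ E) (href : ∀ Z' ∈ cells P', ∃ Z ∈ cells P, Z' ≤ Z)
    (x : LevelRing T P K) (W' : Tower T P') (p q : Σ a : Arrow P W', Fin a.source.len) :
    connect T K P P' hE href x W' (Arrow.toFin hE p) (Arrow.toFin hE q) =
      Matrix.blockDiagonal' (fun a : Arrow P W' => x a.source) p q := by
  change connect T K P P' hE href x W' (Arrow.blocks hE href W' p) (Arrow.blocks hE href W' q) = _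
  rw [connect_apply, Matrix.reindex_apply, Matrix.submatrix_apply, Equiv.symm_apply_apply,
    Equiv.symm_apply_apply]

/-- Inside a diagonal block both matrices evaluate f on the same level of the source tower, at
possibly different points, and adaptedness makes the values equal. Between different blocks the
first matrix is zero, so a nonzero entry comes from the compression to the finer tower. -/
theorem connect_compress_sub_toFin (hE : E' ≤ E)
    (href : ∀ Z' ∈ cells P', ∃ Z ∈ cells P, Z' ≤ Z) {f : FunctionAlgebra T K} {i : ℤ}
    (hf : IsAdapted P f i) (W' : Tower T P') (p q : Σ a : Arrow P W', Fin a.source.len)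
    (h : connect T K P P' hE href (compress P (monomial T K f i)) W'
        (Arrow.toFin hE p) (Arrow.toFin hE q) -
      compress P' (monomial T K f i) W' (Arrow.toFin hE p) (Arrow.toFin hE q) ≠ 0) :
    p.1 ≠ q.1 ∧ ((Arrow.toFin hE p : ℕ) : ℤ) - ((Arrow.toFin hE q : ℕ) : ℤ) = i ∧
      f ((T ^ ((Arrow.toFin hE p : ℕ) : ℤ)) W'.point) ≠ 0 := by
  classical
  have hne : p.1 ≠ q.1 := by
    intro hpq
    apply h
    obtain ⟨a, k⟩ := p
    obtain ⟨b, l⟩ := q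
    obtain rfl : a = b := hpq
    rw [connect_toFin, Matrix.blockDiagonal'_apply_eq, compress_monomial, compress_monomial,
      sub_eq_zero]
    by_cases hi : (k : ℤ) - (l : ℤ) = i
    · rw [if_pos hi, if_pos (by rw [Arrow.toFin_val, Arrow.toFin_val]; push_cast; linarith),
        Arrow.toFin_val, Nat.cast_add, add_comm, zpow_add_apply]
      exact hf a.source k l k.2 l.2 hi _ a.source.point_mem _ (a.mem_source W'.point_mem)
    · rw [if_neg hi, if_neg]
      intro hi'
      apply hi
      rw [Arrow.toFin_val, Arrow.toFin_val] at hi'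
      push_cast at hi'
      linarith
  rw [connect_toFin, Matrix.blockDiagonal'_apply_ne _ _ _ hne, zero_sub, neg_ne_zero,
    compress_monomial] at h
  split_ifs at h with hi
  · exact ⟨hne, hi, h⟩
  · exact absurd rfl h

theorem card_filter_near_le {n : ℕ} (c d : ℕ) :
    (Finset.univ.filter fun p : Fin n => c ≤ (p : ℕ) + d ∧ (p : ℕ) ≤ c + d).card ≤ 2 * d + 1 := by
  have h : (Finset.univ.filter fun p : Fin n => c ≤ (p : ℕ) + d ∧ (p : ℕ) ≤ c + d).card ≤
      (Finset.Icc (c - d) (c + d)).card := by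
    refine Finset.card_le_card_of_injOn (fun p => (p : ℕ)) (fun p hp => ?_)
      (fun p _ q _ h => Fin.ext h)
    have hp := (Finset.mem_filter.1 hp).2
    simp only [Finset.coe_Icc, Set.mem_Icc]
    omega
  rw [Nat.card_Icc] at h
  omega

/-- The compressions to consecutive towers differ only near the block boundaries. -/
theorem rank_connect_compress_sub_le (hE : E' ≤ E)
    (href : ∀ Z' ∈ cells P', ∃ Z ∈ cells P, Z' ≤ Z) {f : FunctionAlgebra T K} {i : ℤ}
    (hf : IsAdapted P f i) (W' : Tower T P') :
    ((connect T K P P' hE href (compress P (monomial T K f i)) -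
      compress P' (monomial T K f i)) W').rank ≤
      (Fintype.card (Arrow P W') - 1) * (2 * i.natAbs + 1) := by
  classical
  -- Some block begins at position 0, so the other beginnings, which are the interior boundaries,
  -- number at most the number of arrows minus one.
  let G : Finset (Arrow P W') := Finset.univ.filter fun a => a.pos ≠ 0
  have hG : G.card ≤ Fintype.card (Arrow P W') - 1 := by
    obtain ⟨⟨a, l⟩, ha⟩ := Arrow.toFin_surjective (W' := W') hE href ⟨0, W'.len_pos⟩
    have ha : a.pos + (l : ℕ) = 0 := congrArg Fin.val ha
    rw [← Finset.card_univ, ← Finset.card_erase_of_mem (Finset.mem_univ a)]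
    refine Finset.card_le_card fun b hb => Finset.mem_erase.2 ⟨?_, Finset.mem_univ _⟩
    rintro rfl
    exact (Finset.mem_filter.1 hb).2 (by omega)
  -- A nonzero entry of the difference joins two blocks at distance |i|. The beginning of the later
  -- block lies between its row and its column, hence within |i| of the row.
  let s : Finset (Fin W'.len) := G.biUnion fun a => Finset.univ.filter fun p : Fin W'.len =>
    a.pos ≤ (p : ℕ) + i.natAbs ∧ (p : ℕ) ≤ a.pos + i.natAbs
  have hs : s.card ≤ (Fintype.card (Arrow P W') - 1) * (2 * i.natAbs + 1) :=
    (Finset.card_biUnion_le_card_mul _ _ _ fun a _ => card_filter_near_le _ _).trans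
      (Nat.mul_le_mul_right _ hG)
  refine (Matrix.rank_le_card_of_support_subset _ s fun p hp => ?_).trans hs
  obtain ⟨q, hq⟩ := Function.ne_iff.1 hp
  obtain ⟨p, rfl⟩ := Arrow.toFin_surjective hE href p
  obtain ⟨q, rfl⟩ := Arrow.toFin_surjective hE href q
  obtain ⟨hne, hi, -⟩ := connect_compress_sub_toFin hE href hf W' p q hq
  have mem : ∀ a : Arrow P W', a.pos ≠ 0 → a.pos ≤ (Arrow.toFin hE p : ℕ) + i.natAbs →
      (Arrow.toFin hE p : ℕ) ≤ a.pos + i.natAbs → Arrow.toFin hE p ∈ (s : Set (Fin W'.len)) :=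
    fun a h1 h2 h3 => Finset.mem_coe.2 (Finset.mem_biUnion.2
      ⟨a, Finset.mem_filter.2 ⟨Finset.mem_univ _, h1⟩,
        Finset.mem_filter.2 ⟨Finset.mem_univ _, h2, h3⟩⟩)
  have hpq : Arrow.toFin hE p ≠ Arrow.toFin hE q := fun h =>
    hne (congrArg Sigma.fst (Arrow.toFin_injective hE h))
  rcases lt_or_gt_of_ne hpq with hlt | hlt
  · obtain ⟨h1, h2⟩ := Arrow.exists_pos_between hE hne hlt
    exact mem q.1 (by omega) (by omega) (by omega)
  · obtain ⟨h1, h2⟩ := Arrow.exists_pos_between hE hne.symm hlt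
    exact mem p.1 (by omega) (by omega) (by omega)

theorem char_ne_zero_iff (U : Clopens X) (x : X) :
    FunctionAlgebra.char T K U x ≠ 0 ↔ x ∈ U := by
  classical
  rw [FunctionAlgebra.char_apply]
  split_ifs with h <;> simp [h]

theorem char_eq_char_of_iff {U : Clopens X} {x z : X} (h : x ∈ U ↔ z ∈ U) :
    FunctionAlgebra.char T K U x = FunctionAlgebra.char T K U z := by
  classical
  rw [FunctionAlgebra.char_apply, FunctionAlgebra.char_apply]
  exact if_congr h rfl rfl

/-- Each level T^p(W) with p < |W| lies in a single cell. -/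
theorem isAdapted_of_const {f : FunctionAlgebra T K}
    (hf : ∀ Z ∈ cells P, ∀ x ∈ Z, ∀ z ∈ Z, f x = f z) (i : ℤ) : IsAdapted P f i := by
  intro W p q hp _ _ x hx z hz
  rcases Nat.eq_zero_or_pos p with rfl | h0
  · exact hf E (Or.inl rfl) _ (W.mem_E hx) _ (W.mem_E hz)
  · obtain ⟨j, rfl⟩ : ∃ j, p = j + 1 := ⟨p - 1, by omega⟩
    have hj : j < W.word.length := by simpa [Tower.len] using hp
    push_cast
    exact hf _ (Or.inr (W.word[j]).2) _ (((W.mem_base x).1 hx).2.1 j hj) _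
      (((W.mem_base z).1 hz).2.1 j hj)

theorem char_const_on_cells {Z : Clopens X} (hZ : Z ∈ cells P) :
    ∀ Z' ∈ cells P, ∀ x ∈ Z', ∀ z ∈ Z',
      FunctionAlgebra.char T K Z x = FunctionAlgebra.char T K Z z := by
  intro Z' hZ' x hx z hz
  refine char_eq_char_of_iff ⟨fun h => ?_, fun h => ?_⟩
  · rwa [Tower.cell_unique hZ hZ' h hx]
  · rwa [Tower.cell_unique hZ hZ' h hz]

/-- T⁻¹(Z) need not be a union of cells, but its characteristic function on level p is that of Z on
level p + 1. Adaptedness in degree -1 tests only those p for which level p + 1 still belongs to the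
tower. -/
theorem isAdapted_translate_of_const {Z : Clopens X}
    (hZ : ∀ Z' ∈ cells P, ∀ x ∈ Z', ∀ z ∈ Z',
      FunctionAlgebra.char T K Z x = FunctionAlgebra.char T K Z z) :
    IsAdapted P (FunctionAlgebra.char T K (translate T (-1) Z)) (-1) := by
  intro W p q hp hq hpq x hx z hz
  have key := isAdapted_of_const hZ 1 W q p hq hp
    (by omega) x hx z hz
  have e : ∀ x, FunctionAlgebra.char T K (translate T (-1) Z) ((T ^ (p : ℤ)) x) =
      FunctionAlgebra.char T K Z ((T ^ (q : ℤ)) x) := by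
    classical
    intro x
    rw [FunctionAlgebra.char_apply, FunctionAlgebra.char_apply]
    refine if_congr ?_ rfl rfl
    rw [mem_translate_neg, ← zpow_add_apply, show 1 + (p : ℤ) = q by omega]
  rw [e, e, key]

/-- The compressions of `f t`, where `f` vanishes on `E`, are compatible with the block diagonal embeddings. -/
theorem connect_compress_one (hE : E' ≤ E) (href : ∀ Z' ∈ cells P', ∃ Z ∈ cells P, Z' ≤ Z)
    {f : FunctionAlgebra T K} (hf : IsAdapted P f 1) (hfE : ∀ x ∈ E, f x = 0) :
    connect T K P P' hE href (compress P (monomial T K f 1)) =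
      compress P' (monomial T K f 1) := by
  funext W'
  ext p q
  by_contra hpq
  obtain ⟨p, rfl⟩ := Arrow.toFin_surjective hE href p
  obtain ⟨q, rfl⟩ := Arrow.toFin_surjective hE href q
  obtain ⟨hne, hi, h⟩ := connect_compress_sub_toFin hE href hf W' p q (sub_ne_zero.2 hpq)
  obtain ⟨h1, h2⟩ := Arrow.exists_pos_between hE hne.symm
    (show Arrow.toFin hE q < Arrow.toFin hE p by rw [Fin.lt_def]; omega)
  -- A step of length 1 between different blocks goes from the top of one block to the bottom of the
  -- next, which lies in E, where f vanishes.
  have h3 : (Arrow.toFin hE p : ℕ) = p.1.pos := by omega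
  rw [h3] at h
  exact h (hfE _ (p.1.source.mem_E (p.1.mem_source W'.point_mem)))

/-- The compressions of `f t⁻¹`, where `f` vanishes on `T⁻¹(E)`, are compatible with the block diagonal embeddings. -/
theorem connect_compress_neg_one (hE : E' ≤ E)
    (href : ∀ Z' ∈ cells P', ∃ Z ∈ cells P, Z' ≤ Z)
    {f : FunctionAlgebra T K} (hf : IsAdapted P f (-1)) (hfE : ∀ x, (T ^ (1 : ℤ)) x ∈ E → f x = 0) :
    connect T K P P' hE href (compress P (monomial T K f (-1))) =
      compress P' (monomial T K f (-1)) := by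
  funext W'
  ext p q
  by_contra hpq
  obtain ⟨p, rfl⟩ := Arrow.toFin_surjective hE href p
  obtain ⟨q, rfl⟩ := Arrow.toFin_surjective hE href q
  obtain ⟨hne, hi, h⟩ := connect_compress_sub_toFin hE href hf W' p q (sub_ne_zero.2 hpq)
  obtain ⟨h1, h2⟩ := Arrow.exists_pos_between hE hne
    (show Arrow.toFin hE p < Arrow.toFin hE q by rw [Fin.lt_def]; omega)
  apply h
  apply hfE
  -- Here row p is the top of its block, so T carries it to the bottom of the next block, inside E.
  rw [← zpow_add_apply, show 1 + ((Arrow.toFin hE p : ℕ) : ℤ) = q.1.pos by omega]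
  exact q.1.source.mem_E (q.1.mem_source W'.point_mem)

end Step
end RankCrossed

namespace RankCrossed

/-! ### The total measure of the block boundaries -/

section BaseMass

set_option linter.unusedSectionVars false

variable {X : Type*} [TopologicalSpace X] [MeasurableSpace X] [BorelSpace X]
  {T : X ≃ₜ X} {μ : Measure X} [IsProbabilityMeasure μ] {E E' : Clopens X}
  {P : Finpartition Eᶜ} {P' : Finpartition E'ᶜ} {K : Type*} [Field K]

variable (P K) in
/-- The matrix unit in the upper left corner of every block. -/
noncomputable def cornerUnit : LevelRing T P K :=
  fun W => Matrix.single ⟨0, W.len_pos⟩ ⟨0, W.len_pos⟩ 1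

theorem rank_cornerUnit (W : Tower T P) : (cornerUnit P K W).rank = 1 := by
  classical
  refine le_antisymm ?_ (Nat.one_le_iff_ne_zero.2 fun h => ?_)
  · rw [← Finset.card_singleton (⟨0, W.len_pos⟩ : Fin W.len)]
    refine Matrix.rank_le_card_of_support_subset _ _ fun p hp => ?_
    rw [Finset.coe_singleton, Set.mem_singleton_iff]
    by_contra hne
    apply hp
    funext q
    exact Matrix.single_apply_of_row_ne (Ne.symm hne) _ _ _
  · have h1 := congrFun (congrFun ((rank_eq_zero_iff _).1 h) ⟨0, W.len_pos⟩) ⟨0, W.len_pos⟩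
    simp [cornerUnit] at h1

/-- The total measure of the bases of the towers. -/
noncomputable def baseMass (T : X ≃ₜ X) (μ : Measure X) {E : Clopens X} (P : Finpartition Eᶜ) : ℝ :=
  ∑' W : Tower T P, μ.real (W.base : Set X)

theorem summable_rank (hT : Ergodic T μ) (x : LevelRing T P K) :
    Summable fun W : Tower T P => μ.real (W.base : Set X) * (x W).rank :=
  (summable_levelRank hT x).congr fun W => levelRank_term x W

theorem summable_base (hT : Ergodic T μ) :
    Summable fun W : Tower T P => μ.real (W.base : Set X) :=
  -- The base measures are the rank series of an element with all ranks 1; the field ℚ is an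
  -- arbitrary choice.
  (summable_rank hT (cornerUnit P ℚ)).congr fun W => by rw [rank_cornerUnit]; simp

theorem baseMass_nonneg : 0 ≤ baseMass T μ P := tsum_nonneg fun _ => measureReal_nonneg

theorem baseMass_le : baseMass T μ P ≤ μ.real (E : Set X) := by
  have h : ∑' W : Tower T P, μ (W.base : Set X) ≤ μ (E : Set X) := by
    rw [← measure_iUnion]
    · exact measure_mono (Set.iUnion_subset fun W x hx => W.mem_E hx)
    · intro W W' hne
      exact Set.disjoint_left.2 fun x hx hx' => hne (Tower.eq_of_mem hx hx')
    · exact fun _ => measurableSet_clopen _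
  have h1 := ENNReal.toReal_mono (measure_ne_top _ _) h
  rwa [ENNReal.tsum_toReal_eq fun W => measure_ne_top _ _] at h1

/-- A bounded rank in every tower costs at most the total measure of the bases, which are disjoint
subsets of E. -/
theorem levelRank_le_of_rank_le (hT : Ergodic T μ) {x : LevelRing T P K} {c : ℕ}
    (h : ∀ W, (x W).rank ≤ c) : levelRank μ x ≤ c * μ.real (E : Set X) := by
  rw [levelRank_eq]
  calc ∑' W : Tower T P, μ.real (W.base : Set X) * (x W).rank
      ≤ ∑' W : Tower T P, c * μ.real (W.base : Set X) :=
        (summable_rank hT x).tsum_le_tsum (fun W => by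
          rw [mul_comm]
          have := h W
          gcongr) ((summable_base hT).mul_left _)
    _ = c * baseMass T μ P := tsum_mul_left
    _ ≤ c * μ.real (E : Set X) := by gcongr; exact baseMass_le

theorem rank_connect_cornerUnit (hE : E' ≤ E) (href : ∀ Z' ∈ cells P', ∃ Z ∈ cells P, Z' ≤ Z)
    (W' : Tower T P') :
    (connect T K P P' hE href (cornerUnit P K) W').rank = Fintype.card (Arrow P W') := by
  rw [rank_connect]
  simp [rank_cornerUnit]

theorem one_le_card_arrow (hE : E' ≤ E) (href : ∀ Z' ∈ cells P', ∃ Z ∈ cells P, Z' ≤ Z)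
    (W' : Tower T P') : 1 ≤ Fintype.card (Arrow P W') := by
  obtain ⟨⟨a, -⟩, -⟩ := Arrow.toFin_surjective (W' := W') hE href ⟨0, W'.len_pos⟩
  exact Fintype.card_pos_iff.2 ⟨a⟩

/-- The image of the corner unit has rank equal to the number of arrows at each fine tower, and its
total rank is the base mass of the coarse level. Subtracting one for each fine tower leaves the
interior boundaries. The resulting difference telescopes along the levels. -/
theorem hasSum_card_arrow_sub_one (hT : Ergodic T μ) (hE : E' ≤ E)
    (href : ∀ Z' ∈ cells P', ∃ Z ∈ cells P, Z' ≤ Z) (hE' : μ (E' : Set X) ≠ 0) :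
    HasSum (fun W' : Tower T P' =>
      μ.real (W'.base : Set X) * ((Fintype.card (Arrow P W') - 1 : ℕ) : ℝ))
      (baseMass T μ P - baseMass T μ P') := by
  have h1 := (summable_rank hT (connect T ℚ P P' hE href (cornerUnit P ℚ))).hasSum
  rw [← levelRank_eq, levelRank_connect hT hE href hE', levelRank_eq] at h1
  simp only [rank_cornerUnit, rank_connect_cornerUnit, Nat.cast_one, mul_one] at h1
  refine (h1.sub (summable_base hT (P := P')).hasSum).congr_fun fun W' => ?_
  rw [Nat.cast_sub (one_le_card_arrow hE href W')]
  push_cast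
  ring

theorem baseMass_antitone (hT : Ergodic T μ) (hE : E' ≤ E)
    (href : ∀ Z' ∈ cells P', ∃ Z ∈ cells P, Z' ≤ Z) (hE' : μ (E' : Set X) ≠ 0) :
    baseMass T μ P' ≤ baseMass T μ P :=
  sub_nonneg.1 ((hasSum_card_arrow_sub_one hT hE href hE').nonneg fun W' => by positivity)

theorem levelRank_connect_compress_sub_le (hT : Ergodic T μ) (hE : E' ≤ E)
    (href : ∀ Z' ∈ cells P', ∃ Z ∈ cells P, Z' ≤ Z) (hE' : μ (E' : Set X) ≠ 0)
    {f : FunctionAlgebra T K} {i : ℤ} (hf : IsAdapted P f i) :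
    levelRank μ (connect T K P P' hE href (compress P (monomial T K f i)) -
      compress P' (monomial T K f i)) ≤
      (baseMass T μ P - baseMass T μ P') * (2 * i.natAbs + 1 : ℕ) := by
  rw [levelRank_eq]
  refine hasSum_le (fun W' => ?_) (summable_rank hT _).hasSum
    ((hasSum_card_arrow_sub_one hT hE href hE').mul_right _)
  rw [mul_assoc, ← Nat.cast_mul]
  have := rank_connect_compress_sub_le hE href hf W'
  gcongr

end BaseMass

/-! ### The homomorphism Φ as a limit of compressions -/

namespace ApproxSystem

set_option linter.unusedSectionVars false

open Filter
open scoped Topology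

variable {X : Type*} [TopologicalSpace X] [CompactSpace X] [T2Space X]
  [TotallyDisconnectedSpace X] [Infinite X] [MeasurableSpace X] [BorelSpace X]
  (S : ApproxSystem X) {T : X ≃ₜ X} {μ : Measure X} [IsProbabilityMeasure μ]
  [μ.IsOpenPosMeasure] (hT : Ergodic T μ) {K : Type*} [Field K]

variable (K) in
/-- The canonical map `R_n → R_rk`. -/
noncomputable def levelMap (n : ℕ) : S.Level T K n →+* S.RankCompletion hT K :=
  (S.toCompletion hT K).comp (S.toLimit T n).toRingHom

theorem norm_levelMap (n : ℕ) (x : S.Level T K n) : ‖S.levelMap hT K n x‖ = levelRank μ x :=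
  S.norm_toCompletion hT K _

theorem levelMap_smul (n : ℕ) (c : K) (x : S.Level T K n) :
    S.levelMap hT K n (c • x) = c • S.levelMap hT K n x := by
  change S.toCompletion hT K (S.toLimit T n (c • x)) = _
  rw [map_smul]
  exact UniformSpace.Completion.coe_smul (X := S.RankedLimit hT K) c (S.toLimit T n x)

theorem levelMap_step (n : ℕ) (x : S.Level T K n) :
    S.levelMap hT K (n + 1) (S.step T K n x) = S.levelMap hT K n x := by
  change S.toCompletion hT K (S.toLimit T (n + 1) (S.step T K n x)) =
    S.toCompletion hT K (S.toLimit T n x)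
  rw [← S.toLimit_trans n (n + 1) n.le_succ x, S.trans_succ T K n n le_rfl, S.trans_self]
  rfl

variable (K) in
/-- The approximations to the image in `R_rk` of an element of the crossed product. -/
noncomputable def approximant (n : ℕ) (a : CrossedProduct T K) : S.RankCompletion hT K :=
  S.levelMap hT K n (compress (S.P n) a)

theorem approximant_add (n : ℕ) (a b : CrossedProduct T K) :
    S.approximant hT K n (a + b) = S.approximant hT K n a + S.approximant hT K n b := by
  unfold approximant
  rw [map_add, map_add]

theorem approximant_smul (n : ℕ) (c : K) (a : CrossedProduct T K) :
    S.approximant hT K n (c • a) = c • S.approximant hT K n a := by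
  unfold approximant
  rw [map_smul, levelMap_smul]

theorem dist_approximant_succ_le {n : ℕ} {f : FunctionAlgebra T K} {i : ℤ}
    (hf : IsAdapted (S.P n) f i) :
    dist (S.approximant hT K n (monomial T K f i)) (S.approximant hT K (n + 1) (monomial T K f i)) ≤
      (baseMass T μ (S.P n) - baseMass T μ (S.P (n + 1))) * (2 * i.natAbs + 1 : ℕ) := by
  rw [dist_eq_norm]
  unfold approximant
  rw [← levelMap_step, ← map_sub, norm_levelMap]
  exact levelRank_connect_compress_sub_le hT _ _ (S.measure_E_ne_zero μ _) hf

theorem eventually_const_on_cells (f : FunctionAlgebra T K) :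
    ∃ n₀, ∀ n ≥ n₀, ∀ Z ∈ cells (S.P n), ∀ x ∈ Z, ∀ z ∈ Z, f x = f z :=
  S.exists_const_on_cells (LocallyConstant.isLocallyConstant f)

/-- For a monomial of degree i, successive distances are at most 2|i| + 1 times the decrease of the
base mass. The base masses are nonnegative and decreasing, so these distances are summable. Sums of
monomials follow by additivity. -/
theorem exists_tendsto_approximant (a : CrossedProduct T K) :
    ∃ l, Tendsto (fun n => S.approximant hT K n a) atTop (𝓝 l) := by
  induction a using SkewMonoidAlgebra.induction_on' with
  | single i f =>
    obtain ⟨i, rfl⟩ := Multiplicative.ofAdd.surjective i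
    change ∃ l, Tendsto (fun n => S.approximant hT K n (monomial T K f i)) atTop (𝓝 l)
    obtain ⟨n₀, hn₀⟩ := S.eventually_const_on_cells f
    -- The index is shifted by `n₀`, because the estimate holds only once f is constant on the
    -- cells.
    let m : ℕ → ℝ := fun n => baseMass T μ (S.P (n + n₀))
    have hm : ∀ n, 0 ≤ m n - m (n + 1) := fun n => by
      have := baseMass_antitone hT (S.antitone (n + n₀).le_succ) (S.refines (n + n₀))
        (S.measure_E_ne_zero μ _)
      rw [sub_nonneg]
      simp only [m]
      rwa [show n + 1 + n₀ = n + n₀ + 1 by ring]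
    have hsum : Summable fun n => (m n - m (n + 1)) * (2 * i.natAbs + 1 : ℕ) := by
      refine Summable.mul_right _ (summable_of_sum_range_le (c := m 0) hm fun n => ?_)
      rw [Finset.sum_range_sub']
      linarith [show 0 ≤ m n from baseMass_nonneg]
    have hc := cauchySeq_of_dist_le_of_summable
      (f := fun n => S.approximant hT K (n + n₀) (monomial T K f i)) _ (fun n => by
        have := S.dist_approximant_succ_le hT (isAdapted_of_const (T := T) (i := i)
          (hn₀ (n + n₀) (by omega)))
        rw [show n.succ + n₀ = n + n₀ + 1 by omega]
        simp only [m]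
        rwa [show n + 1 + n₀ = n + n₀ + 1 by omega]) hsum
    obtain ⟨l, hl⟩ := cauchySeq_tendsto_of_complete hc
    exact ⟨l, (tendsto_add_atTop_iff_nat n₀).1 hl⟩
  | add a b ha hb =>
    obtain ⟨l, hl⟩ := ha
    obtain ⟨l', hl'⟩ := hb
    exact ⟨l + l', (hl.add hl').congr fun n => (S.approximant_add hT n a b).symm⟩

variable (K) in
/-- The limit of the approximations. -/
noncomputable def embedFun (a : CrossedProduct T K) : S.RankCompletion hT K :=
  (S.exists_tendsto_approximant hT a).choose

theorem tendsto_approximant (a : CrossedProduct T K) :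
    Tendsto (fun n => S.approximant hT K n a) atTop (𝓝 (S.embedFun hT K a)) :=
  (S.exists_tendsto_approximant hT a).choose_spec

theorem embedFun_eq {a : CrossedProduct T K} {l : S.RankCompletion hT K}
    (h : Tendsto (fun n => S.approximant hT K n a) atTop (𝓝 l)) : S.embedFun hT K a = l :=
  tendsto_nhds_unique (S.tendsto_approximant hT a) h

theorem embedFun_add (a b : CrossedProduct T K) :
    S.embedFun hT K (a + b) = S.embedFun hT K a + S.embedFun hT K b :=
  S.embedFun_eq hT (((S.tendsto_approximant hT a).add (S.tendsto_approximant hT b)).congr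
    fun n => (S.approximant_add hT n a b).symm)

theorem embedFun_smul (c : K) (a : CrossedProduct T K) :
    S.embedFun hT K (c • a) = c • S.embedFun hT K a :=
  S.embedFun_eq hT (((S.tendsto_approximant hT a).const_smul c).congr
    fun n => (S.approximant_smul hT n c a).symm)

theorem embedFun_one : S.embedFun hT K 1 = 1 :=
  S.embedFun_eq hT (tendsto_const_nhds.congr fun n => by
    unfold approximant
    rw [compress_one, map_one])

/-- At level n the multiplicative defect has rank at most |i| in each tower, hence norm at most |i|
μ(E_n), which tends to 0. -/
theorem embedFun_monomial_mul (f g : FunctionAlgebra T K) (i j : ℤ) :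
    S.embedFun hT K (monomial T K f i * monomial T K g j) =
      S.embedFun hT K (monomial T K f i) * S.embedFun hT K (monomial T K g j) := by
  refine S.embedFun_eq hT ?_
  have h1 := (S.tendsto_approximant hT (monomial T K f i)).mul
    (S.tendsto_approximant hT (monomial T K g j))
  have h2 : Tendsto (fun n => S.approximant hT K n (monomial T K f i * monomial T K g j) -
      S.approximant hT K n (monomial T K f i) * S.approximant hT K n (monomial T K g j))
      atTop (𝓝 0) := by
    rw [tendsto_zero_iff_norm_tendsto_zero]
    have h3 := (S.tendsto_measure_E hT).const_mul (i.natAbs : ℝ)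
    rw [mul_zero] at h3
    refine squeeze_zero (fun _ => norm_nonneg _) (fun n => ?_) h3
    unfold approximant
    rw [← map_mul, ← map_sub, norm_levelMap]
    exact levelRank_le_of_rank_le hT (rank_compress_mul_sub_le f g i j)
  have h4 := h2.add h1
  rw [zero_add] at h4
  exact h4.congr fun n => sub_add_cancel _ _

theorem embedFun_mul (a b : CrossedProduct T K) :
    S.embedFun hT K (a * b) = S.embedFun hT K a * S.embedFun hT K b := by
  induction a using SkewMonoidAlgebra.induction_on' with
  | single i f =>
    induction b using SkewMonoidAlgebra.induction_on' with
    | single j g => exact S.embedFun_monomial_mul hT f g i.toAdd j.toAdd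
    | add a b ha hb => rw [mul_add, embedFun_add, ha, hb, embedFun_add, mul_add]
  | add a a' ha ha' => rw [add_mul, embedFun_add, ha, ha', embedFun_add, add_mul]

variable (K) in
/-- The homomorphism from the crossed product to the rank completion. -/
noncomputable def embed : CrossedProduct T K →ₐ[K] S.RankCompletion hT K :=
  AlgHom.ofLinearMap
    { toFun := S.embedFun hT K
      map_add' := S.embedFun_add hT
      map_smul' := S.embedFun_smul hT } (S.embedFun_one hT) (S.embedFun_mul hT)

theorem tendsto_embed (a : CrossedProduct T K) :
    Tendsto (fun n => S.approximant hT K n a) atTop (𝓝 (S.embed hT K a)) :=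
  S.tendsto_approximant hT a

/-- If the compressions of `a` are compatible from level `n` on, the image of `a` is the image of
its compression to level `n`. -/
theorem embed_eq_levelMap {a : CrossedProduct T K} {n : ℕ}
    (h : ∀ m ≥ n, S.step T K m (compress (S.P m) a) = compress (S.P (m + 1)) a) :
    S.embed hT K a = S.levelMap hT K n (compress (S.P n) a) := by
  refine tendsto_nhds_unique (S.tendsto_embed hT a) (tendsto_const_nhds.congr' ?_)
  filter_upwards [eventually_ge_atTop n] with m hm
  induction m, hm using Nat.le_induction with
  | base => rfl
  | succ m hm ih =>
    rw [ih]
    unfold approximant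
    rw [← h m hm, levelMap_step]

end ApproxSystem
end RankCrossed

namespace RankCrossed

/-! ### The matrix units e_ij(W) and the representation on the towers -/

section MatrixUnits

set_option linter.unusedSectionVars false

variable {X : Type*} [TopologicalSpace X] {T : X ≃ₜ X} {E : Clopens X} {P : Finpartition Eᶜ}
  {K : Type*} [Field K]

theorem char_mul_char (U V : Clopens X) :
    FunctionAlgebra.char T K U * FunctionAlgebra.char T K V = FunctionAlgebra.char T K (U ⊓ V) := by
  classical
  refine FunctionAlgebra.ext fun x => ?_
  rw [FunctionAlgebra.mul_apply]
  simp only [FunctionAlgebra.char_apply]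
  have h : x ∈ U ⊓ V ↔ x ∈ U ∧ x ∈ V := Iff.rfl
  by_cases hU : x ∈ U <;> by_cases hV : x ∈ V <;> simp [h, hU, hV]

theorem char_mul_eq {U V W : Clopens X} (h : ∀ x, x ∈ W ↔ x ∈ U ∧ x ∈ V) :
    FunctionAlgebra.char T K U * FunctionAlgebra.char T K V = FunctionAlgebra.char T K W := by
  rw [char_mul_char]
  congr 1
  exact SetLike.ext fun x => (h x).symm

theorem char_eq_zero {U : Clopens X} (h : ∀ x, x ∉ U) : FunctionAlgebra.char T K U = 0 := by
  classical
  refine FunctionAlgebra.ext fun x => ?_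
  rw [FunctionAlgebra.char_apply, if_neg (h x)]
  rfl

theorem monomial_zero (i : ℤ) : monomial T K 0 i = 0 := SkewMonoidAlgebra.single_zero _

theorem monomial_add (f g : FunctionAlgebra T K) (i : ℤ) :
    monomial T K (f + g) i = monomial T K f i + monomial T K g i :=
  SkewMonoidAlgebra.single_add _ _ _

theorem smul_monomial (c : K) (f : FunctionAlgebra T K) (i : ℤ) :
    c • monomial T K f i = monomial T K (c • f) i :=
  SkewMonoidAlgebra.smul_single _ _ _

theorem chi_mul_tpow (U : Clopens X) (i : ℤ) :
    chi T K U * tpow T K i = monomial T K (FunctionAlgebra.char T K U) i := by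
  unfold chi tpow
  rw [monomial_mul, smul_one, mul_one, zero_add]

theorem tpow_mul_chi_eq (U : Clopens X) (i : ℤ) :
    tpow T K i * chi T K U = monomial T K (FunctionAlgebra.char T K (translate T i U)) i := by
  rw [tpow_mul_chi, chi_mul_tpow]

theorem chi_mul_chi (U V : Clopens X) : chi T K U * chi T K V = chi T K (U ⊓ V) := by
  unfold chi
  rw [monomial_mul, ofAdd_zero, one_smul, char_mul_char, zero_add]

namespace Tower

noncomputable instance : DecidableEq (Tower T P) := Classical.decEq _

variable (W : Tower T P)

/-- The levels 1, …, i avoid E as long as i < |W|, so the factors χ_{X \ E} have no effect and only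
t^i χ_W remains. -/
theorem pow_mul_chi {i : ℕ} (hi : i < W.len) :
    (chi T K Eᶜ * tpow T K 1) ^ i * chi T K W.base =
      monomial T K (FunctionAlgebra.char T K (translate T i W.base)) i := by
  induction i with
  | zero =>
    rw [pow_zero, one_mul, chi]
    congr 2
    refine SetLike.ext fun x => ?_
    rw [mem_translate]
    rfl
  | succ i ih =>
    rw [pow_succ', mul_assoc, ih (by omega), chi_mul_tpow, monomial_mul, FunctionAlgebra.smul_char,
      show (1 : ℤ) + (i : ℤ) = ((i + 1 : ℕ) : ℤ) by push_cast; ring]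
    congr 1
    refine char_mul_eq fun x => ?_
    constructor
    · rintro ⟨z, hz, rfl⟩
      refine ⟨W.notMem_of_lt hz (Nat.succ_pos i) hi, (T ^ (i : ℤ)) z, ⟨z, hz, rfl⟩, ?_⟩
      rw [← zpow_add_apply]
      congr 2
      push_cast; ring
    · rintro ⟨-, -, ⟨z, hz, rfl⟩, rfl⟩
      refine ⟨z, hz, ?_⟩
      rw [← zpow_add_apply]
      congr 2
      push_cast; ring

theorem chi_mul_pow {j : ℕ} (hj : j < W.len) :
    chi T K W.base * (tpow T K (-1) * chi T K Eᶜ) ^ j =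
      monomial T K (FunctionAlgebra.char T K W.base) (-(j : ℤ)) := by
  induction j with
  | zero => rw [pow_zero, mul_one]; rfl
  | succ j ih =>
    rw [pow_succ, ← mul_assoc, ih (by omega), tpow_mul_chi_eq, monomial_mul,
      FunctionAlgebra.smul_char,
      show -(j : ℤ) + -1 = -((j + 1 : ℕ) : ℤ) by push_cast; ring]
    congr 1
    refine char_mul_eq fun x => ⟨fun hx => ⟨hx, ?_⟩, fun hx => hx.1⟩
    rw [mem_translate_neg, mem_translate_neg, ← zpow_add_apply]
    have := W.notMem_of_lt hx (Nat.succ_pos j) hj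
    rw [show (1 : ℤ) + (j : ℤ) = ((j + 1 : ℕ) : ℤ) by push_cast; ring]
    exact this

/-- Writing χ_W as χ_W χ_W lets the two outer powers be evaluated separately. -/
theorem e_eq (i j : Fin W.len) : W.e K i j =
    monomial T K (FunctionAlgebra.char T K (translate T ((i : ℕ) : ℤ) W.base))
      ((i : ℤ) - (j : ℤ)) := by
  have h : chi T K W.base = chi T K W.base * chi T K W.base := by
    rw [chi_mul_chi, inf_idem]
  unfold Tower.e
  rw [h, ← mul_assoc, W.pow_mul_chi i.2, mul_assoc, W.chi_mul_pow j.2, monomial_mul,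
    FunctionAlgebra.smul_char, char_mul_char, inf_idem, sub_eq_add_neg]

/-- The levels of a tower are pairwise disjoint, so the product vanishes unless the inner indices
agree. -/
theorem e_mul_e (i j k l : Fin W.len) :
    W.e K i j * W.e K k l = if j = k then W.e K i l else 0 := by
  rw [e_eq, e_eq, monomial_mul, FunctionAlgebra.smul_char]
  split_ifs with h
  · subst h
    rw [e_eq]
    congr 1
    · refine char_mul_eq fun x => ⟨fun hx => ⟨hx, ?_⟩, fun hx => hx.1⟩
      obtain ⟨z, hz, rfl⟩ := hx
      refine ⟨(T ^ ((j : ℕ) : ℤ)) z, ⟨z, hz, rfl⟩, ?_⟩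
      rw [← zpow_add_apply, sub_add_cancel]
    · ring
  · rw [char_mul_char, char_eq_zero, monomial_zero]
    rintro x ⟨⟨z, hz, rfl⟩, ⟨_, ⟨z', hz', rfl⟩, h'⟩⟩
    apply h
    have h2 : (T ^ ((j : ℕ) : ℤ)) z = (T ^ ((k : ℕ) : ℤ)) z' := by
      apply (T ^ ((i : ℤ) - (j : ℤ))).injective
      rw [h', ← zpow_add_apply, sub_add_cancel]
    exact Fin.ext (Tower.level_unique hz hz' j.2 k.2 h2).1

theorem h_eq : W.h K = ∑ i, W.e K i i := by
  refine Finset.sum_congr rfl fun i _ => ?_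
  rw [e_eq, sub_self]
  rfl

theorem e_mul_h (i j : Fin W.len) : W.e K i j * W.h K = W.e K i j := by
  rw [h_eq, Finset.mul_sum]
  simp [e_mul_e]

/-- Compression inverts the identification of the span of the e_ij(W) with matrices, and matrix
units of one tower vanish on all others. -/
theorem compress_e (i j : Fin W.len) :
    compress P (W.e K i j) = Pi.single W (Matrix.single i j (1 : K)) := by
  classical
  funext W'
  ext p q
  rw [e_eq, compress_monomial, FunctionAlgebra.char_apply]
  by_cases hW : W' = W
  · subst hW
    rw [Pi.single_eq_same, Matrix.single_apply]
    have hmem : (T ^ ((p : ℕ) : ℤ)) W'.point ∈ translate T ((i : ℕ) : ℤ) W'.base ↔ p = i := by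
      constructor
      · rintro ⟨z, hz, h⟩
        exact Fin.ext (Tower.level_unique W'.point_mem hz p.2 i.2 h.symm).1
      · rintro rfl
        exact ⟨_, W'.point_mem, rfl⟩
    rw [← ite_and]
    refine if_congr ?_ rfl rfl
    rw [hmem]
    constructor
    · rintro ⟨h1, rfl⟩
      exact ⟨rfl, Fin.ext (by omega)⟩
    · rintro ⟨rfl, rfl⟩
      exact ⟨rfl, rfl⟩
  · rw [Pi.single_eq_of_ne hW, if_neg (c := _ ∈ translate T _ _), ite_self]
    · rfl
    · rintro ⟨z, hz, h⟩
      exact hW (Tower.level_unique W'.point_mem hz p.2 i.2 h.symm).2.2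

end Tower

/-- The multiplicative defect has rank at most the absolute value of the degree of the left factor,
which is 0 here. -/
theorem compress_monomial_zero_mul (f : FunctionAlgebra T K) (a : CrossedProduct T K) :
    compress P (monomial T K f 0 * a) = compress P (monomial T K f 0) * compress P a := by
  induction a using SkewMonoidAlgebra.induction_on' with
  | single j g =>
    funext W
    have h := rank_compress_mul_sub_le f g 0 j.toAdd W
    exact sub_eq_zero.1 ((rank_eq_zero_iff _).1 (Nat.le_zero.1 h))
  | add a b ha hb => rw [mul_add, map_add, ha, hb, map_add, mul_add]

theorem compress_h (W : Tower T P) : compress P (W.h K) W = 1 := by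
  rw [Tower.h_eq, map_sum, Finset.sum_apply]
  simp only [Tower.compress_e, Pi.single_eq_same]
  exact Matrix.sum_single_one

theorem compress_h_mul (W : Tower T P) (a : CrossedProduct T K) :
    compress P (W.h K * a) W = compress P a W := by
  have h : compress P (W.h K * a) = compress P (W.h K) * compress P a := by
    unfold Tower.h chi
    rw [Finset.sum_mul, map_sum, map_sum, Finset.sum_mul]
    exact Finset.sum_congr rfl fun l _ => compress_monomial_zero_mul _ _
  rw [h, Pi.mul_apply, compress_h, one_mul]

theorem compress_sum_e (W : Tower T P) (x : Matrix (Fin W.len) (Fin W.len) K) :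
    compress P (∑ i, ∑ j, x i j • W.e K i j) = Pi.single W x := by
  simp only [map_sum, map_smul, Tower.compress_e]
  conv_rhs => rw [Matrix.matrix_eq_sum_single x]
  funext W'
  by_cases hW : W' = W
  · subst hW
    simp [Finset.sum_apply]
  · simp [Finset.sum_apply, Pi.single_eq_of_ne hW]

/-- h_W has degree 0 and compresses to the identity on W, so multiplying by it does not change the
W-component of a compression. Hence the only candidate for π_n(a) is the compression of a. -/
theorem IsImage.eq_compress {a : CrossedProduct T K} {x : LevelRing T P K} (h : IsImage a x) :
    x = compress P a := by
  funext W
  rw [← compress_h_mul, h W, compress_sum_e, Pi.single_eq_same]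

namespace IsImage

variable {a b : CrossedProduct T K} {x z : LevelRing T P K}

theorem add (ha : IsImage a x) (hb : IsImage b z) : IsImage (a + b) (x + z) := by
  intro W
  rw [mul_add, ha W, hb W]
  simp only [Pi.add_apply, Matrix.add_apply, add_smul, Finset.sum_add_distrib]

/-- Since e_ij = e_ij h_W, the product e_ij b can be expanded through h_W b. Centrality of h_W is
not needed. -/
theorem mul (ha : IsImage a x) (hb : IsImage b z) : IsImage (a * b) (x * z) := by
  intro W
  rw [← mul_assoc, ha W]
  have h1 : ∀ i j, W.e K i j * b = ∑ l, z W j l • W.e K i l := by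
    intro i j
    rw [← W.e_mul_h, mul_assoc, hb W]
    simp only [Finset.mul_sum, mul_smul_comm, Tower.e_mul_e, smul_ite, smul_zero]
    rw [Finset.sum_eq_single j]
    · simp
    · intro k _ hk
      simp [Ne.symm hk]
    · exact fun h => absurd (Finset.mem_univ j) h
  simp only [Finset.sum_mul, smul_mul_assoc, h1, Pi.mul_apply, Matrix.mul_apply, Finset.sum_smul,
    Finset.smul_sum, smul_smul]
  exact Finset.sum_congr rfl fun i _ => Finset.sum_comm

theorem of_algebraMap (c : K) : IsImage (algebraMap K (CrossedProduct T K) c)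
    (algebraMap K (LevelRing T P K) c) := by
  intro W
  rw [Algebra.algebraMap_eq_smul_one, mul_smul_comm, mul_one, Tower.h_eq, Finset.smul_sum]
  refine Finset.sum_congr rfl fun i _ => ?_
  have h : ∀ j, algebraMap K (LevelRing T P K) c W i j = if i = j then c else 0 := by
    intro j
    rw [Pi.algebraMap_apply, Matrix.algebraMap_matrix_apply]
    rfl
  simp [h]

/-- The image of a monomial whose coefficient vanishes on the levels leaving the towers. -/
theorem of_isAdapted {f : FunctionAlgebra T K} {i : ℤ} (hf : IsAdapted P f i)
    (h0 : ∀ (W : Tower T P) (l : ℕ), l < W.len → (∀ k : Fin W.len, (l : ℤ) - (k : ℤ) ≠ i) →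
      ∀ x ∈ W.base, f ((T ^ (l : ℤ)) x) = 0) :
    IsImage (monomial T K f i) (compress P (monomial T K f i)) := by
  classical
  intro W
  unfold Tower.h
  rw [Finset.sum_mul]
  refine Finset.sum_congr rfl fun l _ => ?_
  simp only [compress_monomial, Tower.e_eq]
  unfold chi
  rw [monomial_mul, ofAdd_zero, one_smul, zero_add]
  -- Either row l meets the diagonal of offset i in one column k of the tower, or it does not, and
  -- then the coefficient is zero on that level by assumption.
  by_cases hk : ∃ k : Fin W.len, (l : ℤ) - (k : ℤ) = i
  · obtain ⟨k, hk⟩ := hk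
    rw [Finset.sum_eq_single k]
    · rw [if_pos hk, hk, smul_monomial]
      congr 1
      refine FunctionAlgebra.ext fun x => ?_
      change FunctionAlgebra.char T K _ x * f x = f _ * FunctionAlgebra.char T K _ x
      rw [FunctionAlgebra.char_apply]
      split_ifs with hx
      · obtain ⟨z, hz, rfl⟩ := hx
        rw [one_mul, mul_one]
        exact hf W l k l.2 k.2 hk z hz _ W.point_mem
      · rw [zero_mul, mul_zero]
    · intro k' _ hk'
      rw [if_neg, zero_smul]
      intro h
      exact hk' (Fin.ext (by omega))
    · exact fun h => absurd (Finset.mem_univ k) h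
  · push Not at hk
    rw [Finset.sum_eq_zero fun k _ => by rw [if_neg (hk k), zero_smul]]
    have : FunctionAlgebra.char T K (translate T ((l : ℕ) : ℤ) W.base) * f = 0 := by
      refine FunctionAlgebra.ext fun x => ?_
      change FunctionAlgebra.char T K _ x * f x = 0
      rw [FunctionAlgebra.char_apply]
      split_ifs with hx
      · obtain ⟨z, hz, rfl⟩ := hx
        rw [h0 W l l.2 hk z hz, mul_zero]
      · rw [zero_mul]
    rw [this, monomial_zero]

end IsImage

end MatrixUnits

/-! ### The matrix units belong to the approximating algebra -/

section ApproxAlgebra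

set_option linter.unusedSectionVars false

variable {X : Type*} [TopologicalSpace X] {T : X ≃ₜ X} {E : Clopens X} {P : Finpartition Eᶜ}
  {K : Type*} [Field K]

theorem char_compl_eq_sum :
    FunctionAlgebra.char T K Eᶜ = ∑ Z ∈ P.parts, FunctionAlgebra.char T K Z := by
  classical
  refine FunctionAlgebra.ext fun x => ?_
  have hsum : ∀ s : Finset (Clopens X), (∑ Z ∈ s, FunctionAlgebra.char T K Z) x =
      ∑ Z ∈ s, FunctionAlgebra.char T K Z x := by
    intro s
    induction s using Finset.induction_on with
    | empty => rfl
    | insert a s ha ih =>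
      rw [Finset.sum_insert ha, Finset.sum_insert ha, FunctionAlgebra.add_apply, ih]
  rw [hsum]
  simp only [FunctionAlgebra.char_apply]
  by_cases hx : x ∈ E
  · rw [if_neg (fun h : x ∈ Eᶜ => h hx), Finset.sum_eq_zero]
    intro Z hZ
    rw [if_neg fun h => Tower.mem_parts_notMem hZ h hx]
  · obtain ⟨Z, hZ, hxZ⟩ := Tower.exists_part (P := P) hx
    rw [if_pos (show x ∈ Eᶜ from hx), Finset.sum_eq_single_of_mem Z hZ, if_pos hxZ]
    intro Z' hZ' hne
    rw [if_neg fun h => hne (Tower.cell_unique (Or.inr hZ') (Or.inr hZ) h hxZ)]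

theorem chi_compl_eq_sum : chi T K Eᶜ = ∑ Z ∈ P.parts, chi T K Z := by
  unfold chi
  rw [char_compl_eq_sum (P := P)]
  exact map_sum (AddMonoidHom.mk' (fun f => monomial T K f 0) fun f g => monomial_add f g 0) _ _

theorem chi_mul_tpow_mem {Z : Clopens X} (hZ : Z ∈ P.parts) :
    chi T K Z * tpow T K 1 ∈ approxAlgebra T K P :=
  Algebra.subset_adjoin (Or.inl ⟨Z, hZ, rfl⟩)

theorem tpow_mul_chi_mem {Z : Clopens X} (hZ : Z ∈ P.parts) :
    tpow T K (-1) * chi T K Z ∈ approxAlgebra T K P :=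
  Algebra.subset_adjoin (Or.inr ⟨Z, hZ, rfl⟩)

theorem chi_compl_mul_tpow_mem : chi T K Eᶜ * tpow T K 1 ∈ approxAlgebra T K P := by
  rw [chi_compl_eq_sum (P := P), Finset.sum_mul]
  exact sum_mem fun Z hZ => chi_mul_tpow_mem hZ

theorem tpow_mul_chi_compl_mem : tpow T K (-1) * chi T K Eᶜ ∈ approxAlgebra T K P := by
  rw [chi_compl_eq_sum (P := P), Finset.mul_sum]
  exact sum_mem fun Z hZ => tpow_mul_chi_mem hZ

theorem chi_add_chi_compl (U : Clopens X) : chi T K U + chi T K Uᶜ = 1 := by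
  classical
  unfold chi
  rw [← monomial_add]
  have : FunctionAlgebra.char T K U + FunctionAlgebra.char T K Uᶜ = 1 := by
    refine FunctionAlgebra.ext fun x => ?_
    rw [FunctionAlgebra.add_apply, FunctionAlgebra.char_apply, FunctionAlgebra.char_apply]
    by_cases hx : x ∈ U
    · rw [if_pos hx, if_neg (fun h : x ∈ Uᶜ => h hx), add_zero]; rfl
    · rw [if_neg hx, if_pos (show x ∈ Uᶜ from hx), zero_add]; rfl
  rw [this]
  rfl

/-- This is the recursion step for cylinder sets: sandwiching χ_V between two generators of A_n
yields the projection of the points whose image under T lies in Z ∩ V. -/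
theorem tpow_chi_chi_tpow (Z V : Clopens X) :
    tpow T K (-1) * chi T K Z * chi T K V * (chi T K Z * tpow T K 1) =
      chi T K (translate T (-1) (Z ⊓ V)) := by
  rw [mul_assoc _ (chi T K Z) (chi T K V), chi_mul_chi, mul_assoc, ← mul_assoc (chi T K (Z ⊓ V)),
    chi_mul_chi, ← mul_assoc, tpow_mul_chi, mul_assoc, tpow_mul_tpow, neg_add_cancel, tpow_zero,
    mul_one]
  congr 2
  rw [inf_right_comm, inf_idem]

/-- χ_{X \ E} is the product of χ_{X \ E} t and t⁻¹ χ_{X \ E}, both sums of generators; E is the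
complement. -/
theorem chi_mem : chi T K E ∈ approxAlgebra T K P := by
  have h : chi T K Eᶜ ∈ approxAlgebra T K P := by
    have := mul_mem (chi_compl_mul_tpow_mem (T := T) (K := K) (P := P))
      (tpow_mul_chi_compl_mem (T := T) (K := K) (P := P))
    rwa [mul_assoc, ← mul_assoc (tpow T K 1), tpow_mul_tpow, add_neg_cancel, tpow_zero, one_mul,
      chi_mul_chi, inf_idem] at this
  rw [eq_sub_of_add_eq (chi_add_chi_compl E)]
  exact sub_mem (one_mem _) h

/-- The points whose itinerary follows a given word and then returns to `E`. -/
def followSet (T : X ≃ₜ X) {E : Clopens X} {P : Finpartition Eᶜ} :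
    List {Z // Z ∈ P.parts} → Clopens X
  | [] => translate T (-1) E
  | Z :: w => translate T (-1) (Z.1 ⊓ followSet T w)

theorem mem_followSet (w : List {Z // Z ∈ P.parts}) (x : X) : x ∈ followSet T w ↔
    (∀ i (h : i < w.length), (T ^ ((i : ℤ) + 1)) x ∈ (w[i]).1) ∧
      (T ^ ((w.length : ℤ) + 1)) x ∈ E := by
  induction w generalizing x with
  | nil =>
    rw [followSet, mem_translate_neg]
    simp
  | cons Z w ih =>
    have h1 : x ∈ followSet T (Z :: w) ↔ (T ^ (1 : ℤ)) x ∈ Z.1 ∧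
        (T ^ (1 : ℤ)) x ∈ followSet T w := by
      rw [followSet, mem_translate_neg]; rfl
    rw [h1, ih, ← and_assoc]
    refine and_congr ⟨fun h i hi => ?_, fun h => ⟨?_, fun i hi => ?_⟩⟩ ?_
    · cases i with
      | zero => simpa using h.1
      | succ i =>
        have := h.2 i (by simpa using hi)
        rw [← zpow_add_apply] at this
        simpa using this
    · have := h 0 (by simp)
      rw [List.getElem_cons_zero] at this
      simpa using this
    · have := h (i + 1) (by simpa using hi)
      rw [← zpow_add_apply]
      simpa using this
    · rw [← zpow_add_apply]
      simp

/-- Induction on the word. It starts from χ_{T⁻¹(E)} = 1 - (t⁻¹ χ_{X \ E})(χ_{X \ E} t), and each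
further letter is one sandwich by generators. -/
theorem chi_followSet_mem (w : List {Z // Z ∈ P.parts}) :
    chi T K (followSet T w) ∈ approxAlgebra T K P := by
  induction w with
  | nil =>
    have h : chi T K (translate T (-1) E) = 1 - tpow T K (-1) * chi T K Eᶜ *
        (chi T K Eᶜ * tpow T K 1) := by
      rw [eq_sub_iff_add_eq, mul_assoc, ← mul_assoc (chi T K Eᶜ), chi_mul_chi, inf_idem,
        ← mul_assoc, tpow_mul_chi, mul_assoc, tpow_mul_tpow, neg_add_cancel, tpow_zero, mul_one,
        ← chi_add_chi_compl (T := T) (K := K) (translate T (-1) E)]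
      congr 2
      refine SetLike.ext fun x => ?_
      rw [mem_translate_neg]
      change _ ↔ ¬ x ∈ translate T (-1) E
      rw [mem_translate_neg]
      rfl
    rw [followSet, h]
    exact sub_mem (one_mem _) (mul_mem tpow_mul_chi_compl_mem chi_compl_mul_tpow_mem)
  | cons Z w ih =>
    rw [followSet, ← tpow_chi_chi_tpow]
    exact mul_mem (mul_mem (tpow_mul_chi_mem Z.2) ih) (chi_mul_tpow_mem Z.2)

theorem Tower.chi_base_mem (W : Tower T P) : chi T K W.base ∈ approxAlgebra T K P := by
  have h : W.base = E ⊓ followSet T W.word := by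
    refine SetLike.ext fun x => ?_
    change _ ↔ x ∈ E ∧ x ∈ followSet T W.word
    rw [W.mem_base, mem_followSet, Tower.len]
    push_cast
    rfl
  rw [h, ← chi_mul_chi]
  exact mul_mem chi_mem (chi_followSet_mem _)

theorem Tower.e_mem (W : Tower T P) (i j : Fin W.len) : W.e K i j ∈ approxAlgebra T K P :=
  mul_mem (mul_mem (pow_mem chi_compl_mul_tpow_mem _) W.chi_base_mem)
    (pow_mem tpow_mul_chi_compl_mem _)

end ApproxAlgebra
end RankCrossed

namespace RankCrossed

/-! ### Values of Φ on A_n, density of the image and injectivity -/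

namespace ApproxSystem

set_option linter.unusedSectionVars false

open Filter
open scoped Topology

variable {X : Type*} [TopologicalSpace X] [CompactSpace X] [T2Space X]
  [TotallyDisconnectedSpace X] [Infinite X] [MeasurableSpace X] [BorelSpace X]
  (S : ApproxSystem X) {T : X ≃ₜ X} {μ : Measure X} [IsProbabilityMeasure μ]
  [μ.IsOpenPosMeasure] (hT : Ergodic T μ) {K : Type*} [Field K]

theorem char_const_on_finer_cells {n m : ℕ} (h : n ≤ m) {Z : Clopens X}
    (hZ : Z ∈ cells (S.P n)) :
    ∀ Z' ∈ cells (S.P m), ∀ x ∈ Z', ∀ z ∈ Z',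
      FunctionAlgebra.char T K Z x = FunctionAlgebra.char T K Z z := by
  intro Z' hZ' x hx z hz
  obtain ⟨Z₁, h1, h2⟩ := S.exists_coarser_cell h hZ'
  exact char_const_on_cells hZ Z₁ h1 x (h2 hx) z (h2 hz)

/-- χ_Z vanishes on E, so χ_Z t has no entry joining the top of one block to the bottom of the next.
Its compressions from level n on are exactly compatible, and the limit is already attained at level
n. -/
theorem exists_isImage_chi_mul_tpow {n : ℕ} {Z : Clopens X} (hZ : Z ∈ (S.P n).parts) :
    ∃ x : S.Level T K n, IsImage (chi T K Z * tpow T K 1) x ∧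
      S.embed hT K (chi T K Z * tpow T K 1) = S.levelMap hT K n x := by
  have h0 : ∀ x ∈ S.E n, FunctionAlgebra.char T K Z x = 0 := fun x hx =>
    not_not.1 fun h => Tower.mem_parts_notMem hZ ((char_ne_zero_iff Z x).1 h) hx
  rw [chi_mul_tpow]
  refine ⟨compress (S.P n) _, IsImage.of_isAdapted
    (isAdapted_of_const (char_const_on_cells (Or.inr hZ)) 1) (fun W l hl hk x hx => ?_),
    S.embed_eq_levelMap hT fun m hm => connect_compress_one _ _
      (isAdapted_of_const (S.char_const_on_finer_cells hm (Or.inr hZ)) 1)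
      fun x hx => h0 x (S.antitone hm hx)⟩
  -- Only row 0 lacks the column l - 1, and level 0 lies in E.
  rcases Nat.eq_zero_or_pos l with rfl | hl0
  · exact h0 x (W.mem_E hx)
  · exact absurd (by simp only; omega) (hk ⟨l - 1, by omega⟩)

theorem exists_isImage_tpow_mul_chi {n : ℕ} {Z : Clopens X} (hZ : Z ∈ (S.P n).parts) :
    ∃ x : S.Level T K n, IsImage (tpow T K (-1) * chi T K Z) x ∧
      S.embed hT K (tpow T K (-1) * chi T K Z) = S.levelMap hT K n x := by
  have h0 : ∀ x, (T ^ (1 : ℤ)) x ∈ S.E n →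
      FunctionAlgebra.char T K (translate T (-1) Z) x = 0 := fun x hx =>
    not_not.1 fun h => Tower.mem_parts_notMem hZ
      ((mem_translate_neg T 1 Z x).1 ((char_ne_zero_iff _ x).1 h)) hx
  rw [tpow_mul_chi_eq]
  refine ⟨compress (S.P n) _, IsImage.of_isAdapted
    (isAdapted_translate_of_const (char_const_on_cells (Or.inr hZ))) (fun W l hl hk x hx => ?_),
    S.embed_eq_levelMap hT fun m hm => connect_compress_neg_one _ _
      (isAdapted_translate_of_const (S.char_const_on_finer_cells hm (Or.inr hZ)))
      fun x hx => h0 x (S.antitone hm hx)⟩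
  apply h0
  rw [← zpow_add_apply]
  -- Only the top row lacks the column l + 1, and T carries the top level into E.
  by_cases hl' : l + 1 < W.len
  · exact absurd (by simp only; push_cast; ring) (hk ⟨l + 1, hl'⟩)
  · rw [show 1 + (l : ℤ) = W.len by omega]
    exact W.mem_E_len hx

/-- On the algebra `A_n`, the homomorphism is the representation on the towers. -/
theorem exists_isImage (n : ℕ) {a : CrossedProduct T K} (ha : a ∈ approxAlgebra T K (S.P n)) :
    ∃ x : S.Level T K n, IsImage a x ∧ S.embed hT K a = S.levelMap hT K n x := by
  induction ha using Algebra.adjoin_induction with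
  | mem a ha =>
    rcases ha with ⟨Z, hZ, rfl⟩ | ⟨Z, hZ, rfl⟩
    · exact S.exists_isImage_chi_mul_tpow hT hZ
    · exact S.exists_isImage_tpow_mul_chi hT hZ
  | algebraMap c =>
    refine ⟨algebraMap K _ c, IsImage.of_algebraMap c, ?_⟩
    rw [Algebra.algebraMap_eq_smul_one, Algebra.algebraMap_eq_smul_one, levelMap_smul, map_smul,
      map_one, map_one]
  | add a b _ _ ha hb =>
    obtain ⟨x, hx, hax⟩ := ha
    obtain ⟨z, hz, hbz⟩ := hb
    exact ⟨x + z, hx.add hz, by rw [map_add, map_add, hax, hbz]⟩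
  | mul a b _ _ ha hb =>
    obtain ⟨x, hx, hax⟩ := ha
    obtain ⟨z, hz, hbz⟩ := hb
    exact ⟨x * z, hx.mul hz, by rw [map_mul, map_mul, hax, hbz]⟩

/-- The finitely supported elements of `∏_W M_{|W|}(K)` are dense. -/
theorem exists_levelRank_sub_lt (hT : Ergodic T μ) (n : ℕ) (x : S.Level T K n) {ε : ℝ} (hε : 0 < ε) :
    ∃ a ∈ approxAlgebra T K (S.P n), levelRank μ (x - compress (S.P n) a) < ε := by
  classical
  have hs := summable_rank hT x
  -- Finitely many towers carry all but ε of the rank of x, and on these x is a finite combination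
  -- of matrix units from A_n.
  obtain ⟨F, hF⟩ := (hs.hasSum.eventually (lt_mem_nhds (sub_lt_self _ hε))).exists
  refine ⟨∑ W ∈ F, ∑ i, ∑ j, x W i j • W.e K i j,
    sum_mem fun W _ => sum_mem fun i _ => sum_mem fun j _ => Subalgebra.smul_mem _ (W.e_mem i j) _,
    ?_⟩
  have hc : ∀ W, compress (S.P n) (∑ W ∈ F, ∑ i, ∑ j, x W i j • W.e K i j) W =
      if W ∈ F then x W else 0 := by
    intro W
    rw [map_sum, Finset.sum_apply]
    simp only [compress_sum_e]
    split_ifs with hW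
    · rw [Finset.sum_eq_single_of_mem W hW, Pi.single_eq_same]
      exact fun W' _ hne => Pi.single_eq_of_ne (Ne.symm hne) _
    · exact Finset.sum_eq_zero fun W' hW' => Pi.single_eq_of_ne (show W ≠ W' by rintro rfl; exact hW hW') _
  have h1 : HasSum (fun W : Tower T (S.P n) => if W ∈ F then
      μ.real (W.base : Set X) * ((x W).rank : ℝ) else 0)
      (∑ W ∈ F, μ.real (W.base : Set X) * ((x W).rank : ℝ)) := by
    rw [← Finset.sum_congr rfl fun W hW => if_pos hW]
    exact hasSum_sum_of_ne_finset_zero fun W hW => if_neg hW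
  have h2 := (hs.hasSum.sub h1).tsum_eq
  rw [levelRank_eq]
  refine lt_of_eq_of_lt (Eq.trans (tsum_congr fun W => ?_) h2) (by linarith)
  rw [Pi.sub_apply, hc]
  split_ifs
  · simp
  · simp

/-- The image of R_∞ is dense. An element of a level ring is approximated by the compression of some
a in A_n, and this compression is π_n(a), whose image in the completion is Φ(a). -/
theorem exists_embed_near (s : S.RankCompletion hT K) {ε : ℝ} (hε : 0 < ε) :
    ∃ a ∈ S.algebra T K, ‖s - S.embed hT K a‖ < ε := by
  obtain ⟨x, hx⟩ := (UniformSpace.Completion.denseRange_coe (α := S.RankedLimit hT K)).exists_dist_lt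
    s (half_pos hε)
  obtain ⟨n, b, rfl⟩ := exists_rep (S := S) (T := T) (K := K) x
  obtain ⟨a, ha, hab⟩ := S.exists_levelRank_sub_lt hT n b (half_pos hε)
  refine ⟨a, le_iSup (fun n => approxAlgebra T K (S.P n)) n ha, ?_⟩
  obtain ⟨c, hc, hac⟩ := S.exists_isImage hT n ha
  rw [hc.eq_compress] at hac
  rw [← S.norm_levelMap hT, map_sub, ← hac] at hab
  have hx : ‖s - S.levelMap hT K n b‖ < ε / 2 := by
    rw [← dist_eq_norm]
    exact hx
  calc ‖s - S.embed hT K a‖ =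
        ‖(s - S.levelMap hT K n b) + (S.levelMap hT K n b - S.embed hT K a)‖ := by
        rw [sub_add_sub_cancel]
    _ ≤ _ := norm_add_le _ _
    _ < ε := by linarith

/-- In degree 0 there are no entries off the diagonal, hence no boundary errors: from a level on
where χ_V is constant on cells the compressions are exactly compatible. So the norm of Φ(χ_V) is a
level rank, and it is nonzero because V meets some level of a tower. -/
theorem embed_chi_ne_zero {V : Clopens X} (hV : (V : Set X).Nonempty) :
    S.embed hT K (chi T K V) ≠ 0 := by
  intro h
  obtain ⟨n, hn⟩ := S.eventually_const_on_cells (FunctionAlgebra.char T K V)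
  have hstep : ∀ m ≥ n, S.step T K m (compress (S.P m) (chi T K V)) =
      compress (S.P (m + 1)) (chi T K V) := by
    intro m hm
    funext W'
    ext p q
    by_contra hpq
    obtain ⟨p, rfl⟩ := Arrow.toFin_surjective (S.antitone m.le_succ) (S.refines m) p
    obtain ⟨q, rfl⟩ := Arrow.toFin_surjective (S.antitone m.le_succ) (S.refines m) q
    obtain ⟨hne, hi, -⟩ := connect_compress_sub_toFin _ _ (isAdapted_of_const (hn m hm) 0) W' p q
      (sub_ne_zero.2 hpq)
    have hpq' : Arrow.toFin (S.antitone m.le_succ) p = Arrow.toFin (S.antitone m.le_succ) q :=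
      Fin.ext (by omega)
    exact hne (congrArg (fun r => r.1) (Arrow.toFin_injective (S.antitone m.le_succ) hpq'))
  have h0 : levelRank μ (compress (S.P n) (chi T K V)) = 0 := by
    rw [← S.norm_levelMap hT, ← S.embed_eq_levelMap hT hstep, h, norm_zero]
  have hzero := eq_zero_of_levelRank_eq_zero hT h0
  -- V has positive measure by fullness, while the points outside all levels form a null set.
  obtain ⟨x, hxV, W, z, l, hz, hl, rfl⟩ : ∃ x ∈ V, ∃ (W : Tower T (S.P n)) (z : X) (l : ℕ),
      z ∈ W.base ∧ l < W.len ∧ (T ^ (l : ℤ)) z = x := by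
    by_contra! hcon
    refine V.isOpen.measure_ne_zero μ hV (measure_mono_null ?_
      (ae_iff.1 (ae_mem_level hT (S.P n) (S.measure_E_ne_zero μ n))))
    rintro x hx ⟨W, z, l, hz, hl, h⟩
    exact hcon x hx W z l hz hl h
  have h1 := congrFun (congrFun (congrFun hzero W) ⟨l, hl⟩) ⟨l, hl⟩
  unfold chi at h1
  rw [compress_monomial, if_pos (sub_self _)] at h1
  refine (char_ne_zero_iff (T := T) (K := K) V _).2 hxV (Eq.trans ?_ h1)
  exact isAdapted_of_const (hn n le_rfl) 0 W l l hl hl (sub_self _) _ hz _ W.point_mem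

/-- Compressing a nonzero element of the crossed product to a small clopen set yields a multiple of
a characteristic function. -/
theorem exists_compression_eq_smul_chi (hT : Ergodic T μ) {a : CrossedProduct T K} (ha : a ≠ 0) :
    ∃ (b : CrossedProduct T K) (V : Clopens X) (c : K), (V : Set X).Nonempty ∧ c ≠ 0 ∧
      chi T K V * a * b = c • chi T K V := by
  classical
  obtain ⟨g, hg⟩ : ∃ g, a.coeff g ≠ 0 := by
    by_contra! h
    exact ha (SkewMonoidAlgebra.ext h)
  obtain ⟨x, hx⟩ : ∃ x, (a.coeff g) x ≠ 0 := by
    by_contra! h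
    exact hg (FunctionAlgebra.ext h)
  have hlc : IsLocallyConstant (a.coeff g).toFun := (a.coeff g).isLocallyConstant
  -- On V the coefficient of the chosen term is a nonzero constant, and V is disjoint from its
  -- translates by all nonzero differences between an exponent of a and the chosen one. Cutting down
  -- to V therefore isolates that term.
  obtain ⟨V, hV, hVx, hVd⟩ := exists_clopen_disjoint_translates hT
    (hlc.isOpen_fiber ((a.coeff g) x)) ⟨x, rfl⟩
    (a.support.sup fun i => (i.toAdd - g.toAdd).natAbs)
  refine ⟨tpow T K (-g.toAdd) * chi T K V, V, (a.coeff g) x, hV, hx, ?_⟩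
  have hsum : a = ∑ i ∈ a.support, monomial T K (a.coeff i) i.toAdd :=
    (SkewMonoidAlgebra.sum_single a).symm
  have hterm : ∀ i ∈ a.support, chi T K V * monomial T K (a.coeff i) i.toAdd *
      (tpow T K (-g.toAdd) * chi T K V) =
      if i = g then (a.coeff g) x • chi T K V else 0 := by
    intro i hi
    rw [tpow_mul_chi_eq, chi, monomial_mul, monomial_mul, ofAdd_zero, one_smul, zero_add,
      FunctionAlgebra.smul_char]
    split_ifs with hig
    · subst hig
      rw [add_neg_cancel, smul_monomial]
      congr 1
      refine FunctionAlgebra.ext fun z => ?_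
      change FunctionAlgebra.char T K V z * (a.coeff i) z * FunctionAlgebra.char T K _ z =
        (a.coeff i) x * FunctionAlgebra.char T K V z
      rw [FunctionAlgebra.char_apply, FunctionAlgebra.char_apply]
      by_cases hz : z ∈ V
      · have h1 : z ∈ translate T i.toAdd (translate T (-i.toAdd) V) := by
          rw [mem_translate, mem_translate_neg, zpow_apply_neg]
          exact hz
        have h2 : (a.coeff i) z = (a.coeff i) x := hVx hz
        rw [if_pos hz, if_pos h1, h2, one_mul]
      · simp [hz]
    · rw [← monomial_zero (T := T) (K := K) (i.toAdd + -g.toAdd)]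
      congr 1
      refine FunctionAlgebra.ext fun z => ?_
      change FunctionAlgebra.char T K V z * (a.coeff i) z * FunctionAlgebra.char T K _ z = 0
      rw [FunctionAlgebra.char_apply, FunctionAlgebra.char_apply]
      by_cases hz : z ∈ V
      · rw [if_neg (c := z ∈ translate T _ _), mul_zero]
        rw [mem_translate, mem_translate_neg, ← zpow_add_apply]
        refine hVd _ (fun h => hig ?_) ?_ z hz
        · exact Multiplicative.toAdd.injective (by omega)
        · have := Finset.le_sup (f := fun i : Multiplicative ℤ => (i.toAdd - g.toAdd).natAbs) hi
          omega
      · simp [hz]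
  have hgs : g ∈ a.support := SkewMonoidAlgebra.mem_support_iff.2 hg
  conv_lhs => rw [hsum]
  rw [Finset.mul_sum, Finset.sum_mul, Finset.sum_congr rfl hterm, Finset.sum_ite_eq', if_pos hgs]

/-- If Φ(a) = 0, then cutting a down to c χ_V with c ≠ 0 would give Φ(χ_V) = 0. -/
theorem embed_injective : Function.Injective (S.embed hT K) := by
  rw [injective_iff_map_eq_zero]
  intro a h
  by_contra ha
  obtain ⟨b, V, c, hV, hc, heq⟩ := exists_compression_eq_smul_chi hT ha
  have h1 := congrArg (S.embed hT K) heq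
  rw [map_mul, map_mul, h, mul_zero, zero_mul, map_smul] at h1
  exact (smul_ne_zero hc (S.embed_chi_ne_zero hT hV)) h1.symm

end ApproxSystem

theorem SylvesterRank.comap_elt {R R' : Type*} [Ring R] [Ring R'] (f : R →+* R')
    (N : SylvesterRank R') (x : R) : (N.comap f).elt x = N.elt (f x) := by
  change N.rk ((!![x] : Matrix (Fin 1) (Fin 1) R).map f) = N.rk !![f x]
  congr 1
  ext i j
  rw [Subsingleton.elim i 0, Subsingleton.elim j 0]
  rfl

/-- An isometric homomorphism with dense range into a complete normed ring is a completion. -/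
theorem isRankCompletion_of_norm {R R' : Type*} [Ring R] [Ring R'] [MetricSpace R']
    [CompleteSpace R'] (nrm : R' → ℝ) (hd : ∀ x y, dist x y = nrm (x - y)) {rkR : R → ℝ}
    (f : R →+* R') (hiso : ∀ x, nrm (f x) = rkR x)
    (hdense : ∀ s, ∀ ε > 0, ∃ x, nrm (s - f x) < ε) : IsRankCompletion rkR nrm f where
  isometric := hiso
  dense := hdense
  separated s hs := dist_eq_zero.1 ((hd s 0).trans (by rw [sub_zero, hs]))
  complete u hu := by
    obtain ⟨s, hs⟩ := cauchySeq_tendsto_of_complete (Metric.cauchySeq_iff.2 fun ε hε => by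
      obtain ⟨n₀, h⟩ := hu ε hε
      exact ⟨n₀, fun m hm n hn => (hd _ _).trans_lt (h m hm n hn)⟩ : CauchySeq u)
    refine ⟨s, fun ε hε => ?_⟩
    obtain ⟨n₀, h⟩ := Metric.tendsto_atTop.1 hs ε hε
    exact ⟨n₀, fun n hn => (hd _ _).symm.trans_lt (h n hn)⟩

end RankCrossed

/-! ### Assembly of the theorem -/

theorem theorem4p6 {X : Type*} [TopologicalSpace X] [CompactSpace X]
    [TopologicalSpace.MetrizableSpace X] [TotallyDisconnectedSpace X] [Infinite X]
    [MeasurableSpace X] [BorelSpace X] (T : X ≃ₜ X)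
    (μ : Measure X) [IsProbabilityMeasure μ] [μ.IsOpenPosMeasure] (hT : Ergodic T μ)
    (K : Type*) [Field K] (S : RankCrossed.ApproxSystem X) :
    -- the direct limit is a regular ring with a rank function
    (∀ x : S.Limit T K, ∃ z, x * z * x = x) ∧
    RankCrossed.IsRankFunction (S.limitRank hT K) ∧
    -- the embedding of the crossed product, and the rank function of the completion on matrices
    ∃ (Φ : RankCrossed.CrossedProduct T K →ₐ[K] S.RankCompletion hT K)
      (N : RankCrossed.SylvesterRank (S.RankCompletion hT K)),
      Function.Injective Φ ∧
      (∀ n, ∀ a ∈ RankCrossed.approxAlgebra T K (S.P n), ∃ x : S.Level T K n,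
        RankCrossed.IsImage a x ∧ Φ a = S.toCompletion hT K (S.toLimit T n x)) ∧
      (∀ s, N.elt s = ‖s‖) ∧
      -- the induced rank functions are faithful
      (N.comap Φ.toRingHom).Faithful ∧
      (N.comap (Φ.comp (S.algebra T K).val).toRingHom).Faithful ∧
      -- the rank completions
      RankCrossed.IsRankCompletion (N.comap Φ.toRingHom).elt (fun s => ‖s‖) Φ.toRingHom ∧
      RankCrossed.IsRankCompletion (N.comap (Φ.comp (S.algebra T K).val).toRingHom).elt
        (fun s => ‖s‖) (Φ.comp (S.algebra T K).val).toRingHom := by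
  obtain ⟨N, hN⟩ := S.exists_completionSylvester hT K
  have inj := S.embed_injective hT (K := K)
  refine ⟨S.exists_limit_inverse K, S.limitRank_isRankFunction hT K, S.embed hT K, N, inj,
    fun n a ha => S.exists_isImage hT n ha, hN, fun x hx => ?_, fun x hx => ?_, ?_, ?_⟩
  -- The completion is Hausdorff, so rank zero means image zero, and faithfulness reduces to
  -- injectivity of the homomorphism.
  · rw [RankCrossed.SylvesterRank.comap_elt, hN, norm_eq_zero] at hx
    exact inj (hx.trans (map_zero (S.embed hT K)).symm)
  · rw [RankCrossed.SylvesterRank.comap_elt, hN, norm_eq_zero] at hx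
    exact Subtype.ext (inj (hx.trans (map_zero (S.embed hT K)).symm))
  · refine RankCrossed.isRankCompletion_of_norm _ dist_eq_norm _ (fun x => ?_) fun s ε hε => ?_
    · rw [RankCrossed.SylvesterRank.comap_elt, hN]
    · obtain ⟨a, -, h⟩ := S.exists_embed_near hT s hε
      exact ⟨a, h⟩
  · refine RankCrossed.isRankCompletion_of_norm _ dist_eq_norm _ (fun x => ?_) fun s ε hε => ?_
    · rw [RankCrossed.SylvesterRank.comap_elt, hN]
    · obtain ⟨a, ha, h⟩ := S.exists_embed_near hT s hε
      exact ⟨⟨a, ha⟩, h⟩
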